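/- Let $n\in\mathbb{N}$, let $X$ be a normal random vector in $\mathbb{R}^n$ with mean zero and non-singular covariance matrix $\Sigma$, and let $X(1),X(2),\dots$ be independent copies of $X$. For $N\ge 1$ put $$\bar X=\frac1N\sum_{k=1}^N X(k),\qquad \bar\Sigma=\frac1N\sum_{k=1}^N X(k)X(k)^{\mathrm T}-\bar X\bar X^{\mathrm T},\qquad \tilde X^{(2)}(k)=\Sigma^{1/2}\bar\Sigma^{-1/2}\big(X(k)-\bar X\big),\quad 1\le k\le N,$$ with positive (semi)definite square roots ($\bar\Sigma$ is almost surely invertible as soon as $N\ge n+1$). Let $f:\mathbb{R}^n\to\mathbb{R}$ be a Lebesgue measurable function such that $\mathbb{E}[(1+|X|)^{8}f(X)^{2}]<\infty$. Then there is a real sequence $(A_N)$, with $A_N=1+\mathrm{O}(N^{-1/2})$ as $N\to\infty$, such that for all sufficiently large $N$ the second order moment matching estimator $\frac1N\sum_{k=1}^N f(\tilde X^{(2)}(k))$ is square integrable and $$\mathrm{Var}\Big[\frac1N\sum_{k=1}^N f(\tilde X^{(2)}(k))\Big]=\frac{A_N}{N}\Big(\mathrm{Var}[f(X)]-\mathbb{E}[Xf(X)]^{\mathrm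 T}\Sigma^{-1}\mathbb{E}[Xf(X)]-\frac12\,\mathrm{tr}\Big[\big(\mathbb{E}[(\Sigma^{-1}XX^{\mathrm T}-I)f(X)]\big)^{2}\Big]\Big).$$ The sequence $(A_N)$ and the threshold for $N$ may depend on $n$, $\Sigma$ and $f$. -/

import Mathlib

open MeasureTheory ProbabilityTheory Filter Asymptotics
open scoped MatrixOrder

namespace MomentMatching

/-- The sample mean `N⁻¹ ∑ₖ x(k)` of `N` points of `ℝⁿ`. -/
noncomputable def sampleMean {n N : ℕ} (x : Fin N → EuclideanSpace ℝ (Fin n)) :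
    EuclideanSpace ℝ (Fin n) :=
  (N : ℝ)⁻¹ • ∑ k, x k

/-- The (biased) sample covariance matrix `N⁻¹ ∑ₖ x(k) x(k)ᵀ - x̄ x̄ᵀ`. -/
noncomputable def sampleCov {n N : ℕ} (x : Fin N → EuclideanSpace ℝ (Fin n)) :
    Matrix (Fin n) (Fin n) ℝ :=
  (N : ℝ)⁻¹ • ∑ k, Matrix.vecMulVec (x k).ofLp (x k).ofLp -
    Matrix.vecMulVec (sampleMean x).ofLp (sampleMean x).ofLp

/-- The `k`-th second order moment matched sample
`S^{1/2} (sampleCov x)^{-1/2} (x(k) - x̄) + μ`, for the target mean `μ` and covariance `S`.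
The square roots are the positive semidefinite ones. -/
noncomputable def matchedSample {n N : ℕ} (μ : EuclideanSpace ℝ (Fin n))
    (S : Matrix (Fin n) (Fin n) ℝ) (x : Fin N → EuclideanSpace ℝ (Fin n)) (k : Fin N) :
    EuclideanSpace ℝ (Fin n) :=
  WithLp.toLp 2
    ((CFC.sqrt S * (CFC.sqrt (sampleCov x))⁻¹).mulVec (x k - sampleMean x).ofLp) + μ

/-- The second order moment matching estimator: the average of `f` over the second order moment
matched samples. -/
noncomputable def matchedEstimator {n N : ℕ} (f : EuclideanSpace ℝ (Fin n) → ℝ)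
    (μ : EuclideanSpace ℝ (Fin n)) (S : Matrix (Fin n) (Fin n) ℝ)
    (x : Fin N → EuclideanSpace ℝ (Fin n)) : ℝ :=
  (N : ℝ)⁻¹ * ∑ k, f (matchedSample μ S x k)

/-- The vector `E[X f(X)]`, where `X` has law `ν`. -/
noncomputable def meanXf {n : ℕ} (ν : Measure (EuclideanSpace ℝ (Fin n)))
    (f : EuclideanSpace ℝ (Fin n) → ℝ) : Fin n → ℝ :=
  fun i => ∫ x, x i * f x ∂ν

/-- The matrix `E[(S⁻¹ X Xᵀ - I) f(X)]`, where `X` has law `ν`. -/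
noncomputable def meanHessf {n : ℕ} (ν : Measure (EuclideanSpace ℝ (Fin n)))
    (S : Matrix (Fin n) (Fin n) ℝ) (f : EuclideanSpace ℝ (Fin n) → ℝ) :
    Matrix (Fin n) (Fin n) ℝ :=
  Matrix.of fun i j => ∫ x, (S⁻¹ * Matrix.vecMulVec x.ofLp x.ofLp - 1) i j * f x ∂ν

end MomentMatching

/-!
The matched samples are `S^{1/2} Yₖ`, where `Yₖ` (`stdSample`) are the samples standardized to have
sample mean `0` and sample covariance `1`. Put `φ y = f (S^{1/2} y)`, let `γ` be the standard
Gaussian measure, and let `g` be the difference of `φ` and its orthogonal projection in `L²(γ)` onto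
the polynomials of degree at most two (`exists_residual`). Since the average of such a polynomial
over the `Yₖ` is its `γ`-integral (`average_quadraticPoly`), the estimator is almost surely a
constant plus `N⁻¹ ∑ₖ g(Yₖ)` (`ae_matchedEstimator_eq`). By the Gaussian moments up to order four,
`∫ g² ∂γ` is the bracket in the asserted formula (`integral_residual_sq_eq`). It remains to see that
`N` times the variance of `N⁻¹ ∑ₖ g(Yₖ)` is `∫ g² ∂γ + O(1 / N)`
(`exists_variance_average_stdSample`).

This rests on the joint law of two standardized samples. The `n × N` matrix with columns
`N^{-1/2} Yₖ` is the adjoint of an isometry `v : ℝⁿ → ℝᴺ` whose range is orthogonal to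
`u = N^{-1/2} (1, …, 1)` (`exists_stdSample_isometry`), and rotations of `ℝᴺ` that fix `u` preserve
the law of the samples and act on `v` (`map_rotateSamples_pi`, `stdSample_rotateSamples`). So two
fixed directions of `ℝᴺ` may be replaced by a uniform random orthonormal pair in the orthogonal
complement of `u`, independent of the samples; then only the law of the components of such a pair
along the range of a fixed isometry matters, and it is computed by applying Gram-Schmidt to Gaussian
vectors (`exists_lintegral_frame`). The result, `exists_lintegral_stdSample_pair`, is that
`(Yₖ, Yₗ)`, `k ≠ l`, has with respect to `γ ⊗ γ` a density proportional to
`((1 - ‖x‖² / M)₊ (1 - ‖y‖² / M)₊ - (1 + ⟪x, y⟫)² / M²)₊ ^ p * exp ((‖x‖² + ‖y‖²) / 2)`,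
where `M = N - 1` and `2 p = M - n - 3` (`pairKernel`).

To second order this density is a product `a(x) a(y)` with `a = 1 + O(1 / M)`, minus
`(1 + ⟪x, y⟫)² / (2 M)`, up to `O(M⁻²)` times a polynomial weight (`exists_pairKernel_bound`).
Against `g(x) g(y)` the product gives `(∫ g a ∂γ)² = O(M⁻²)`, because `∫ g ∂γ = 0`, and the term of
order `1 / M` gives exactly zero, because `(1 + ⟪x, y⟫)²` is a polynomial of degree two in `x`.
Hence the covariances of `g(Yₖ)` and `g(Yₗ)` are `O(N⁻²)`, and in the variance of the average they
contribute no more than `O(N⁻²)`.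
-/

namespace MomentMatching

open scoped RealInnerProductSpace
open Module

/-! ### Densities and projections of standard Gaussian vectors -/

section StdGaussian

variable {E F : Type*} [NormedAddCommGroup E] [InnerProductSpace ℝ E] [FiniteDimensional ℝ E]
  [MeasurableSpace E] [BorelSpace E] [NormedAddCommGroup F] [InnerProductSpace ℝ F]
  [FiniteDimensional ℝ F] [MeasurableSpace F] [BorelSpace F]

variable (E) in
/-- The standard Gaussian measure has a density proportional to `exp (-‖x‖² / 2)`. -/
lemma exists_stdGaussian_eq_withDensity :
    ∃ c : ℝ, 0 < c ∧ stdGaussian E =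
      volume.withDensity fun x => ENNReal.ofReal (c * Real.exp (-‖x‖ ^ 2 / 2)) := by
  have key (w : E) := GaussianFourier.integral_cexp_neg_mul_sq_norm_add (V := E)
    (b := (1 / 2 : ℂ)) (by norm_num) Complex.I w
  have hint : Integrable (fun x : E => Real.exp (-‖x‖ ^ 2 / 2)) := by
    have := (GaussianFourier.integrable_cexp_neg_mul_sq_norm_add (V := E)
      (b := (1 / 2 : ℂ)) (by norm_num) 0 0).norm
    refine this.congr (ae_of_all _ fun x => ?_)
    simp only [Complex.norm_exp]
    congr 1
    simp [← Complex.ofReal_pow]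
    ring
  set c : ℝ := (2 * Real.pi) ^ (-(finrank ℝ E : ℝ) / 2) with hc
  have hc0 : 0 < c := by positivity
  refine ⟨c, hc0, ?_⟩
  have hfin : IsFiniteMeasure
      (volume.withDensity fun x : E => ENNReal.ofReal (c * Real.exp (-‖x‖ ^ 2 / 2))) :=
    isFiniteMeasure_withDensity_ofReal (hint.const_mul c).hasFiniteIntegral
  apply Measure.ext_of_charFun
  ext t
  rw [charFun_stdGaussian, charFun_apply,
    integral_withDensity_eq_integral_toReal_smul (by fun_prop) (by simp)]
  have h1 : ∀ x : E, (ENNReal.ofReal (c * Real.exp (-‖x‖ ^ 2 / 2))).toReal •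
      Complex.exp (⟪x, t⟫ * Complex.I) =
      (c : ℂ) * Complex.exp (-(1 / 2 : ℂ) * ‖x‖ ^ 2 + Complex.I * ⟪t, x⟫) := by
    intro x
    rw [ENNReal.toReal_ofReal (by positivity), Complex.real_smul, Complex.ofReal_mul,
      Complex.ofReal_exp, mul_assoc, ← Complex.exp_add, real_inner_comm]
    congr 2
    push_cast
    ring
  simp_rw [h1]
  rw [integral_const_mul, key, ← mul_assoc]
  have h2 : (c : ℂ) * (Real.pi / (1 / 2 : ℂ)) ^ (finrank ℝ E / 2 : ℂ) = 1 := by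
    have : (Real.pi / (1 / 2 : ℂ)) ^ (finrank ℝ E / 2 : ℂ) =
        ((2 * Real.pi) ^ ((finrank ℝ E : ℝ) / 2) : ℝ) := by
      rw [Complex.ofReal_cpow (by positivity)]
      push_cast
      congr 1
      ring
    rw [this, ← Complex.ofReal_mul, hc, ← Real.rpow_add (by positivity)]
    simp [neg_div]
  rw [h2, one_mul]
  congr 1
  simp
  ring

/-- The components of a standard Gaussian vector along a copy of `F` and along a subspace `K`
orthogonal to it are independent standard Gaussian vectors. -/
lemma map_adjoint_orthogonalProjection_stdGaussian (u : F →ₗᵢ[ℝ] E) (K : Submodule ℝ E)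
    (hK : ∀ x, ∀ k ∈ K, ⟪u x, k⟫ = 0) :
    (stdGaussian E).map (fun ξ => (u.toContinuousLinearMap.adjoint ξ, K.orthogonalProjectionOnto ξ)) =
      (stdGaussian F).prod (stdGaussian K) := by
  have : IsFiniteMeasure ((stdGaussian E).map
    (fun ξ => (u.toContinuousLinearMap.adjoint ξ, K.orthogonalProjectionOnto ξ))) := inferInstance
  rw [← charFun_eq_prod_iff]
  intro t
  obtain ⟨s, k⟩ := t
  rw [Measure.map_map (by fun_prop) (by fun_prop), charFun_apply,
    integral_map (by fun_prop) (by fun_prop)]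
  have h : ∀ x : E, ⟪(WithLp.toLp 2 ∘ fun ξ => (u.toContinuousLinearMap.adjoint ξ,
      K.orthogonalProjectionOnto ξ)) x, WithLp.toLp 2 (s, k)⟫ = ⟪x, u s + k⟫ := by
    intro x
    simp [WithLp.prod_inner_apply, ContinuousLinearMap.adjoint_inner_left, inner_add_right]
  simp_rw [h, ← charFun_apply, charFun_stdGaussian, ← Complex.exp_add]
  have h3 : ‖u s + (k : E)‖ ^ 2 = ‖s‖ ^ 2 + ‖k‖ ^ 2 := by
    rw [norm_add_sq_real, hK s k k.2]
    simp
  congr 1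
  rw [← Complex.ofReal_pow, h3]
  push_cast
  ring

end StdGaussian

/-! ### Projections of uniformly distributed unit vectors -/

section Sphere

variable {F K : Type*} [NormedAddCommGroup F] [InnerProductSpace ℝ F] [FiniteDimensional ℝ F]
  [MeasurableSpace F] [BorelSpace F] [NormedAddCommGroup K] [InnerProductSpace ℝ K]
  [FiniteDimensional ℝ K] [MeasurableSpace K] [BorelSpace K]

lemma lintegral_comp_linearMap {T : F →ₗ[ℝ] F} (hT : LinearMap.det T ≠ 0) {G : F → ENNReal}
    (hG : Measurable G) :
    ∫⁻ x, G (T x) = ENNReal.ofReal |(LinearMap.det T)⁻¹| * ∫⁻ x, G x := by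
  rw [← smul_eq_mul, ← lintegral_smul_measure, ← Measure.map_linearMap_addHaar_eq_smul_addHaar volume hT,
    lintegral_map hG (LinearMap.continuous_of_finiteDimensional T).measurable]

lemma lintegral_comp_const_smul {c : ℝ} (hc : 0 < c) {G : F → ENNReal} (hG : Measurable G) :
    ∫⁻ x, G (c • x) = ENNReal.ofReal (c ^ finrank ℝ F)⁻¹ * ∫⁻ x, G x := by
  have := lintegral_comp_linearMap (T := c • (LinearMap.id : F →ₗ[ℝ] F))
    (by simp [hc.ne']) hG
  simp only [LinearMap.det_smul, LinearMap.det_id, mul_one] at this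
  rwa [abs_of_pos (by positivity)] at this

/-- Change of variables `t = x / √(1 - ‖x‖²)` from the unit ball to the whole space. -/
lemma lintegral_eq_lintegral_ball (G : F → ENNReal) :
    ∫⁻ t, G t = ∫⁻ x in Metric.ball (0 : F) 1,
      ENNReal.ofReal ((1 - ‖x‖ ^ 2) ^ (-(finrank ℝ F : ℝ) / 2 - 1)) *
        G ((√(1 - ‖x‖ ^ 2))⁻¹ • x) := by
  have hpos : ∀ x ∈ Metric.ball (0 : F) 1, 0 < 1 - ‖x‖ ^ 2 := by
    intro x hx
    rw [mem_ball_zero_iff] at hx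
    nlinarith [norm_nonneg x]
  set f : F → F := fun x => (√(1 - ‖x‖ ^ 2))⁻¹ • x with hfdef
  -- the derivative `(1 - ‖x‖²) ^ (-1 / 2) • (1 + (1 - ‖x‖²)⁻¹ x xᵀ)`
  let f' : F → F →L[ℝ] F := fun x =>
    (√(1 - ‖x‖ ^ 2))⁻¹ • LinearMap.toContinuousLinearMap
      (LinearMap.transvection (((1 - ‖x‖ ^ 2)⁻¹ • innerSL ℝ x : F →L[ℝ] ℝ) : F →ₗ[ℝ] ℝ) x)
  have himage : f '' Metric.ball (0 : F) 1 = Set.univ :=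
    (OpenPartialHomeomorph.univUnitBall (E := F)).symm_image_target_eq_source
  have hinj : Set.InjOn f (Metric.ball (0 : F) 1) :=
    (OpenPartialHomeomorph.univUnitBall (E := F)).symm.injOn
  have hderiv : ∀ x ∈ Metric.ball (0 : F) 1,
      HasFDerivWithinAt f (f' x) (Metric.ball (0 : F) 1) x := by
    intro x hx
    have hp := hpos x hx
    have h1 : HasFDerivAt (fun x : F => 1 - ‖x‖ ^ 2) (-((2 : ℝ) • innerSL ℝ x)) x := by
      have := (hasStrictFDerivAt_norm_sq x).hasFDerivAt
      exact (this.const_sub 1).congr_fderiv (by simp [two_smul])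
    have h2 : HasDerivAt (fun y : ℝ => (√y)⁻¹)
        (-(1 / (2 * √(1 - ‖x‖ ^ 2))) / √(1 - ‖x‖ ^ 2) ^ 2) (1 - ‖x‖ ^ 2) :=
      (Real.hasDerivAt_sqrt hp.ne').inv (Real.sqrt_pos.2 hp).ne'
    have h3 := ((h2.comp_hasFDerivAt x h1).smul (hasFDerivAt_id x)).hasFDerivWithinAt
      (s := Metric.ball (0 : F) 1)
    refine h3.congr_fderiv ?_
    ext y
    have hs : √(1 - ‖x‖ ^ 2) ≠ 0 := (Real.sqrt_pos.2 hp).ne'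
    have hs2 : √(1 - ‖x‖ ^ 2) ^ 2 = 1 - ‖x‖ ^ 2 := Real.sq_sqrt hp.le
    simp only [f', Function.comp, add_apply, smul_apply,
      ContinuousLinearMap.smulRight_apply, LinearMap.coe_toContinuousLinearMap',
      LinearMap.transvection.apply, ContinuousLinearMap.coe_coe, innerSL_apply_apply, smul_eq_mul,
      neg_apply, id, ContinuousLinearMap.coe_id']
    rw [← hs2]
    match_scalars <;> field_simp
    rw [Real.sqrt_sq (Real.sqrt_nonneg _)]
  have hdet : ∀ x ∈ Metric.ball (0 : F) 1,
      |(f' x).det| = (1 - ‖x‖ ^ 2) ^ (-(finrank ℝ F : ℝ) / 2 - 1) := by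
    intro x hx
    have hp := hpos x hx
    have : (f' x).det = (√(1 - ‖x‖ ^ 2))⁻¹ ^ finrank ℝ F * (1 - ‖x‖ ^ 2)⁻¹ := by
      simp only [f', ContinuousLinearMap.det, ContinuousLinearMap.toLinearMap_smul, LinearMap.det_smul,
        LinearMap.coe_toContinuousLinearMap, LinearMap.transvection.det]
      congr 1
      simp
      field_simp
      ring
    rw [this, abs_of_pos (by positivity), Real.sqrt_eq_rpow, ← Real.rpow_neg hp.le,
      ← Real.rpow_natCast, ← Real.rpow_mul hp.le, ← Real.rpow_neg_one, ← Real.rpow_add hp]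
    congr 1
    ring
  calc ∫⁻ t, G t = ∫⁻ t in f '' Metric.ball (0 : F) 1, G t := by
        rw [himage, Measure.restrict_univ]
    _ = ∫⁻ x in Metric.ball (0 : F) 1, ENNReal.ofReal |(f' x).det| * G (f x) :=
        lintegral_image_eq_lintegral_abs_det_fderiv_mul volume measurableSet_ball hderiv hinj G
    _ = _ := setLIntegral_congr_fun measurableSet_ball fun x hx => by rw [hdet x hx]

variable (F K) in
/-- If `z` and `r` are independent standard Gaussian vectors, so that `(z, r) / ‖(z, r)‖` is
uniformly distributed on the unit sphere, then the component `z / ‖(z, r)‖` has a density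
proportional to `(1 - ‖x‖²) ^ (dim K / 2 - 1)` on the unit ball. -/
lemma exists_lintegral_sphere (hK : 0 < finrank ℝ K) :
    ∃ c : ENNReal, ∀ G : F → ENNReal, Measurable G →
      ∫⁻ r, ∫⁻ z, G ((√(‖z‖ ^ 2 + ‖r‖ ^ 2))⁻¹ • z) ∂(stdGaussian F) ∂(stdGaussian K) =
        c * ∫⁻ x in Metric.ball (0 : F) 1,
          ENNReal.ofReal ((1 - ‖x‖ ^ 2) ^ ((finrank ℝ K : ℝ) / 2 - 1)) * G x := by
  obtain ⟨a, ha, hF⟩ := exists_stdGaussian_eq_withDensity F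
  obtain ⟨b, hb, hKd⟩ := exists_stdGaussian_eq_withDensity K
  set n := finrank ℝ F
  set d := finrank ℝ K
  have : Nontrivial K := Module.nontrivial_of_finrank_pos hK
  have hr0 : ∀ᵐ r : K, r ≠ 0 := by
    simp [ae_iff]
  set J : ENNReal := ∫⁻ r : K, ENNReal.ofReal (‖r‖ ^ n * Real.exp (-‖r‖ ^ 2 / 2))
  refine ⟨ENNReal.ofReal a * ENNReal.ofReal b * J, fun G hG => ?_⟩
  -- the inner integral, after the substitution `z = ‖r‖ • t`
  have hinner : ∀ r : K, r ≠ 0 →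
      ∫⁻ z, G ((√(‖z‖ ^ 2 + ‖r‖ ^ 2))⁻¹ • z) ∂(stdGaussian F) =
      ENNReal.ofReal a * ∫⁻ t : F, ENNReal.ofReal (‖r‖ ^ n * Real.exp (-(‖r‖ ^ 2 * ‖t‖ ^ 2) / 2)) *
        G ((√(1 + ‖t‖ ^ 2))⁻¹ • t) := by
    intro r hr
    have hrp : 0 < ‖r‖ := norm_pos_iff.2 hr
    rw [hF, lintegral_withDensity_eq_lintegral_mul _ (by fun_prop) (by fun_prop)]
    have h1 := lintegral_comp_const_smul (F := F) hrp
      (G := fun z => ENNReal.ofReal (Real.exp (-‖z‖ ^ 2 / 2)) *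
        G ((√(‖z‖ ^ 2 + ‖r‖ ^ 2))⁻¹ • z)) (by fun_prop)
    have h2 : ∫⁻ z, ENNReal.ofReal (Real.exp (-‖z‖ ^ 2 / 2)) *
        G ((√(‖z‖ ^ 2 + ‖r‖ ^ 2))⁻¹ • z) = ENNReal.ofReal (‖r‖ ^ n) *
        ∫⁻ t : F, ENNReal.ofReal (Real.exp (-(‖r‖ ^ 2 * ‖t‖ ^ 2) / 2)) *
          G ((√(1 + ‖t‖ ^ 2))⁻¹ • t) := by
      have h3 : ∀ t : F, ENNReal.ofReal (Real.exp (-‖‖r‖ • t‖ ^ 2 / 2)) *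
          G ((√(‖‖r‖ • t‖ ^ 2 + ‖r‖ ^ 2))⁻¹ • ‖r‖ • t) =
          ENNReal.ofReal (Real.exp (-(‖r‖ ^ 2 * ‖t‖ ^ 2) / 2)) *
          G ((√(1 + ‖t‖ ^ 2))⁻¹ • t) := by
        intro t
        have h4 : √(‖‖r‖ • t‖ ^ 2 + ‖r‖ ^ 2) = ‖r‖ * √(1 + ‖t‖ ^ 2) := by
          rw [norm_smul, norm_norm, show (‖r‖ * ‖t‖) ^ 2 + ‖r‖ ^ 2 = ‖r‖ ^ 2 * (1 + ‖t‖ ^ 2) by ring,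
            Real.sqrt_mul (by positivity), Real.sqrt_sq hrp.le]
        rw [h4, norm_smul, norm_norm, smul_smul, mul_pow, mul_inv, mul_comm ‖r‖⁻¹, mul_assoc,
          inv_mul_cancel₀ hrp.ne', mul_one]
      simp_rw [h3] at h1
      rw [h1, ← mul_assoc, ← ENNReal.ofReal_mul (by positivity), mul_inv_cancel₀ (by positivity),
        ENNReal.ofReal_one, one_mul]
    simp_rw [Pi.mul_apply, ENNReal.ofReal_mul ha.le, mul_assoc]
    rw [lintegral_const_mul _ (by fun_prop), h2, ← lintegral_const_mul _ (by fun_prop)]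
    simp_rw [← mul_assoc, ← ENNReal.ofReal_mul (pow_nonneg hrp.le n)]
  -- the integral over `r` for fixed `t`
  have houter : ∀ t : F, ∫⁻ r : K, ENNReal.ofReal (‖r‖ ^ n *
      Real.exp (-(‖r‖ ^ 2 * ‖t‖ ^ 2) / 2)) * ENNReal.ofReal (Real.exp (-‖r‖ ^ 2 / 2)) =
      ENNReal.ofReal ((1 + ‖t‖ ^ 2) ^ (-((n : ℝ) + d) / 2)) * J := by
    intro t
    have hp : 0 < 1 + ‖t‖ ^ 2 := by positivity
    set s := √(1 + ‖t‖ ^ 2) with hs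
    have hs0 : 0 < s := Real.sqrt_pos.2 hp
    have hs2 : s ^ 2 = 1 + ‖t‖ ^ 2 := Real.sq_sqrt hp.le
    have h1 := lintegral_comp_const_smul (F := K) hs0
      (G := fun r => ENNReal.ofReal (‖r‖ ^ n * Real.exp (-‖r‖ ^ 2 / 2))) (by fun_prop)
    have h2 : ∀ r : K, ENNReal.ofReal (‖r‖ ^ n *
        Real.exp (-(‖r‖ ^ 2 * ‖t‖ ^ 2) / 2)) * ENNReal.ofReal (Real.exp (-‖r‖ ^ 2 / 2)) =
        ENNReal.ofReal (s ^ n)⁻¹ *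
        ENNReal.ofReal (‖s • r‖ ^ n * Real.exp (-‖s • r‖ ^ 2 / 2)) := by
      intro r
      rw [← ENNReal.ofReal_mul (by positivity), ← ENNReal.ofReal_mul (by positivity),
        norm_smul, Real.norm_of_nonneg hs0.le, mul_pow, mul_pow, hs2, mul_assoc, ← Real.exp_add,
        ← mul_assoc, inv_mul_cancel_left₀ (by positivity)]
      congr 3
      ring
    simp_rw [h2]
    rw [lintegral_const_mul _ (by fun_prop), h1, ← mul_assoc, ← ENNReal.ofReal_mul (by positivity)]
    congr 2
    rw [hs, Real.sqrt_eq_rpow, ← mul_inv, ← pow_add, ← Real.rpow_natCast, ← Real.rpow_mul hp.le,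
      ← Real.rpow_neg hp.le]
    congr 1
    push_cast
    ring
  calc ∫⁻ r, ∫⁻ z, G ((√(‖z‖ ^ 2 + ‖r‖ ^ 2))⁻¹ • z) ∂(stdGaussian F) ∂(stdGaussian K)
      = ∫⁻ r : K, ENNReal.ofReal (b * Real.exp (-‖r‖ ^ 2 / 2)) *
          ∫⁻ z, G ((√(‖z‖ ^ 2 + ‖r‖ ^ 2))⁻¹ • z) ∂(stdGaussian F) := by
        conv_lhs => rw [hKd]
        rw [lintegral_withDensity_eq_lintegral_mul _ (by fun_prop)]
        · rfl
        · have : Measurable fun p : K × F => G ((√(‖p.2‖ ^ 2 + ‖p.1‖ ^ 2))⁻¹ • p.2) := by fun_prop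
          exact this.lintegral_prod_right'
    _ = ∫⁻ r : K, ∫⁻ t : F, ENNReal.ofReal a * ENNReal.ofReal b * ((ENNReal.ofReal (‖r‖ ^ n *
          Real.exp (-(‖r‖ ^ 2 * ‖t‖ ^ 2) / 2)) * ENNReal.ofReal (Real.exp (-‖r‖ ^ 2 / 2))) *
          G ((√(1 + ‖t‖ ^ 2))⁻¹ • t)) := by
        refine lintegral_congr_ae (hr0.mono fun r hr => ?_)
        beta_reduce
        rw [hinner r hr, ← lintegral_const_mul _ (by fun_prop),
          ← lintegral_const_mul _ (by fun_prop), ENNReal.ofReal_mul hb.le]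
        refine lintegral_congr fun t => ?_
        ring
    _ = ∫⁻ t : F, ∫⁻ r : K, ENNReal.ofReal a * ENNReal.ofReal b * ((ENNReal.ofReal (‖r‖ ^ n *
          Real.exp (-(‖r‖ ^ 2 * ‖t‖ ^ 2) / 2)) * ENNReal.ofReal (Real.exp (-‖r‖ ^ 2 / 2))) *
          G ((√(1 + ‖t‖ ^ 2))⁻¹ • t)) := by
        apply lintegral_lintegral_swap
        fun_prop
    _ = ∫⁻ t : F, ENNReal.ofReal a * ENNReal.ofReal b * J *
          (ENNReal.ofReal ((1 + ‖t‖ ^ 2) ^ (-((n : ℝ) + d) / 2)) *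
          G ((√(1 + ‖t‖ ^ 2))⁻¹ • t)) := by
        refine lintegral_congr fun t => ?_
        rw [lintegral_const_mul _ (by fun_prop), lintegral_mul_const _ (by fun_prop), houter]
        ring
    _ = ENNReal.ofReal a * ENNReal.ofReal b * J * ∫⁻ t : F,
          (ENNReal.ofReal ((1 + ‖t‖ ^ 2) ^ (-((n : ℝ) + d) / 2)) *
          G ((√(1 + ‖t‖ ^ 2))⁻¹ • t)) := lintegral_const_mul _ (by fun_prop)
    _ = _ := by
        rw [lintegral_eq_lintegral_ball]
        congr 1
        refine setLIntegral_congr_fun measurableSet_ball fun x hx => ?_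
        have hp : 0 < 1 - ‖x‖ ^ 2 := by
          rw [mem_ball_zero_iff] at hx
          nlinarith [norm_nonneg x]
        have h1 : 1 + ‖(√(1 - ‖x‖ ^ 2))⁻¹ • x‖ ^ 2 = (1 - ‖x‖ ^ 2)⁻¹ := by
          rw [norm_smul, mul_pow, norm_inv, Real.norm_of_nonneg (Real.sqrt_nonneg _), inv_pow,
            Real.sq_sqrt hp.le]
          field_simp
          ring
        rw [h1, Real.sqrt_inv, inv_inv, smul_smul, mul_inv_cancel₀ (Real.sqrt_pos.2 hp).ne',
          one_smul, ← mul_assoc, ← ENNReal.ofReal_mul (by positivity), Real.inv_rpow hp.le,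
          ← Real.rpow_neg hp.le, ← Real.rpow_add hp]
        congr 3
        ring

end Sphere

section InvSqrt

variable {F : Type*} [NormedAddCommGroup F] [InnerProductSpace ℝ F]

/-- For a vector `x` of the open unit ball, a self-adjoint map whose square is the inverse of
`1 - x xᵀ`. -/
noncomputable def invSqrtMap (x : F) : F →ₗ[ℝ] F :=
  LinearMap.transvection
    ((√(1 - ‖x‖ ^ 2) * (1 + √(1 - ‖x‖ ^ 2)))⁻¹ • (innerSL ℝ x : F →L[ℝ] ℝ).toLinearMap) x

lemma invSqrtMap_apply (x y : F) : invSqrtMap x y =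
    y + ((√(1 - ‖x‖ ^ 2) * (1 + √(1 - ‖x‖ ^ 2)))⁻¹ * ⟪x, y⟫) • x := by
  simp [invSqrtMap, LinearMap.transvection.apply]

lemma det_invSqrtMap [FiniteDimensional ℝ F] {x : F} (hx : ‖x‖ < 1) :
    LinearMap.det (invSqrtMap x) = (√(1 - ‖x‖ ^ 2))⁻¹ := by
  have hp : 0 < 1 - ‖x‖ ^ 2 := by nlinarith [norm_nonneg x]
  have hs := Real.sqrt_pos.2 hp
  have hs2 : √(1 - ‖x‖ ^ 2) ^ 2 = 1 - ‖x‖ ^ 2 := Real.sq_sqrt hp.le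
  rw [invSqrtMap, LinearMap.transvection.det]
  simp only [LinearMap.smul_apply, ContinuousLinearMap.coe_coe, innerSL_apply_apply,
    real_inner_self_eq_norm_sq, smul_eq_mul]
  have : ‖x‖ ^ 2 = 1 - √(1 - ‖x‖ ^ 2) ^ 2 := by linarith
  rw [this, sub_sub_cancel, Real.sqrt_sq hs.le]
  field_simp
  ring

lemma inner_invSqrtMap_right {x : F} (hx : ‖x‖ < 1) (y : F) :
    ⟪x, invSqrtMap x y⟫ = (√(1 - ‖x‖ ^ 2))⁻¹ * ⟪x, y⟫ := by
  have hp : 0 < 1 - ‖x‖ ^ 2 := by nlinarith [norm_nonneg x]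
  have hs := Real.sqrt_pos.2 hp
  have hs2 : √(1 - ‖x‖ ^ 2) ^ 2 = 1 - ‖x‖ ^ 2 := Real.sq_sqrt hp.le
  rw [invSqrtMap_apply, inner_add_right, inner_smul_right, real_inner_self_eq_norm_sq]
  have : ‖x‖ ^ 2 = 1 - √(1 - ‖x‖ ^ 2) ^ 2 := by linarith
  rw [this, sub_sub_cancel, Real.sqrt_sq hs.le]
  field_simp
  ring

lemma norm_invSqrtMap_sq {x : F} (hx : ‖x‖ < 1) (y : F) :
    ‖invSqrtMap x y‖ ^ 2 = ‖y‖ ^ 2 + ⟪x, y⟫ ^ 2 / (1 - ‖x‖ ^ 2) := by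
  have hp : 0 < 1 - ‖x‖ ^ 2 := by nlinarith [norm_nonneg x]
  have hs := Real.sqrt_pos.2 hp
  have hs2 : √(1 - ‖x‖ ^ 2) ^ 2 = 1 - ‖x‖ ^ 2 := Real.sq_sqrt hp.le
  rw [invSqrtMap_apply, norm_add_sq_real, inner_smul_right, norm_smul, mul_pow, Real.norm_eq_abs,
    sq_abs, real_inner_comm x y]
  have : ‖x‖ ^ 2 = 1 - √(1 - ‖x‖ ^ 2) ^ 2 := by linarith
  rw [this, sub_sub_cancel, Real.sqrt_sq hs.le]
  field_simp
  ring

lemma inner_invSqrtMap_comm (x y z : F) : ⟪invSqrtMap x y, z⟫ = ⟪y, invSqrtMap x z⟫ := by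
  rw [invSqrtMap_apply, invSqrtMap_apply, inner_add_left, inner_add_right, inner_smul_left,
    inner_smul_right, real_inner_comm x y]
  simp
  ring

end InvSqrt

section Frame

variable {F H : Type*} [NormedAddCommGroup F] [InnerProductSpace ℝ F] [FiniteDimensional ℝ F]
  [MeasurableSpace F] [BorelSpace F] [NormedAddCommGroup H] [InnerProductSpace ℝ H]
  [FiniteDimensional ℝ H] [MeasurableSpace H] [BorelSpace H]

/-- The normalized projection of a standard Gaussian vector to `Uᗮ` is a uniform unit vector there;
its component along a copy `v` of `F` in `Uᗮ` has a density on the unit ball that depends only on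
the dimension `d` of what remains of `Uᗮ`. In particular the constant does not depend on `U` and
`v`: it is the one that normalizes the density. -/
lemma exists_lintegral_projection_sphere (d : ℕ) (hd : 2 < d) :
    ∃ c : ENNReal, ∀ (U : Submodule ℝ H) (v : F →ₗᵢ[ℝ] H),
      (∀ x, ∀ u ∈ U, ⟪v x, u⟫ = 0) → finrank ℝ F + finrank ℝ U + d = finrank ℝ H →
      ∀ G : F → ENNReal, Measurable G →
      ∫⁻ ξ, G (v.toContinuousLinearMap.adjoint
          (‖ξ - U.starProjection ξ‖⁻¹ • (ξ - U.starProjection ξ))) ∂(stdGaussian H) =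
        c * ∫⁻ x : F, ENNReal.ofReal ((max (1 - ‖x‖ ^ 2) 0) ^ ((d : ℝ) / 2 - 1)) * G x := by
  refine ⟨(∫⁻ x : F, ENNReal.ofReal ((max (1 - ‖x‖ ^ 2) 0) ^ ((d : ℝ) / 2 - 1)))⁻¹,
    fun U v hv hdim G hG => ?_⟩
  set V : Submodule ℝ H := LinearMap.range v.toLinearMap
  set K : Submodule ℝ H := (V ⊔ U)ᗮ with hKdef
  have hVU : V ≤ Uᗮ := by
    rintro _ ⟨x, rfl⟩
    rw [Submodule.mem_orthogonal']
    exact fun u hu => hv x u hu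
  have hvK : ∀ x, ∀ k ∈ K, ⟪v x, k⟫ = 0 := fun x k hk =>
    (Submodule.mem_orthogonal _ _).1 hk _ (Submodule.mem_sup_left ⟨x, rfl⟩)
  have hK : finrank ℝ K = d := by
    have h1 := Submodule.finrank_add_finrank_orthogonal (V ⊔ U)
    have h2 := Submodule.finrank_sup_add_finrank_inf_eq V U
    have h3 : V ⊓ U = ⊥ := by
      rw [eq_bot_iff]
      intro y hy
      have := (Submodule.mem_orthogonal' _ _).1 (hVU hy.1) y hy.2
      simpa using this
    have h4 : finrank ℝ V = finrank ℝ F := LinearMap.finrank_range_of_inj v.injective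
    rw [h3, finrank_bot] at h2
    rw [hKdef]
    omega
  have hUv : ∀ ξ, v.toContinuousLinearMap.adjoint (U.starProjection ξ) = 0 := by
    intro ξ
    refine ext_inner_left ℝ fun x => ?_
    rw [ContinuousLinearMap.adjoint_inner_right, inner_zero_right]
    exact hv x _ (Submodule.starProjection_apply_mem U ξ)
  have hdecomp : ∀ ξ, ξ - U.starProjection ξ =
      v (v.toContinuousLinearMap.adjoint ξ) + K.starProjection ξ := by
    intro ξ
    have hmem : ξ - (v (v.toContinuousLinearMap.adjoint ξ) + U.starProjection ξ) ∈ K := by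
      rw [hKdef, Submodule.mem_orthogonal]
      intro z hz
      obtain ⟨_, ⟨y, rfl⟩, u, hu, rfl⟩ := Submodule.mem_sup.1 hz
      have h1 : ⟪v y, ξ - (v (v.toContinuousLinearMap.adjoint ξ) + U.starProjection ξ)⟫ = 0 := by
        rw [inner_sub_right, inner_add_right, hv y _ (Submodule.starProjection_apply_mem U ξ),
          LinearIsometry.inner_map_map, ContinuousLinearMap.adjoint_inner_right]
        simp
      have h2 : ⟪u, ξ - (v (v.toContinuousLinearMap.adjoint ξ) + U.starProjection ξ)⟫ = 0 := by
        rw [← sub_sub, sub_right_comm, inner_sub_right, real_inner_comm (v _),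
          hv _ u hu, sub_zero]
        exact (Submodule.mem_orthogonal _ _).1
          (Submodule.sub_starProjection_mem_orthogonal (K := U) ξ) u hu
      rw [inner_add_left]
      exact (congrArg₂ (· + ·) h1 h2).trans (add_zero 0)
    have h3 : K.starProjection ξ =
        ξ - (v (v.toContinuousLinearMap.adjoint ξ) + U.starProjection ξ) := by
      refine Submodule.eq_starProjection_of_mem_orthogonal hmem ?_
      rw [sub_sub_cancel, hKdef, Submodule.orthogonal_orthogonal]
      exact Submodule.add_mem _ (Submodule.mem_sup_left ⟨_, rfl⟩)
        (Submodule.mem_sup_right (Submodule.starProjection_apply_mem U ξ))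
    rw [h3]
    abel
  have hnorm : ∀ ξ, ‖ξ - U.starProjection ξ‖ = √(‖v.toContinuousLinearMap.adjoint ξ‖ ^ 2 +
      ‖K.orthogonalProjectionOnto ξ‖ ^ 2) := by
    intro ξ
    rw [hdecomp, eq_comm, Real.sqrt_eq_iff_mul_self_eq (by positivity) (by positivity),
      ← sq, norm_add_sq_real, hvK _ _ (Submodule.starProjection_apply_mem K ξ)]
    have h1 : ‖K.starProjection ξ‖ = ‖K.orthogonalProjectionOnto ξ‖ := rfl
    rw [h1, LinearIsometry.norm_map]
    ring
  obtain ⟨c, hc⟩ := exists_lintegral_sphere F K (by omega)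
  have hball : ∀ G : F → ENNReal, ∫⁻ x in Metric.ball (0 : F) 1,
      ENNReal.ofReal ((1 - ‖x‖ ^ 2) ^ ((d : ℝ) / 2 - 1)) * G x =
      ∫⁻ x : F, ENNReal.ofReal ((max (1 - ‖x‖ ^ 2) 0) ^ ((d : ℝ) / 2 - 1)) * G x := by
    intro G
    rw [← lintegral_indicator measurableSet_ball]
    refine lintegral_congr fun x => ?_
    have hp : (0 : ℝ) < (d : ℝ) / 2 - 1 := by
      have : (2 : ℝ) < d := by exact_mod_cast hd
      linarith
    by_cases hx : x ∈ Metric.ball (0 : F) 1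
    · rw [Set.indicator_of_mem hx, max_eq_left]
      rw [mem_ball_zero_iff] at hx
      nlinarith [norm_nonneg x]
    · rw [Set.indicator_of_notMem hx, max_eq_right, Real.zero_rpow hp.ne']
      · simp
      · rw [mem_ball_zero_iff] at hx
        nlinarith [norm_nonneg x]
  simp only [hK, hball] at hc
  have hc1 : c * ∫⁻ x : F, ENNReal.ofReal ((max (1 - ‖x‖ ^ 2) 0) ^ ((d : ℝ) / 2 - 1)) = 1 := by
    have := hc (fun _ => 1) measurable_const
    simpa using this.symm
  have hprod := lintegral_prod_symm' (μ := stdGaussian F) (ν := stdGaussian K)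
    (f := fun p => G ((√(‖p.1‖ ^ 2 + ‖p.2‖ ^ 2))⁻¹ • p.1)) (by fun_prop)
  rw [← ENNReal.eq_inv_of_mul_eq_one_left hc1, ← hc G hG, ← hprod,
    ← map_adjoint_orthogonalProjection_stdGaussian v K hvK, lintegral_map]
  · refine lintegral_congr fun ξ => ?_
    rw [map_smul, map_sub, hUv, sub_zero, hnorm]
  · fun_prop
  · fun_prop

end Frame

/-! ### Projections of random orthonormal pairs -/

section TwoFrame

variable {F H : Type*} [NormedAddCommGroup F] [InnerProductSpace ℝ F]
  [NormedAddCommGroup H] [InnerProductSpace ℝ H]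

/-- The unit vector in the direction of `x`, and `0` for `x = 0`. -/
noncomputable def unitVec (x : H) : H := ‖x‖⁻¹ • x

/-- The component of `ξ` orthogonal to the unit vector `a`. -/
noncomputable def orthPart (a ξ : H) : H := ξ - ⟪a, ξ⟫ • a

lemma norm_unitVec {x : H} (hx : x ≠ 0) : ‖unitVec x‖ = 1 := by
  rw [unitVec, norm_smul, norm_inv, norm_norm, inv_mul_cancel₀ (norm_ne_zero_iff.2 hx)]

lemma inner_orthPart_self {a : H} (ha : ‖a‖ = 1) (ξ : H) : ⟪a, orthPart a ξ⟫ = 0 := by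
  simp [orthPart, inner_sub_right, inner_smul_right, ha]

lemma inner_orthPart_of_inner_eq_zero {a b : H} (hab : ⟪b, a⟫ = 0) (ξ : H) :
    ⟪b, orthPart a ξ⟫ = ⟪b, ξ⟫ := by
  simp [orthPart, inner_sub_right, inner_smul_right, hab]

lemma inner_unitVec_eq_zero {a x : H} (h : ⟪a, x⟫ = 0) : ⟪a, unitVec x⟫ = 0 := by
  simp [unitVec, inner_smul_right, h]

lemma orthPart_eq_sub_starProjection {a : H} (ha : ‖a‖ = 1) (ξ : H) :
    orthPart a ξ = ξ - (ℝ ∙ a).starProjection ξ := by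
  rw [Submodule.starProjection_unit_singleton ℝ ha, orthPart]

lemma orthPart_orthPart_eq_sub_starProjection [FiniteDimensional ℝ H] {a b : H} (ha : ‖a‖ = 1)
    (hb : ‖b‖ = 1) (hab : ⟪a, b⟫ = 0) (ξ : H) :
    orthPart b (orthPart a ξ) = ξ - (Submodule.span ℝ {a, b}).starProjection ξ := by
  have h : (Submodule.span ℝ {a, b}).starProjection ξ = ⟪a, ξ⟫ • a + ⟪b, ξ⟫ • b := by
    refine Submodule.eq_starProjection_of_mem_orthogonal ?_ ?_
    · exact Submodule.add_mem _
        (Submodule.smul_mem _ _ (Submodule.subset_span (by simp)))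
        (Submodule.smul_mem _ _ (Submodule.subset_span (by simp)))
    · rw [Submodule.mem_orthogonal]
      intro z hz
      obtain ⟨r, s, rfl⟩ := Submodule.mem_span_pair.1 hz
      simp [inner_add_left, inner_sub_right, inner_add_right, inner_smul_left, inner_smul_right,
        ha, hb, hab, real_inner_comm a b]
      ring
  have h2 : ⟪b, orthPart a ξ⟫ = ⟪b, ξ⟫ :=
    inner_orthPart_of_inner_eq_zero (by rw [real_inner_comm, hab]) ξ
  rw [h, orthPart, h2, orthPart, sub_sub]

section Measurable

variable [MeasurableSpace H] [BorelSpace H] [FiniteDimensional ℝ H]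

@[fun_prop]
lemma measurable_unitVec : Measurable (unitVec : H → H) := by
  unfold unitVec; fun_prop

lemma Measurable.orthPart {α : Type*} [MeasurableSpace α] {f g : α → H} (hf : Measurable f)
    (hg : Measurable g) : Measurable fun x => orthPart (f x) (g x) := by
  unfold MomentMatching.orthPart; fun_prop

end Measurable

variable [FiniteDimensional ℝ F] [MeasurableSpace F] [BorelSpace F]
  [FiniteDimensional ℝ H] [MeasurableSpace H] [BorelSpace H]

/-- Almost surely, a Gaussian vector is not a multiple of `a`; here `a` may be any vector, as
`orthPart a ξ` differs from `ξ` by a multiple of `a`. -/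
lemma ae_orthPart_ne_zero {a : H} (ha : 1 < finrank ℝ H) :
    ∀ᵐ ξ ∂(stdGaussian H), orthPart a ξ ≠ 0 := by
  obtain ⟨c, -, hc⟩ := exists_stdGaussian_eq_withDensity H
  rw [hc]
  refine (withDensity_absolutelyContinuous _ _).ae_le ?_
  have h1 : (ℝ ∙ a) ≠ ⊤ := by
    intro h
    have := finrank_span_le_card (R := ℝ) ({a} : Set H)
    rw [h, finrank_top, Set.toFinset_singleton, Finset.card_singleton] at this
    omega
  have h2 := Measure.addHaar_submodule (volume : Measure H) (ℝ ∙ a) h1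
  refine measure_mono_null (fun ξ hξ => ?_) h2
  simp only [orthPart, ne_eq, Set.mem_compl_iff, Set.mem_ofPred_eq, not_not, sub_eq_zero] at hξ
  rw [SetLike.mem_coe, Submodule.mem_span_singleton]
  exact ⟨_, hξ.symm⟩

/-- The second step of the Gram-Schmidt construction of a uniform random orthonormal pair: given
the first vector `a`, a uniform unit vector orthogonal to `a` and `u₀` has a component along `F`
whose density is obtained from that on the unit ball by the linear map `(1 - x xᵀ) ^ (1 / 2)`, with
`x` the component of `a`. -/
lemma exists_lintegral_second_vector (d : ℕ) (hd : 2 < d)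
    (hdim : finrank ℝ F + 2 + d = finrank ℝ H) :
    ∃ c : ENNReal, ∀ (u₀ a : H) (v : F →ₗᵢ[ℝ] H), ‖u₀‖ = 1 → ‖a‖ = 1 → ⟪u₀, a⟫ = 0 →
      (∀ x, ⟪v x, u₀⟫ = 0) → ‖v.toContinuousLinearMap.adjoint a‖ < 1 →
      ∀ G : F → ENNReal, Measurable G →
      ∫⁻ ξ, G (v.toContinuousLinearMap.adjoint (unitVec (orthPart a (orthPart u₀ ξ))))
          ∂(stdGaussian H) =
        c * ∫⁻ w : F, ENNReal.ofReal ((√(1 - ‖v.toContinuousLinearMap.adjoint a‖ ^ 2))⁻¹ *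
          (max (1 - ‖w‖ ^ 2 - ⟪v.toContinuousLinearMap.adjoint a, w⟫ ^ 2 /
            (1 - ‖v.toContinuousLinearMap.adjoint a‖ ^ 2)) 0) ^ ((d : ℝ) / 2 - 1)) * G w := by
  obtain ⟨c, hc⟩ := exists_lintegral_projection_sphere (F := F) (H := H) d hd
  refine ⟨c, fun u₀ a v hu₀ ha hua hv hx G hG => ?_⟩
  set x := v.toContinuousLinearMap.adjoint a with hxdef
  have hp : 0 < 1 - ‖x‖ ^ 2 := by nlinarith [norm_nonneg x]
  have hs := Real.sqrt_pos.2 hp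
  have hs2 : √(1 - ‖x‖ ^ 2) ^ 2 = 1 - ‖x‖ ^ 2 := Real.sq_sqrt hp.le
  have hau : ⟪a, u₀⟫ = 0 := by rw [real_inner_comm, hua]
  have hdet : LinearMap.det (invSqrtMap x) ≠ 0 := by
    rw [det_invSqrtMap hx]; positivity
  have hxv : ∀ y, ⟪a, v y⟫ = ⟪x, y⟫ := fun y => by
    rw [hxdef, ContinuousLinearMap.adjoint_inner_left]; rfl
  -- the isometry onto the part of the range of `v` orthogonal to `a`
  let w : F →ₗ[ℝ] H := LinearMap.id.comp (v.toLinearMap.comp (invSqrtMap x)) -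
    ((innerSL ℝ a).toLinearMap.comp (v.toLinearMap.comp (invSqrtMap x))).smulRight a
  have hw : ∀ y, w y = orthPart a (v (invSqrtMap x y)) := fun y => by simp [w, orthPart]
  have hwnorm : ∀ y, ‖w y‖ = ‖y‖ := by
    intro y
    rw [← sq_eq_sq₀ (norm_nonneg _) (norm_nonneg _), hw, orthPart, norm_sub_sq_real,
      inner_smul_right, real_inner_comm a (v _), hxv, inner_invSqrtMap_right hx, v.norm_map,
      norm_invSqrtMap_sq hx, norm_smul, ha, mul_one, Real.norm_eq_abs, sq_abs, ← hs2,
      Real.sqrt_sq hs.le]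
    field_simp
    ring
  let v₂ : F →ₗᵢ[ℝ] H := ⟨w, hwnorm⟩
  have hv₂ : ∀ y, v₂ y = orthPart a (v (invSqrtMap x y)) := hw
  have horth : ∀ y, ∀ u ∈ Submodule.span ℝ {u₀, a}, ⟪v₂ y, u⟫ = 0 := by
    intro y u hu
    obtain ⟨r, s, rfl⟩ := Submodule.mem_span_pair.1 hu
    rw [inner_add_right, inner_smul_right, inner_smul_right, hv₂, real_inner_comm a,
      inner_orthPart_self ha, real_inner_comm u₀, inner_orthPart_of_inner_eq_zero hua,
      real_inner_comm, hv]
    simp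
  have hspan : finrank ℝ (Submodule.span ℝ {u₀, a}) = 2 := by
    have hli : LinearIndependent ℝ ![u₀, a] := by
      rw [LinearIndependent.pair_iff]
      intro s t hst
      have h1 := congrArg (fun z => ⟪u₀, z⟫) hst
      have h2 := congrArg (fun z => ⟪a, z⟫) hst
      simp only [inner_add_right, inner_smul_right, real_inner_self_eq_norm_sq, hu₀, ha, hua, hau,
        inner_zero_right] at h1 h2
      constructor <;> linarith
    have := finrank_span_eq_card hli
    rwa [show Set.range ![u₀, a] = {u₀, a} by ext; simp [eq_comm, or_comm],
      Fintype.card_fin] at this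
  have key := hc (Submodule.span ℝ {u₀, a}) v₂ horth (by omega)
  -- `v† = (1 - x xᵀ) ^ (1 / 2) v₂†` on the orthogonal complement of `u₀` and `a`
  have hadj : ∀ z, ⟪a, z⟫ = 0 → v₂.toContinuousLinearMap.adjoint z =
      invSqrtMap x (v.toContinuousLinearMap.adjoint z) := by
    intro z hz
    refine ext_inner_right ℝ fun y => ?_
    rw [ContinuousLinearMap.adjoint_inner_left, inner_invSqrtMap_comm,
      ContinuousLinearMap.adjoint_inner_left]
    change ⟪z, v₂ y⟫ = ⟪z, v (invSqrtMap x y)⟫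
    rw [hv₂, inner_orthPart_of_inner_eq_zero (by rw [real_inner_comm, hz])]
  let L : F ≃ₗ[ℝ] F := LinearMap.equivOfDetNeZero (invSqrtMap x) hdet
  have hL : ∀ y, L y = invSqrtMap x y := fun y => rfl
  have hLm : Measurable L.symm := (LinearMap.continuous_of_finiteDimensional
    (L.symm : F →ₗ[ℝ] F)).measurable
  have h1 := key (fun y => G (L.symm y)) (hG.comp hLm)
  have h2 : ∀ ξ, v.toContinuousLinearMap.adjoint (unitVec (orthPart a (orthPart u₀ ξ))) =
      L.symm (v₂.toContinuousLinearMap.adjoint (‖ξ - (Submodule.span ℝ {u₀, a}).starProjection ξ‖⁻¹ •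
        (ξ - (Submodule.span ℝ {u₀, a}).starProjection ξ))) := by
    intro ξ
    rw [← orthPart_orthPart_eq_sub_starProjection hu₀ ha hua, hadj, ← hL,
      LinearEquiv.symm_apply_apply, unitVec]
    rw [inner_smul_right, inner_orthPart_self ha, mul_zero]
  simp_rw [h2]
  rw [h1]
  congr 1
  have h3 := lintegral_comp_linearMap hdet
    (G := fun y => ENNReal.ofReal ((max (1 - ‖y‖ ^ 2) 0) ^ ((d : ℝ) / 2 - 1)) * G (L.symm y))
    (Measurable.mul (by fun_prop) (hG.comp hLm))
  rw [det_invSqrtMap hx, inv_inv, abs_of_pos hs] at h3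
  have h4 : ∀ y, L.symm (invSqrtMap x y) = y := fun y => by rw [← hL, LinearEquiv.symm_apply_apply]
  simp_rw [h4, norm_invSqrtMap_sq hx, ← sub_sub] at h3
  simp_rw [ENNReal.ofReal_mul (inv_nonneg.2 hs.le), mul_assoc]
  rw [lintegral_const_mul _ (by fun_prop), h3, ← mul_assoc, ← ENNReal.ofReal_mul (by positivity),
    inv_mul_cancel₀ hs.ne', ENNReal.ofReal_one, one_mul]

end TwoFrame

section TwoFrameLaw
variable {F H : Type*} [NormedAddCommGroup F] [InnerProductSpace ℝ F]
  [NormedAddCommGroup H] [InnerProductSpace ℝ H]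
  [FiniteDimensional ℝ F] [MeasurableSpace F] [BorelSpace F]
  [FiniteDimensional ℝ H] [MeasurableSpace H] [BorelSpace H]

/-- The components along `F` of a uniform random orthonormal pair in the orthogonal complement of
`u₀` have a joint density proportional to a power of `(1 - ‖x‖²) (1 - ‖w‖²) - ⟪x, w⟫²`. -/
lemma exists_lintegral_frame (d : ℕ) (hd : 2 < d) (hdim : finrank ℝ F + 2 + d = finrank ℝ H) :
    ∃ c : ENNReal, ∀ (u₀ : H) (v : F →ₗᵢ[ℝ] H), ‖u₀‖ = 1 → (∀ x, ⟪v x, u₀⟫ = 0) →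
      ∀ G : F × F → ENNReal, Measurable G →
      ∫⁻ ξ₁, ∫⁻ ξ₂, G (v.toContinuousLinearMap.adjoint (unitVec (orthPart u₀ ξ₁)),
          v.toContinuousLinearMap.adjoint
            (unitVec (orthPart (unitVec (orthPart u₀ ξ₁)) (orthPart u₀ ξ₂))))
          ∂(stdGaussian H) ∂(stdGaussian H) =
        c * ∫⁻ x : F, ∫⁻ w : F, ENNReal.ofReal
          ((max (max (1 - ‖x‖ ^ 2) 0 * (1 - ‖w‖ ^ 2) - ⟪x, w⟫ ^ 2) 0) ^ ((d : ℝ) / 2 - 1)) *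
            G (x, w) := by
  obtain ⟨c₁, hc₁⟩ := exists_lintegral_projection_sphere (F := F) (H := H) (d + 1) (by omega)
  obtain ⟨c₂, hc₂⟩ := exists_lintegral_second_vector (F := F) (H := H) d hd hdim
  have hq : (0 : ℝ) < (d : ℝ) / 2 - 1 := by
    have : (2 : ℝ) < d := by exact_mod_cast hd
    linarith
  refine ⟨c₂ * c₁, fun u₀ v hu₀ hv G hG => ?_⟩
  have hspan : ∀ x, ∀ u ∈ (ℝ ∙ u₀), ⟪v x, u⟫ = 0 := by
    intro x u hu
    obtain ⟨r, rfl⟩ := Submodule.mem_span_singleton.1 hu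
    rw [inner_smul_right, hv, mul_zero]
  have hu₀0 : u₀ ≠ 0 := by
    rintro rfl; simp at hu₀
  have key := hc₁ (ℝ ∙ u₀) v hspan (by rw [finrank_span_singleton hu₀0]; omega)
  simp_rw [← orthPart_eq_sub_starProjection hu₀] at key
  set A : H → F := fun ξ => v.toContinuousLinearMap.adjoint (unitVec (orthPart u₀ ξ)) with hA
  have hAm : Measurable A := by
    have := Measurable.orthPart (measurable_const (a := u₀)) (measurable_id (α := H))
    simp only [hA]
    fun_prop
  have hkey : ∀ G : F → ENNReal, Measurable G → ∫⁻ ξ, G (A ξ) ∂(stdGaussian H) =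
      c₁ * ∫⁻ x : F, ENNReal.ofReal ((max (1 - ‖x‖ ^ 2) 0) ^ (((d + 1 : ℕ) : ℝ) / 2 - 1)) * G x :=
    key
  have hlt : ∀ᵐ ξ ∂(stdGaussian H), ‖A ξ‖ < 1 := by
    have hS : MeasurableSet {x : F | 1 ≤ ‖x‖} := measurableSet_le measurable_const measurable_norm
    have h1 := hkey ({x | 1 ≤ ‖x‖}.indicator 1) (measurable_one.indicator hS)
    have h2 : ∀ x : F, ENNReal.ofReal ((max (1 - ‖x‖ ^ 2) 0) ^ (((d + 1 : ℕ) : ℝ) / 2 - 1)) *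
        {x : F | 1 ≤ ‖x‖}.indicator 1 x = 0 := by
      intro x
      by_cases hx : 1 ≤ ‖x‖
      · rw [max_eq_right (by nlinarith), Real.zero_rpow (by push_cast; linarith)]
        simp
      · rw [Set.indicator_of_notMem (by simpa using hx), mul_zero]
    simp_rw [h2] at h1
    rw [lintegral_zero, mul_zero] at h1
    have h3 := (lintegral_eq_zero_iff ((measurable_one.indicator hS).comp hAm)).1 h1
    filter_upwards [h3] with ξ hξ
    by_contra hcon
    rw [Function.comp_apply, Set.indicator_of_mem (by simpa using hcon)] at hξ
    simp at hξ
  let Φ : F → ENNReal := fun x => ∫⁻ w : F, ENNReal.ofReal ((√(1 - ‖x‖ ^ 2))⁻¹ *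
    (max (1 - ‖w‖ ^ 2 - ⟪x, w⟫ ^ 2 / (1 - ‖x‖ ^ 2)) 0) ^ ((d : ℝ) / 2 - 1)) * G (x, w)
  have hΦ : Measurable Φ := by
    have : Measurable fun p : F × F => ENNReal.ofReal ((√(1 - ‖p.1‖ ^ 2))⁻¹ *
      (max (1 - ‖p.2‖ ^ 2 - ⟪p.1, p.2⟫ ^ 2 / (1 - ‖p.1‖ ^ 2)) 0) ^ ((d : ℝ) / 2 - 1)) *
        G (p.1, p.2) := by fun_prop
    exact this.lintegral_prod_right'
  have hdim2 : 1 < finrank ℝ H := by omega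
  calc _ = ∫⁻ ξ₁, c₂ * Φ (A ξ₁) ∂(stdGaussian H) := by
        refine lintegral_congr_ae ?_
        filter_upwards [hlt, ae_orthPart_ne_zero (a := u₀) hdim2] with ξ₁ h1 h2
        exact hc₂ u₀ (unitVec (orthPart u₀ ξ₁)) v hu₀ (norm_unitVec h2)
          (inner_unitVec_eq_zero (inner_orthPart_self hu₀ ξ₁)) hv h1 (fun w => G (A ξ₁, w))
          (by fun_prop)
    _ = c₂ * c₁ * ∫⁻ x : F, ENNReal.ofReal
          ((max (1 - ‖x‖ ^ 2) 0) ^ (((d + 1 : ℕ) : ℝ) / 2 - 1)) * Φ x := by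
        have h1 : ∫⁻ ξ₁, c₂ * Φ (A ξ₁) ∂(stdGaussian H) = c₂ * ∫⁻ ξ₁, Φ (A ξ₁) ∂(stdGaussian H) :=
          lintegral_const_mul _ (hΦ.comp hAm)
        rw [h1, hkey Φ hΦ, mul_assoc]
    _ = _ := by
        congr 1
        refine lintegral_congr fun x => ?_
        rw [← lintegral_const_mul _ (by fun_prop)]
        refine lintegral_congr fun w => ?_
        rw [← mul_assoc, ← ENNReal.ofReal_mul (by positivity)]
        congr 2
        rcases le_or_gt 1 ‖x‖ with hx | hx
        · rw [max_eq_right (a := 1 - ‖x‖ ^ 2) (by nlinarith), Real.zero_rpow (by push_cast; linarith),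
            zero_mul, zero_mul, zero_sub, max_eq_right (by nlinarith [sq_nonneg ⟪x, w⟫]),
            Real.zero_rpow hq.ne']
        · have hp : 0 < 1 - ‖x‖ ^ 2 := by nlinarith [norm_nonneg x]
          have hs := Real.sqrt_pos.2 hp
          rw [max_eq_left (a := 1 - ‖x‖ ^ 2) hp.le]
          have h1 : max ((1 - ‖x‖ ^ 2) * (1 - ‖w‖ ^ 2) - ⟪x, w⟫ ^ 2) 0 =
              (1 - ‖x‖ ^ 2) * max (1 - ‖w‖ ^ 2 - ⟪x, w⟫ ^ 2 / (1 - ‖x‖ ^ 2)) 0 := by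
            rw [mul_max_of_nonneg _ _ hp.le, mul_zero]
            congr 1
            field_simp
          rw [h1, Real.mul_rpow hp.le (le_max_right _ _), ← mul_assoc]
          congr 1
          rw [Real.sqrt_eq_rpow, ← Real.rpow_neg hp.le, ← Real.rpow_add hp]
          congr 1
          push_cast
          ring

/-- The joint density of two standardized samples with respect to a product of standard Gaussian
measures, up to a constant factor; here `M` is one less than the number of samples. -/
noncomputable def pairKernel (M p : ℝ) (x y : F) : ℝ :=
  (max (max (1 - ‖x‖ ^ 2 / M) 0 * max (1 - ‖y‖ ^ 2 / M) 0 - (1 + ⟪x, y⟫) ^ 2 / M ^ 2) 0) ^ p *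
    Real.exp ((‖x‖ ^ 2 + ‖y‖ ^ 2) / 2)

lemma measurable_pairKernel (M p : ℝ) :
    Measurable fun z : F × F => pairKernel M p z.1 z.2 := by
  unfold pairKernel; fun_prop

omit [FiniteDimensional ℝ F] [MeasurableSpace F] [BorelSpace F] in
lemma pairKernel_nonneg (M p : ℝ) (x y : F) : 0 ≤ pairKernel M p x y := by
  unfold pairKernel; positivity

omit [FiniteDimensional ℝ F] [MeasurableSpace F] [BorelSpace F] in
/-- The substitution `X = √M x`, `Y = -x / √M + σ w` in the base of the density of the components
`(x, w)` of a random orthonormal pair. The quantity `(1 - ‖x‖²) (1 - ‖w‖²) - ⟪x, w⟫²` is the Gram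
determinant of the components orthogonal to `F`; in the new variables it becomes symmetric, with
off-diagonal Gram entry proportional to `1 + ⟪X, Y⟫`. -/
lemma frame_density_eq {M σ : ℝ} (hM : 1 < M) (hσ : σ ^ 2 = (M ^ 2 - 1) / M)
    (x y : F) :
    max (max (1 - ‖(√M)⁻¹ • x‖ ^ 2) 0 * (1 - ‖σ⁻¹ • (y + M⁻¹ • x)‖ ^ 2) -
      ⟪(√M)⁻¹ • x, σ⁻¹ • (y + M⁻¹ • x)⟫ ^ 2) 0 =
    M ^ 2 / (M ^ 2 - 1) * max (max (1 - ‖x‖ ^ 2 / M) 0 * max (1 - ‖y‖ ^ 2 / M) 0 -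
      (1 + ⟪x, y⟫) ^ 2 / M ^ 2) 0 := by
  have hM0 : 0 < M := by linarith
  have hM1 : 0 < M ^ 2 - 1 := by nlinarith
  have hsq : √M ^ 2 = M := Real.sq_sqrt hM0.le
  have h1 : ‖(√M)⁻¹ • x‖ ^ 2 = ‖x‖ ^ 2 / M := by
    rw [norm_smul, mul_pow, norm_inv, inv_pow, Real.norm_eq_abs, sq_abs, hsq]
    field_simp
  have h2 : ‖σ⁻¹ • (y + M⁻¹ • x)‖ ^ 2 =
      (‖y‖ ^ 2 + 2 * ⟪x, y⟫ / M + ‖x‖ ^ 2 / M ^ 2) * (M / (M ^ 2 - 1)) := by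
    rw [norm_smul, mul_pow, norm_inv, inv_pow, Real.norm_eq_abs, sq_abs, hσ, norm_add_sq_real,
      inner_smul_right, norm_smul, mul_pow, norm_inv, Real.norm_of_nonneg hM0.le,
      real_inner_comm x y]
    field_simp
  have h3 : ⟪(√M)⁻¹ • x, σ⁻¹ • (y + M⁻¹ • x)⟫ ^ 2 =
      (⟪x, y⟫ + ‖x‖ ^ 2 / M) ^ 2 / (M ^ 2 - 1) := by
    rw [inner_smul_left, inner_smul_right, inner_add_right, inner_smul_right,
      real_inner_self_eq_norm_sq, mul_pow, mul_pow, inv_pow, hσ]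
    simp only [conj_trivial, inv_pow, hsq]
    field_simp
  rw [h1, h2, h3]
  rcases le_or_gt M (‖x‖ ^ 2) with hx | hx
  · have h4 : 1 - ‖x‖ ^ 2 / M ≤ 0 := by
      rw [sub_nonpos, le_div_iff₀ hM0]; linarith
    rw [max_eq_right h4, zero_mul, zero_mul, max_eq_right, max_eq_right, mul_zero]
    · rw [zero_sub, neg_nonpos]; positivity
    · rw [zero_sub, neg_nonpos]; positivity
  · have h4 : 0 < 1 - ‖x‖ ^ 2 / M := by
      rw [sub_pos, div_lt_iff₀ hM0]; linarith
    have h5 : max ((1 - ‖x‖ ^ 2 / M) * max (1 - ‖y‖ ^ 2 / M) 0 - (1 + ⟪x, y⟫) ^ 2 / M ^ 2) 0 =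
        max ((1 - ‖x‖ ^ 2 / M) * (1 - ‖y‖ ^ 2 / M) - (1 + ⟪x, y⟫) ^ 2 / M ^ 2) 0 := by
      rcases le_total 0 (1 - ‖y‖ ^ 2 / M) with hy | hy
      · rw [max_eq_left hy]
      · have h6 : 0 ≤ (1 + ⟪x, y⟫) ^ 2 / M ^ 2 := by positivity
        rw [max_eq_right hy, max_eq_right (by linarith), max_eq_right]
        nlinarith
    rw [max_eq_left h4.le, h5, mul_max_of_nonneg _ _ (by positivity), mul_zero]
    congr 1
    field_simp
    ring

/-- The law of `(√M x, -x / √M + σ w)`, where `(x, w)` are the components along `F` of a uniform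
random orthonormal pair, has the density `pairKernel` up to a constant factor. -/
lemma exists_lintegral_pairKernel (d : ℕ) (hd : 2 < d) (hdim : finrank ℝ F + 2 + d = finrank ℝ H)
    {M σ : ℝ} (hM : 1 < M) (hσ : σ ^ 2 = (M ^ 2 - 1) / M) (hσ0 : 0 < σ) :
    ∃ c : ENNReal, ∀ (u₀ : H) (v : F →ₗᵢ[ℝ] H), ‖u₀‖ = 1 → (∀ x, ⟪v x, u₀⟫ = 0) →
      ∀ G : F × F → ENNReal, Measurable G →
      ∫⁻ ξ₁, ∫⁻ ξ₂, G (v.toContinuousLinearMap.adjoint (√M • unitVec (orthPart u₀ ξ₁)),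
          v.toContinuousLinearMap.adjoint ((-(√M)⁻¹) • unitVec (orthPart u₀ ξ₁) +
            σ • unitVec (orthPart (unitVec (orthPart u₀ ξ₁)) (orthPart u₀ ξ₂))))
          ∂(stdGaussian H) ∂(stdGaussian H) =
        c * ∫⁻ x, ∫⁻ y, ENNReal.ofReal (pairKernel M ((d : ℝ) / 2 - 1) x y) * G (x, y)
          ∂(stdGaussian F) ∂(stdGaussian F) := by
  obtain ⟨c₁, hc₁⟩ := exists_lintegral_frame (F := F) (H := H) d hd hdim
  obtain ⟨a, ha, hF⟩ := exists_stdGaussian_eq_withDensity F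
  set n := finrank ℝ F
  set q : ℝ := (d : ℝ) / 2 - 1
  have hM0 : 0 < M := by linarith
  have hM1 : 0 < M ^ 2 - 1 := by nlinarith
  have hsM : 0 < √M := Real.sqrt_pos.2 hM0
  have hMs : M⁻¹ * √M = (√M)⁻¹ := by
    nth_rw 1 [← Real.sq_sqrt hM0.le]
    field_simp
  set R : ENNReal := ENNReal.ofReal ((M ^ 2 / (M ^ 2 - 1)) ^ q) with hR
  refine ⟨c₁ * (ENNReal.ofReal ((√M)⁻¹ ^ n) * ENNReal.ofReal (σ⁻¹ ^ n) * R *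
    (ENNReal.ofReal a * ENNReal.ofReal a)⁻¹), fun u₀ v hu₀ hv G hG => ?_⟩
  have h1 := hc₁ u₀ v hu₀ hv (fun z => G (√M • z.1, -(√M)⁻¹ • z.1 + σ • z.2)) (by fun_prop)
  simp only [map_smul, map_add]
  rw [h1]
  -- density in the variables `X = √M x`, `Y = - x / √M + σ w`
  let D : F → F → ENNReal := fun x w => ENNReal.ofReal
    ((max (max (1 - ‖x‖ ^ 2) 0 * (1 - ‖w‖ ^ 2) - ⟪x, w⟫ ^ 2) 0) ^ q)
  let Q : F → F → ENNReal := fun X Y => D ((√M)⁻¹ • X) (σ⁻¹ • (Y + M⁻¹ • X)) * G (X, Y)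
  have hQ : Measurable fun z : F × F => Q z.1 z.2 := by
    simp only [Q, D]; fun_prop
  have h2 : ∀ x w, D x w * G (√M • x, -(√M)⁻¹ • x + σ • w) =
      Q (√M • x) (σ • w - (√M)⁻¹ • x) := by
    intro x w
    have e1 : (√M)⁻¹ • √M • x = x := by rw [smul_smul, inv_mul_cancel₀ hsM.ne', one_smul]
    have e2 : σ⁻¹ • (σ • w - (√M)⁻¹ • x + M⁻¹ • √M • x) = w := by
      rw [smul_smul M⁻¹, hMs, sub_add_cancel, smul_smul, inv_mul_cancel₀ hσ0.ne', one_smul]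
    simp only [Q, e1, e2]
    congr 3
    rw [neg_smul]; abel
  have h3 : ∀ x, ∫⁻ w, Q (√M • x) (σ • w - (√M)⁻¹ • x) =
      ENNReal.ofReal (σ⁻¹ ^ n) * ∫⁻ Y, Q (√M • x) Y := by
    intro x
    rw [lintegral_comp_const_smul hσ0 (G := fun Y => Q (√M • x) (Y - (√M)⁻¹ • x)) (by fun_prop),
      lintegral_sub_right_eq_self (fun Y => Q (√M • x) Y), inv_pow]
  have h4 : ∫⁻ x, ∫⁻ w, D x w * G (√M • x, -(√M)⁻¹ • x + σ • w) =
      ENNReal.ofReal ((√M)⁻¹ ^ n) * ENNReal.ofReal (σ⁻¹ ^ n) * ∫⁻ X, ∫⁻ Y, Q X Y := by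
    simp_rw [h2, h3]
    rw [lintegral_comp_const_smul hsM (G := fun X => ENNReal.ofReal (σ⁻¹ ^ n) * ∫⁻ Y, Q X Y)
      (hQ.lintegral_prod_right'.const_mul _), lintegral_const_mul _ hQ.lintegral_prod_right']
    simp only [inv_pow, mul_assoc]
    rfl
  have h5 : ∀ X Y, Q X Y = R * (ENNReal.ofReal (Real.exp (-‖X‖ ^ 2 / 2)) *
      (ENNReal.ofReal (Real.exp (-‖Y‖ ^ 2 / 2)) *
        (ENNReal.ofReal (pairKernel M q X Y) * G (X, Y)))) := by
    intro X Y
    simp only [Q, D]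
    rw [frame_density_eq hM hσ, Real.mul_rpow (by positivity) (le_max_right _ _),
      ENNReal.ofReal_mul (by positivity), ← hR, mul_assoc]
    congr 1
    rw [← mul_assoc, ← mul_assoc, ← ENNReal.ofReal_mul (by positivity),
      ← ENNReal.ofReal_mul (by positivity)]
    congr 2
    rw [pairKernel, mul_comm (_ ^ q), ← mul_assoc, ← Real.exp_add, ← Real.exp_add]
    ring_nf
    simp
  have hk := measurable_pairKernel (F := F) M q
  have h6 : ∫⁻ x, ∫⁻ y, ENNReal.ofReal (pairKernel M q x y) * G (x, y)
      ∂(stdGaussian F) ∂(stdGaussian F) = ENNReal.ofReal a * ENNReal.ofReal a *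
      ∫⁻ x : F, ∫⁻ y : F, ENNReal.ofReal (Real.exp (-‖x‖ ^ 2 / 2)) *
      (ENNReal.ofReal (Real.exp (-‖y‖ ^ 2 / 2)) *
        (ENNReal.ofReal (pairKernel M q x y) * G (x, y))) := by
    have hmeas : Measurable fun z : F × F => ENNReal.ofReal (pairKernel M q z.1 z.2) *
      G (z.1, z.2) := by fun_prop
    have e : ∀ g : F → ENNReal, Measurable g → ∫⁻ y, g y ∂(stdGaussian F) =
        ENNReal.ofReal a * ∫⁻ y, ENNReal.ofReal (Real.exp (-‖y‖ ^ 2 / 2)) * g y := by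
      intro g hg
      rw [hF, lintegral_withDensity_eq_lintegral_mul _ (by fun_prop) hg,
        ← lintegral_const_mul _ (by fun_prop)]
      refine lintegral_congr fun y => ?_
      rw [Pi.mul_apply, ENNReal.ofReal_mul ha.le, mul_assoc]
    rw [e _ hmeas.lintegral_prod_right', mul_assoc]
    congr 1
    rw [← lintegral_const_mul]
    · refine lintegral_congr fun x => ?_
      rw [e _ (by fun_prop), mul_left_comm]
      congr 1
      rw [← lintegral_const_mul _ (by fun_prop)]
    · have : Measurable fun z : F × F => ENNReal.ofReal (Real.exp (-‖z.1‖ ^ 2 / 2)) *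
        (ENNReal.ofReal (Real.exp (-‖z.2‖ ^ 2 / 2)) *
        (ENNReal.ofReal (pairKernel M q z.1 z.2) * G (z.1, z.2))) := by fun_prop
      exact this.lintegral_prod_right'
  change c₁ * ∫⁻ x, ∫⁻ w, D x w * G (√M • x, -(√M)⁻¹ • x + σ • w) = _
  rw [h4, h6, mul_assoc c₁]
  congr 1
  have ha0 : ENNReal.ofReal a * ENNReal.ofReal a ≠ 0 := by simp [ha]
  have ha1 : ENNReal.ofReal a * ENNReal.ofReal a ≠ ⊤ := by
    exact ENNReal.mul_ne_top ENNReal.ofReal_ne_top ENNReal.ofReal_ne_top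
  rw [mul_assoc _ _ (_ * _), ← mul_assoc _ (ENNReal.ofReal a * ENNReal.ofReal a),
    ENNReal.inv_mul_cancel ha0 ha1, one_mul, mul_assoc _ R]
  congr 1
  simp_rw [h5]
  rw [← lintegral_const_mul]
  · refine lintegral_congr fun x => ?_
    rw [lintegral_const_mul _ (by fun_prop)]
  · have : Measurable fun z : F × F => ENNReal.ofReal (Real.exp (-‖z.1‖ ^ 2 / 2)) *
      (ENNReal.ofReal (Real.exp (-‖z.2‖ ^ 2 / 2)) *
      (ENNReal.ofReal (pairKernel M q z.1 z.2) * G (z.1, z.2))) := by fun_prop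
    exact this.lintegral_prod_right'

end TwoFrameLaw

/-! ### Standardized samples and rotations -/

section StdSample

variable {n N : ℕ}

/-- The `k`-th standardized sample `(sampleCov x)^{-1/2} (x(k) - x̄)`. -/
noncomputable def stdSample (x : Fin N → EuclideanSpace ℝ (Fin n)) (k : Fin N) :
    EuclideanSpace ℝ (Fin n) :=
  WithLp.toLp 2 ((CFC.sqrt (sampleCov x))⁻¹.mulVec (x k - sampleMean x).ofLp)

lemma matchedSample_zero (S : Matrix (Fin n) (Fin n) ℝ) (x : Fin N → EuclideanSpace ℝ (Fin n))
    (k : Fin N) :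
    matchedSample 0 S x k = Matrix.toEuclideanCLM (𝕜 := ℝ) (CFC.sqrt S) (stdSample x k) := by
  rw [matchedSample, add_zero, ← Matrix.mulVec_mulVec]
  rfl

lemma sum_sub_sampleMean (hN : 0 < N) (x : Fin N → EuclideanSpace ℝ (Fin n)) :
    ∑ k, (x k - sampleMean x) = 0 := by
  have : (N : ℝ) ≠ 0 := by positivity
  simp only [Finset.sum_sub_distrib, Finset.sum_const, Finset.card_univ, Fintype.card_fin,
    sampleMean]
  rw [← Nat.cast_smul_eq_nsmul ℝ, smul_smul, mul_inv_cancel₀ this, one_smul, sub_self]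

lemma sampleCov_eq (hN : 0 < N) (x : Fin N → EuclideanSpace ℝ (Fin n)) :
    sampleCov x = (N : ℝ)⁻¹ • ∑ k, Matrix.vecMulVec (x k - sampleMean x).ofLp
      (x k - sampleMean x).ofLp := by
  have hN0 : (N : ℝ) ≠ 0 := by positivity
  have hm : ∑ k, x k = (N : ℝ) • sampleMean x := by
    rw [sampleMean, smul_smul, mul_inv_cancel₀ hN0, one_smul]
  ext i j
  have hi : ∀ i, ∑ k, x k i = N * sampleMean x i := fun i => by
    have := congrArg (fun z : EuclideanSpace ℝ (Fin n) => z i) hm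
    simpa using this
  simp only [sampleCov, Matrix.sub_apply, Matrix.smul_apply, Matrix.sum_apply,
    Matrix.vecMulVec_apply, PiLp.sub_apply, smul_eq_mul, sub_mul, mul_sub, Finset.sum_sub_distrib,
    ← Finset.mul_sum, ← Finset.sum_mul, hi, Finset.sum_const, Finset.card_univ, Fintype.card_fin,
    nsmul_eq_mul]
  field_simp
  ring

lemma dotProduct_sampleCov_mulVec (hN : 0 < N) (x : Fin N → EuclideanSpace ℝ (Fin n))
    (y z : EuclideanSpace ℝ (Fin n)) :
    y.ofLp ⬝ᵥ (sampleCov x).mulVec z.ofLp =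
      (N : ℝ)⁻¹ * ∑ k, ⟪y, x k - sampleMean x⟫ * ⟪z, x k - sampleMean x⟫ := by
  rw [sampleCov_eq hN, Matrix.smul_mulVec, dotProduct_smul, Matrix.sum_mulVec, dotProduct_sum,
    smul_eq_mul]
  congr 1
  refine Finset.sum_congr rfl fun k _ => ?_
  rw [Matrix.vecMulVec_mulVec, dotProduct_smul, EuclideanSpace.inner_eq_star_dotProduct,
    EuclideanSpace.inner_eq_star_dotProduct]
  simp [dotProduct_comm]

lemma posSemidef_sampleCov (x : Fin N → EuclideanSpace ℝ (Fin n)) : (sampleCov x).PosSemidef := by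
  rcases Nat.eq_zero_or_pos N with rfl | hN
  · have : sampleCov x = 0 := by
      ext i j
      simp [sampleCov, sampleMean]
    rw [this]
    exact Matrix.PosSemidef.zero
  · rw [sampleCov_eq hN]
    refine Matrix.PosSemidef.smul (Matrix.posSemidef_sum _ fun k _ => ?_) (by positivity)
    have := Matrix.posSemidef_vecMulVec_self_star (x k - sampleMean x).ofLp
    simpa using this

lemma sum_stdSample (hN : 0 < N) (x : Fin N → EuclideanSpace ℝ (Fin n)) :
    ∑ k, stdSample x k = 0 := by
  have h : ∀ k, stdSample x k =
      Matrix.toEuclideanCLM (𝕜 := ℝ) (CFC.sqrt (sampleCov x))⁻¹ (x k - sampleMean x) :=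
    fun k => rfl
  simp_rw [h]
  rw [← map_sum, sum_sub_sampleMean hN, map_zero]

/-- The standardized samples have covariance `1`. -/
lemma sum_inner_stdSample (hN : 0 < N) {x : Fin N → EuclideanSpace ℝ (Fin n)}
    (hx : IsUnit (sampleCov x)) (y z : EuclideanSpace ℝ (Fin n)) :
    (N : ℝ)⁻¹ * ∑ k, ⟪stdSample x k, y⟫ * ⟪stdSample x k, z⟫ = ⟪y, z⟫ := by
  set R := CFC.sqrt (sampleCov x) with hR
  have hRR : R * R = sampleCov x :=
    CFC.sqrt_mul_sqrt_self _ (posSemidef_sampleCov x).nonneg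
  have hRH : R.IsHermitian := (CFC.sqrt_nonneg (sampleCov x)).isSelfAdjoint
  have hRu : IsUnit R := (CFC.isUnit_sqrt_iff _ (posSemidef_sampleCov x).nonneg).2 hx
  have hdet : IsUnit R.det := (Matrix.isUnit_iff_isUnit_det _).1 hRu
  have hRi : R⁻¹.IsHermitian := hRH.inv
  have hRt : (R⁻¹).transpose = R⁻¹ := by
    simpa [Matrix.IsHermitian, Matrix.conjTranspose_eq_transpose_of_trivial] using hRi
  have hin : ∀ k (y : EuclideanSpace ℝ (Fin n)), ⟪stdSample x k, y⟫ =
      ⟪WithLp.toLp 2 (R⁻¹.mulVec y.ofLp), x k - sampleMean x⟫ := by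
    intro k y
    rw [EuclideanSpace.inner_eq_star_dotProduct, EuclideanSpace.inner_eq_star_dotProduct, stdSample]
    simp only [star_trivial]
    rw [Matrix.dotProduct_mulVec, ← Matrix.mulVec_transpose, hRt, dotProduct_comm]
  simp_rw [hin]
  rw [← dotProduct_sampleCov_mulVec hN, ← hRR]
  simp only [Matrix.mulVec_mulVec]
  rw [mul_assoc, Matrix.mul_nonsing_inv _ hdet, mul_one, Matrix.dotProduct_mulVec,
    ← Matrix.mulVec_transpose, Matrix.mulVec_mulVec,
    show R.transpose = R by simpa [Matrix.IsHermitian,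
      Matrix.conjTranspose_eq_transpose_of_trivial] using hRH,
    Matrix.mul_nonsing_inv _ hdet, Matrix.one_mulVec, EuclideanSpace.inner_eq_star_dotProduct]
  simp [dotProduct_comm]

/-- The vector of `ℝᴺ` with all coordinates equal to `N ^ (-1 / 2)`. -/
noncomputable def unitOnes (N : ℕ) : EuclideanSpace ℝ (Fin N) :=
  WithLp.toLp 2 fun _ => (√N)⁻¹

lemma norm_unitOnes (hN : 0 < N) : ‖unitOnes N‖ = 1 := by
  have hN0 : (0 : ℝ) < N := by positivity
  rw [EuclideanSpace.norm_eq, Real.sqrt_eq_one]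
  simp [unitOnes, inv_pow, Real.sq_sqrt hN0.le, hN0.ne']

lemma inner_unitOnes (h : EuclideanSpace ℝ (Fin N)) : ⟪unitOnes N, h⟫ = (√N)⁻¹ * ∑ l, h l := by
  rw [PiLp.inner_apply, Finset.mul_sum]
  exact Finset.sum_congr rfl fun l _ => by simp [unitOnes, mul_comm]

/-- The isometric embedding of `ℝⁿ` into `ℝᴺ` whose adjoint sends the `k`-th basis vector to
`N ^ (-1 / 2)` times the `k`-th standardized sample. -/
lemma exists_stdSample_isometry (hN : 0 < N) {x : Fin N → EuclideanSpace ℝ (Fin n)}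
    (hx : IsUnit (sampleCov x)) :
    ∃ v : EuclideanSpace ℝ (Fin n) →ₗᵢ[ℝ] EuclideanSpace ℝ (Fin N),
      (∀ y, ⟪v y, unitOnes N⟫ = 0) ∧
      ∀ h, v.toContinuousLinearMap.adjoint h = (√N)⁻¹ • ∑ l, h l • stdSample x l := by
  have hN0 : (0 : ℝ) < N := by positivity
  let w : EuclideanSpace ℝ (Fin n) →ₗ[ℝ] EuclideanSpace ℝ (Fin N) :=
    { toFun := fun y => WithLp.toLp 2 fun k => (√N)⁻¹ * ⟪stdSample x k, y⟫
      map_add' := fun y z => by ext k; simp [inner_add_right, mul_add]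
      map_smul' := fun r y => by ext k; simp [inner_smul_right]; ring }
  have hw : ∀ y k, w y k = (√N)⁻¹ * ⟪stdSample x k, y⟫ := fun y k => rfl
  have hnorm : ∀ y, ‖w y‖ = ‖y‖ := by
    intro y
    rw [← sq_eq_sq₀ (norm_nonneg _) (norm_nonneg _), EuclideanSpace.real_norm_sq_eq,
      ← real_inner_self_eq_norm_sq, ← sum_inner_stdSample hN hx, Finset.mul_sum]
    refine Finset.sum_congr rfl fun k _ => ?_
    rw [hw, mul_pow, inv_pow, Real.sq_sqrt hN0.le, sq]
  refine ⟨⟨w, hnorm⟩, fun y => ?_, fun h => ?_⟩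
  · rw [real_inner_comm, inner_unitOnes]
    change _ * ∑ l, w y l = 0
    simp_rw [hw]
    rw [← Finset.mul_sum, ← sum_inner, sum_stdSample hN, inner_zero_left]
    simp
  · refine ext_inner_right ℝ fun y => ?_
    rw [ContinuousLinearMap.adjoint_inner_left, inner_smul_left, sum_inner, PiLp.inner_apply,
      Finset.mul_sum]
    refine Finset.sum_congr rfl fun k _ => ?_
    change ⟪h k, w y k⟫ = _
    rw [hw, inner_smul_left]
    simp
    ring

/-- The samples obtained from `x` by the isometry `Q` of `ℝᴺ`: the `k`-th one is the linear
combination of the samples with the coordinates of `Q eₖ` as coefficients. -/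
noncomputable def rotateSamples
    (Q : EuclideanSpace ℝ (Fin N) ≃ₗᵢ[ℝ] EuclideanSpace ℝ (Fin N))
    (x : Fin N → EuclideanSpace ℝ (Fin n)) : Fin N → EuclideanSpace ℝ (Fin n) :=
  fun k => ∑ l, (Q (EuclideanSpace.single k 1)) l • x l

section Rotate

variable (Q : EuclideanSpace ℝ (Fin N) ≃ₗᵢ[ℝ] EuclideanSpace ℝ (Fin N))

/-- The rows of the matrix of `Q` are orthonormal. -/
lemma sum_rotation_mul_rotation (l m : Fin N) :
    ∑ k, (Q (EuclideanSpace.single k 1)) l * (Q (EuclideanSpace.single k 1)) m =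
      if l = m then 1 else 0 := by
  let b := (EuclideanSpace.basisFun (Fin N) ℝ).map Q
  have hb : ∀ k, b k = Q (EuclideanSpace.single k 1) := fun k => by simp [b]
  have := b.sum_inner_mul_inner (EuclideanSpace.single l (1 : ℝ)) (EuclideanSpace.single m (1 : ℝ))
  simp only [hb, EuclideanSpace.inner_single_left, EuclideanSpace.inner_single_right, map_one,
    one_mul, conj_trivial] at this
  rw [this]
  by_cases h : l = m
  · simp [h]
  · simp [h]

lemma sum_rotation_mul_rotation' (j k : Fin N) :
    ∑ l, (Q (EuclideanSpace.single j 1)) l * (Q (EuclideanSpace.single k 1)) l =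
      if j = k then 1 else 0 := by
  have : ⟪Q (EuclideanSpace.single j 1), Q (EuclideanSpace.single k 1)⟫ =
      if j = k then (1 : ℝ) else 0 := by
    rw [LinearIsometryEquiv.inner_map_map, EuclideanSpace.inner_single_left]
    by_cases h : j = k
    · simp [h]
    · simp [h]
  rw [← this, PiLp.inner_apply]
  simp [mul_comm]

variable {Q} (hQ : Q (unitOnes N) = unitOnes N)
include hQ

lemma sum_rotation_apply (hN : 0 < N) (k : Fin N) :
    ∑ l, (Q (EuclideanSpace.single k 1)) l = 1 := by
  have hN0 : (0 : ℝ) < √N := Real.sqrt_pos.2 (by positivity)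
  have h1 := inner_unitOnes (Q (EuclideanSpace.single k 1))
  have h2 := inner_unitOnes (EuclideanSpace.single k (1 : ℝ))
  rw [← hQ, LinearIsometryEquiv.inner_map_map, h2] at h1
  have h3 := mul_left_cancel₀ (inv_ne_zero hN0.ne') h1
  rw [← h3]
  simp

lemma sum_rotation_apply' (hN : 0 < N) (l : Fin N) :
    ∑ k, (Q (EuclideanSpace.single k 1)) l = 1 := by
  have hN0 : (0 : ℝ) < √N := Real.sqrt_pos.2 (by positivity)
  have h1 : unitOnes N = (√N)⁻¹ • ∑ k, EuclideanSpace.single k (1 : ℝ) := by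
    ext j
    simp [unitOnes, Finset.sum_apply, Pi.single_apply]
  rw [h1, map_smul, map_sum] at hQ
  have h2 := congrArg (fun z : EuclideanSpace ℝ (Fin N) => z l)
    (smul_right_injective _ (inv_ne_zero hN0.ne') hQ)
  simpa [Pi.single_apply] using h2

lemma sampleMean_rotateSamples (hN : 0 < N) (x : Fin N → EuclideanSpace ℝ (Fin n)) :
    sampleMean (rotateSamples Q x) = sampleMean x := by
  simp only [sampleMean, rotateSamples]
  rw [Finset.sum_comm]
  simp_rw [← Finset.sum_smul, sum_rotation_apply' hQ hN, one_smul]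

lemma sampleCov_rotateSamples (hN : 0 < N) (x : Fin N → EuclideanSpace ℝ (Fin n)) :
    sampleCov (rotateSamples Q x) = sampleCov x := by
  rw [sampleCov, sampleCov, sampleMean_rotateSamples hQ hN]
  congr 2
  ext i j
  simp only [Matrix.sum_apply, Matrix.vecMulVec_apply, rotateSamples, WithLp.ofLp_sum,
    WithLp.ofLp_smul, Finset.sum_apply, Pi.smul_apply, smul_eq_mul, Finset.sum_mul_sum]
  rw [Finset.sum_comm]
  refine Finset.sum_congr rfl fun l _ => ?_
  rw [Finset.sum_comm]
  have h : ∀ m, ∑ k, Q (EuclideanSpace.single k 1) l * x l i *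
      (Q (EuclideanSpace.single k 1) m * x m j) = if l = m then x l i * x m j else 0 := by
    intro m
    have := sum_rotation_mul_rotation Q l m
    calc _ = (∑ k, Q (EuclideanSpace.single k 1) l * Q (EuclideanSpace.single k 1) m) *
          (x l i * x m j) := by
          rw [Finset.sum_mul]
          exact Finset.sum_congr rfl fun k _ => by ring
      _ = _ := by rw [this]; simp
  simp_rw [h]
  simp

/-- Rotations of `ℝᴺ` that fix `(1, …, 1)` leave the sample mean and the sample covariance
unchanged, so that standardization commutes with them. -/
lemma stdSample_rotateSamples (hN : 0 < N) (x : Fin N → EuclideanSpace ℝ (Fin n)) (k : Fin N) :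
    stdSample (rotateSamples Q x) k =
      ∑ l, (Q (EuclideanSpace.single k 1)) l • stdSample x l := by
  have h : ∀ y, WithLp.toLp 2 ((CFC.sqrt (sampleCov x))⁻¹.mulVec y.ofLp) =
      Matrix.toEuclideanCLM (𝕜 := ℝ) (CFC.sqrt (sampleCov x))⁻¹ y := fun y => rfl
  simp only [stdSample, sampleCov_rotateSamples hQ hN, sampleMean_rotateSamples hQ hN, h]
  simp_rw [← map_smul, ← map_sum]
  congr 1
  simp only [smul_sub, Finset.sum_sub_distrib, ← Finset.sum_smul, sum_rotation_apply hQ hN,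
    one_smul, rotateSamples]

end Rotate

end StdSample

/-! ### Rotation invariance of the samples and invertibility of the sample covariance -/

section Law

variable {n N : ℕ}

/-- The law of independent centered Gaussian samples is invariant under all isometries of `ℝᴺ`, as
seen from its characteristic function. -/
lemma map_rotateSamples_pi {S : Matrix (Fin n) (Fin n) ℝ} (hS : S.PosSemidef)
    (Q : EuclideanSpace ℝ (Fin N) ≃ₗᵢ[ℝ] EuclideanSpace ℝ (Fin N)) :
    (Measure.pi fun _ : Fin N => multivariateGaussian 0 S).map (rotateSamples Q) =
      Measure.pi fun _ : Fin N => multivariateGaussian 0 S := by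
  have hm : Measurable (rotateSamples (n := n) Q) := by
    unfold rotateSamples; fun_prop
  have : IsFiniteMeasure ((Measure.pi fun _ : Fin N => multivariateGaussian 0 S).map
    (rotateSamples Q)) := inferInstance
  rw [← charFun_eq_pi_iff]
  intro t
  let t' : PiLp 2 fun _ : Fin N => EuclideanSpace ℝ (Fin n) :=
    WithLp.toLp 2 fun l => ∑ k, (Q (EuclideanSpace.single k 1)) l • t k
  rw [Measure.map_map (by fun_prop) hm]
  have h1 : charFun ((Measure.pi fun _ : Fin N => multivariateGaussian 0 S).map
      (WithLp.toLp 2 ∘ rotateSamples Q)) t =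
      charFun ((Measure.pi fun _ : Fin N => multivariateGaussian 0 S).map (WithLp.toLp 2)) t' := by
    rw [charFun_apply, charFun_apply, integral_map (by fun_prop) (by fun_prop),
      integral_map (by fun_prop) (by fun_prop)]
    congr 1
    ext x
    congr 3
    simp only [Function.comp, PiLp.inner_apply (𝕜 := ℝ) (f := fun _ : Fin N => EuclideanSpace ℝ (Fin n)),
      rotateSamples, sum_inner, inner_sum, real_inner_smul_left, real_inner_smul_right, t']
    rw [Finset.sum_comm]
  rw [h1, charFun_pi]
  simp_rw [charFun_multivariateGaussian hS, inner_zero_right]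
  rw [← Complex.exp_sum, ← Complex.exp_sum]
  congr 1
  simp only [Complex.ofReal_zero, zero_mul, zero_sub, Finset.sum_neg_distrib, neg_inj,
    ← Finset.sum_div]
  congr 1
  rw [← Complex.ofReal_sum, ← Complex.ofReal_sum]
  congr 1
  have h2 : ∀ l, (t' l).ofLp = ∑ k, (Q (EuclideanSpace.single k 1)) l • (t k).ofLp := by
    intro l
    simp [t', WithLp.ofLp_sum]
  simp_rw [h2, Matrix.mulVec_sum, Matrix.mulVec_smul, sum_dotProduct, dotProduct_sum,
    smul_dotProduct, dotProduct_smul, smul_eq_mul]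
  rw [Finset.sum_comm]
  refine Finset.sum_congr rfl fun j _ => ?_
  rw [Finset.sum_comm]
  have h3 : ∀ k, ∑ l, Q (EuclideanSpace.single j 1) l * (Q (EuclideanSpace.single k 1) l *
      ((t j).ofLp ⬝ᵥ S.mulVec (t k).ofLp)) =
      if j = k then (t j).ofLp ⬝ᵥ S.mulVec (t k).ofLp else 0 := by
    intro k
    simp_rw [← mul_assoc]
    rw [← Finset.sum_mul, sum_rotation_mul_rotation' Q]
    simp
  simp_rw [h3]
  simp

section Measurability

lemma continuous_sampleCov :
    Continuous fun x : Fin N → EuclideanSpace ℝ (Fin n) => sampleCov x := by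
  refine continuous_matrix fun i j => ?_
  simp only [sampleCov, sampleMean, Matrix.sub_apply, Matrix.smul_apply, Matrix.sum_apply,
    Matrix.vecMulVec_apply]
  fun_prop

open scoped Matrix.Norms.L2Operator in
lemma continuous_sqrt_sampleCov :
    Continuous fun x : Fin N → EuclideanSpace ℝ (Fin n) => CFC.sqrt (sampleCov x) :=
  (CFC.continuousOn_sqrt (A := Matrix (Fin n) (Fin n) ℝ)).comp_continuous continuous_sampleCov
    fun x => (posSemidef_sampleCov x).nonneg

/-- The positive square root depends continuously on the sample covariance, and the matrix inverse,
with value `0` at singular matrices, is a measurable function of the entries by Cramer's rule. -/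
lemma measurable_stdSample (k : Fin N) :
    Measurable fun x : Fin N → EuclideanSpace ℝ (Fin n) => stdSample x k := by
  have hinv : ∀ i j, Measurable fun x : Fin N → EuclideanSpace ℝ (Fin n) =>
      (CFC.sqrt (sampleCov x))⁻¹ i j := by
    intro i j
    simp only [Matrix.inv_def, Matrix.smul_apply, Ring.inverse_eq_inv', smul_eq_mul]
    refine Measurable.mul (Measurable.inv ?_) ?_
    · exact (continuous_sqrt_sampleCov.matrix_det).measurable
    · exact (continuous_sqrt_sampleCov.matrix_adjugate.matrix_elem i j).measurable
  have hm : Measurable fun x : Fin N → EuclideanSpace ℝ (Fin n) => sampleMean x := by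
    unfold sampleMean; fun_prop
  unfold stdSample
  refine (WithLp.measurable_toLp 2 _).comp (measurable_pi_lambda _ fun i => ?_)
  simp only [Matrix.mulVec, dotProduct]
  refine Finset.measurable_sum _ fun j _ => (hinv i j).mul ?_
  fun_prop

end Measurability

/-- A form of Fubini's theorem that splits off the first of `m + 1` independent variables. -/
lemma ae_pi_succ {α : Type*} [MeasurableSpace α] {ν : Measure α} [IsProbabilityMeasure ν] {m : ℕ}
    {p : α → (Fin m → α) → Prop} (hp : MeasurableSet {z : α × (Fin m → α) | p z.1 z.2})
    (h : ∀ᵐ z ∂ν, ∀ᵐ w ∂(Measure.pi fun _ : Fin m => ν), p z w) :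
    ∀ᵐ x ∂(Measure.pi fun _ : Fin (m + 1) => ν), p (x 0) (fun i => x i.succ) := by
  have hmp := measurePreserving_piFinSuccAbove (fun _ : Fin (m + 1) => ν) 0
  have := hmp.quasiMeasurePreserving.ae ((Measure.ae_prod_iff_ae_ae hp).2 h)
  filter_upwards [this] with x hx
  exact hx

/-- By induction: a new sample almost surely avoids the proper affine subspace spanned by `z` and
the other samples. -/
lemma ae_linearIndependent_sub_const {ν : Measure (EuclideanSpace ℝ (Fin n))}
    [IsProbabilityMeasure ν] (hν : ν ≪ volume) (z : EuclideanSpace ℝ (Fin n)) (m : ℕ)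
    (hm : m ≤ n) :
    ∀ᵐ w ∂(Measure.pi fun _ : Fin m => ν), LinearIndependent ℝ fun i => w i - z := by
  induction m with
  | zero => exact ae_of_all _ fun w => linearIndependent_empty_type
  | succ m ih =>
    let c : EuclideanSpace ℝ (Fin n) → (Fin m → EuclideanSpace ℝ (Fin n)) →
        Fin (m + 1) → EuclideanSpace ℝ (Fin n) := fun a b => Fin.cons (a - z) fun i => b i - z
    have hc : Continuous fun p : EuclideanSpace ℝ (Fin n) × (Fin m → EuclideanSpace ℝ (Fin n)) =>
        c p.1 p.2 := by
      refine continuous_pi fun i => ?_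
      refine Fin.cases ?_ (fun i => ?_) i
      · simp only [c, Fin.cons_zero]
        fun_prop
      · simp only [c, Fin.cons_succ]
        fun_prop
    have hmeas : MeasurableSet {p : EuclideanSpace ℝ (Fin n) × (Fin m → EuclideanSpace ℝ (Fin n)) |
        LinearIndependent ℝ (c p.1 p.2)} :=
      (isOpen_setOfPred_linearIndependent.preimage hc).measurableSet
    have key : ∀ᵐ a ∂ν, ∀ᵐ b ∂(Measure.pi fun _ : Fin m => ν), LinearIndependent ℝ (c a b) := by
      rw [Measure.ae_ae_comm hmeas]
      filter_upwards [ih (by omega)] with b hb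
      set V := Submodule.span ℝ (Set.range fun i => b i - z)
      have hV : V ≠ ⊤ := by
        intro h
        have h1 := finrank_span_eq_card hb
        rw [show Submodule.span ℝ (Set.range fun i => b i - z) = ⊤ from h, finrank_top] at h1
        simp at h1
        omega
      have h0 : ∀ᵐ a : EuclideanSpace ℝ (Fin n), a - z ∉ V := by
        have h1 := Measure.addHaar_submodule volume V hV
        have h2 : (volume : Measure (EuclideanSpace ℝ (Fin n))) ((fun a => a - z) ⁻¹' V) = 0 := by
          simp_rw [sub_eq_add_neg]
          rw [measure_preimage_add_right, h1]
        exact measure_eq_zero_iff_ae_notMem.1 h2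
      filter_upwards [hν.ae_le h0] with a ha
      exact linearIndependent_finCons.2 ⟨hb, ha⟩
    have := ae_pi_succ hmeas key
    filter_upwards [this] with x hx
    convert hx using 1
    ext i : 1
    refine Fin.cases ?_ (fun i => ?_) i <;> simp [c]

/-- The differences of `n + 1` independent samples with an absolutely continuous law are almost
surely linearly independent. -/
lemma ae_linearIndependent_sub {ν : Measure (EuclideanSpace ℝ (Fin n))}
    [IsProbabilityMeasure ν] (hν : ν ≪ volume) :
    ∀ᵐ x ∂(Measure.pi fun _ : Fin (n + 1) => ν),
      LinearIndependent ℝ fun i : Fin n => x i.succ - x 0 := by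
  refine ae_pi_succ (p := fun z w => LinearIndependent ℝ fun i => w i - z) ?_
    (ae_of_all _ fun z => ae_linearIndependent_sub_const hν z n le_rfl)
  exact (isOpen_setOfPred_linearIndependent.preimage (by fun_prop)).measurableSet

/-- A vector in the kernel of the sample covariance is orthogonal to all `x(k) - x̄`, hence to all
differences of samples. -/
lemma isUnit_sampleCov (x : ℕ → EuclideanSpace ℝ (Fin n))
    (hx : LinearIndependent ℝ fun i : Fin n => x (i + 1) - x 0) (hN : n + 1 ≤ N) :
    IsUnit (sampleCov fun k : Fin N => x k) := by
  rw [Matrix.isUnit_iff_isUnit_det, isUnit_iff_ne_zero]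
  intro hdet
  obtain ⟨y, hy0, hy⟩ := Matrix.exists_mulVec_eq_zero_iff.2 hdet
  have hN0 : 0 < N := by omega
  set X : Fin N → EuclideanSpace ℝ (Fin n) := fun k => x k
  have h1 := dotProduct_sampleCov_mulVec hN0 X (WithLp.toLp 2 y) (WithLp.toLp 2 y)
  simp only [hy, dotProduct_zero, ← sq] at h1
  have h2 : ∀ k, ⟪(WithLp.toLp 2 y : EuclideanSpace ℝ (Fin n)), X k - sampleMean X⟫ = 0 := by
    have h3 : ∑ k, ⟪(WithLp.toLp 2 y : EuclideanSpace ℝ (Fin n)), X k - sampleMean X⟫ ^ 2 = 0 := by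
      rcases mul_eq_zero.1 h1.symm with h | h
      · simp at h; omega
      · exact h
    intro k
    have := (Finset.sum_eq_zero_iff_of_nonneg fun k _ => sq_nonneg _).1 h3 k (Finset.mem_univ k)
    exact pow_eq_zero_iff (two_ne_zero) |>.1 this
  have h4 : ∀ i : Fin n, ⟪(WithLp.toLp 2 y : EuclideanSpace ℝ (Fin n)), x (i + 1) - x 0⟫ = 0 := by
    intro i
    have e1 := h2 ⟨i + 1, by omega⟩
    have e2 := h2 ⟨0, hN0⟩
    simp only [X] at e1 e2
    rw [← sub_sub_sub_cancel_right _ _ (sampleMean X), inner_sub_right, e1, e2, sub_zero]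
  have h5 : Submodule.span ℝ (Set.range fun i : Fin n => x (i + 1) - x 0) = ⊤ :=
    hx.span_eq_top_of_card_eq_finrank' (by simp)
  have h6 : (WithLp.toLp 2 y : EuclideanSpace ℝ (Fin n)) ∈
      (Submodule.span ℝ (Set.range fun i : Fin n => x (i + 1) - x 0))ᗮ := by
    rw [Submodule.mem_orthogonal']
    intro u hu
    induction hu using Submodule.span_induction with
    | mem u hu => obtain ⟨i, rfl⟩ := hu; exact h4 i
    | zero => exact inner_zero_right _
    | add u v _ _ hu hv => rw [inner_add_right, hu, hv, add_zero]
    | smul r u _ hu => rw [inner_smul_right, hu, mul_zero]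
  rw [h5, Submodule.top_orthogonal_eq_bot, Submodule.mem_bot] at h6
  exact hy0 (by simpa using h6)

lemma isUnit_sqrt {S : Matrix (Fin n) (Fin n) ℝ} (hS : S.PosDef) : IsUnit (CFC.sqrt S) :=
  (CFC.isUnit_sqrt_iff S hS.posSemidef.nonneg).2 hS.isUnit

lemma multivariateGaussian_eq_map (S : Matrix (Fin n) (Fin n) ℝ) :
    multivariateGaussian 0 S = (stdGaussian (EuclideanSpace ℝ (Fin n))).map
      (Matrix.toEuclideanCLM (𝕜 := ℝ) (CFC.sqrt S)) := by
  simp [multivariateGaussian]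

lemma stdGaussian_absolutelyContinuous :
    stdGaussian (EuclideanSpace ℝ (Fin n)) ≪ volume := by
  obtain ⟨c, -, hc⟩ := exists_stdGaussian_eq_withDensity (EuclideanSpace ℝ (Fin n))
  rw [hc]
  exact withDensity_absolutelyContinuous _ _

lemma multivariateGaussian_absolutelyContinuous {S : Matrix (Fin n) (Fin n) ℝ} (hS : S.PosDef) :
    multivariateGaussian 0 S ≪ volume := by
  rw [multivariateGaussian_eq_map]
  have h1 : LinearMap.det (Matrix.toEuclideanCLM (𝕜 := ℝ) (CFC.sqrt S)).toLinearMap ≠ 0 := by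
    have : IsUnit (Matrix.toEuclideanCLM (𝕜 := ℝ) (CFC.sqrt S)) := (isUnit_sqrt hS).map _
    have h2 := this.map (ContinuousLinearMap.toLinearMapRingHom
      (M₁ := EuclideanSpace ℝ (Fin n)))
    exact (LinearMap.isUnit_iff_isUnit_det _).1 h2 |>.ne_zero
  refine (stdGaussian_absolutelyContinuous.map
    (Matrix.toEuclideanCLM (𝕜 := ℝ) (CFC.sqrt S)).continuous.measurable).trans ?_
  have h3 := Measure.map_linearMap_addHaar_eq_smul_addHaar volume h1
  rw [ContinuousLinearMap.coe_coe] at h3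
  rw [h3]
  exact Measure.smul_absolutelyContinuous

end Law

/-! ### The joint law of two standardized samples -/

section PairLaw

variable {n N : ℕ}

/-- Rotations act transitively on orthonormal systems of a given length. -/
lemma exists_linearIsometryEquiv_of_orthonormal {m : ℕ} (hm : m ≤ N)
    {u a : Fin m → EuclideanSpace ℝ (Fin N)} (hu : Orthonormal ℝ u) (ha : Orthonormal ℝ a) :
    ∃ Q : EuclideanSpace ℝ (Fin N) ≃ₗᵢ[ℝ] EuclideanSpace ℝ (Fin N), ∀ i, Q (u i) = a i := by
  have ext : ∀ w : Fin m → EuclideanSpace ℝ (Fin N), Orthonormal ℝ w →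
      ∃ b : OrthonormalBasis (Fin N) ℝ (EuclideanSpace ℝ (Fin N)), ∀ i, b (Fin.castLE hm i) = w i := by
    intro w hw
    let w' : Fin N → EuclideanSpace ℝ (Fin N) := fun j => if h : j.1 < m then w ⟨j, h⟩ else 0
    have hw' : Orthonormal ℝ (({j : Fin N | j.1 < m}).domRestrict w') := by
      have : ({j : Fin N | j.1 < m}).domRestrict w' =
          w ∘ fun j : {j : Fin N | j.1 < m} => (⟨j.1, j.2⟩ : Fin m) := by
        ext1 j
        exact dif_pos j.2
      rw [this]
      refine hw.comp _ fun i j hij => ?_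
      simpa [Subtype.ext_iff, Fin.ext_iff] using hij
    obtain ⟨b, hb⟩ := hw'.exists_orthonormalBasis_extension_of_card_eq (by simp)
    refine ⟨b, fun i => ?_⟩
    rw [hb _ (by simp)]
    simp [w']
  obtain ⟨b, hb⟩ := ext u hu
  obtain ⟨b', hb'⟩ := ext a ha
  refine ⟨b.equiv b' (Equiv.refl _), fun i => ?_⟩
  rw [← hb, ← hb', OrthonormalBasis.equiv_apply_basis, Equiv.refl_apply]

lemma orthonormal_vec_three {H : Type*} [NormedAddCommGroup H] [InnerProductSpace ℝ H] {a b c : H}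
    (ha : ‖a‖ = 1) (hb : ‖b‖ = 1) (hc : ‖c‖ = 1) (hab : ⟪a, b⟫ = 0) (hac : ⟪a, c⟫ = 0)
    (hbc : ⟪b, c⟫ = 0) : Orthonormal ℝ ![a, b, c] := by
  refine ⟨fun i => ?_, fun i j hij => ?_⟩
  · fin_cases i <;> simp [ha, hb, hc]
  · fin_cases i <;> fin_cases j <;>
      simp_all [real_inner_comm]

lemma ae_orthPart_orthPart_ne_zero {H : Type*} [NormedAddCommGroup H] [InnerProductSpace ℝ H]
    [FiniteDimensional ℝ H] [MeasurableSpace H] [BorelSpace H] {a b : H} (ha : ‖a‖ = 1)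
    (hb : ‖b‖ = 1) (hab : ⟪a, b⟫ = 0) (hdim : 2 < finrank ℝ H) :
    ∀ᵐ ξ ∂(stdGaussian H), orthPart b (orthPart a ξ) ≠ 0 := by
  obtain ⟨c, -, hc⟩ := exists_stdGaussian_eq_withDensity H
  rw [hc]
  refine (withDensity_absolutelyContinuous _ _).ae_le ?_
  have h1 : Submodule.span ℝ {a, b} ≠ ⊤ := by
    classical
    intro h
    have h2 : Module.finrank ℝ (Submodule.span ℝ ((({a, b} : Finset H) : Set H))) ≤ _ :=
      finrank_span_finset_le_card (R := ℝ) ({a, b} : Finset H)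
    have h3 : Module.finrank ℝ (Submodule.span ℝ ((({a, b} : Finset H) : Set H))) =
        finrank ℝ H := by
      rw [Finset.coe_pair, h, finrank_top]
    have h4 := Finset.card_le_two (a := a) (b := b)
    omega
  have h2 := Measure.addHaar_submodule (volume : Measure H) _ h1
  filter_upwards [measure_eq_zero_iff_ae_notMem.1 h2] with ξ hξ h0
  rw [orthPart_orthPart_eq_sub_starProjection ha hb hab, sub_eq_zero] at h0
  exact hξ (h0 ▸ Submodule.starProjection_apply_mem _ ξ)

/-- Gram-Schmidt applied to `u` and two independent Gaussian vectors almost surely gives an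
orthonormal system, the junk value `unitVec 0 = 0` being avoided. -/
lemma ae_orthonormal_gramSchmidt {H : Type*} [NormedAddCommGroup H] [InnerProductSpace ℝ H]
    [FiniteDimensional ℝ H] [MeasurableSpace H] [BorelSpace H] {u : H} (hu : ‖u‖ = 1)
    (hdim : 2 < finrank ℝ H) :
    ∀ᵐ p ∂((stdGaussian H).prod (stdGaussian H)), Orthonormal ℝ ![u, unitVec (orthPart u p.1),
      unitVec (orthPart (unitVec (orthPart u p.1)) (orthPart u p.2))] := by
  have hm1 : Measurable fun p : H × H => orthPart u p.1 :=
    Measurable.orthPart measurable_const measurable_fst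
  have hm2 : Measurable fun p : H × H =>
      orthPart (unitVec (orthPart u p.1)) (orthPart u p.2) :=
    Measurable.orthPart (measurable_unitVec.comp hm1)
      (Measurable.orthPart measurable_const measurable_snd)
  have key : ∀ᵐ p ∂((stdGaussian H).prod (stdGaussian H)), orthPart u p.1 ≠ 0 ∧
      orthPart (unitVec (orthPart u p.1)) (orthPart u p.2) ≠ 0 := by
    rw [Measure.ae_prod_iff_ae_ae]
    · filter_upwards [ae_orthPart_ne_zero (a := u) (by omega : 1 < finrank ℝ H)] with ξ hξ
      filter_upwards [ae_orthPart_orthPart_ne_zero hu (norm_unitVec hξ)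
        (inner_unitVec_eq_zero (inner_orthPart_self hu ξ)) hdim] with ξ' hξ'
      exact ⟨hξ, hξ'⟩
    · exact (hm1 (measurableSet_singleton 0).compl).inter
        (hm2 (measurableSet_singleton 0).compl)
  filter_upwards [key] with p hp
  have h1 := norm_unitVec hp.1
  have h2 : ⟪u, unitVec (orthPart u p.1)⟫ = 0 :=
    inner_unitVec_eq_zero (inner_orthPart_self hu p.1)
  refine orthonormal_vec_three hu h1 (norm_unitVec hp.2) h2 (inner_unitVec_eq_zero ?_)
    (inner_unitVec_eq_zero (inner_orthPart_self h1 _))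
  rw [inner_orthPart_of_inner_eq_zero h2, inner_orthPart_self hu]

/-- Coordinates of two standard basis vectors in an orthonormal system starting with `unitOnes`, by
Gram-Schmidt. The vectors `√N eₖ` have squared length `M + 1` and inner product `1` with `unitOnes`,
so their parts orthogonal to it have squared length `M` and mutual inner product `-1`. -/
lemma exists_orthonormal_decomposition {M σ : ℝ} (hM : (N : ℝ) = M + 1) (hM1 : 1 < M)
    (hσ : σ ^ 2 = (M ^ 2 - 1) / M) (hσ0 : 0 < σ) {k l : Fin N} (hkl : k ≠ l) :
    ∃ f₁ f₂ : EuclideanSpace ℝ (Fin N), Orthonormal ℝ ![unitOnes N, f₁, f₂] ∧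
      √N • EuclideanSpace.single k (1 : ℝ) = unitOnes N + √M • f₁ ∧
      √N • EuclideanSpace.single l (1 : ℝ) = unitOnes N + ((-(√M)⁻¹) • f₁ + σ • f₂) := by
  have hM0 : 0 < M := by linarith
  have hN0 : 0 < N := k.pos
  have hNR : (0 : ℝ) < N := by positivity
  have hsN : √(N : ℝ) * √N = M + 1 := by rw [Real.mul_self_sqrt hNR.le, hM]
  have hsN0 : 0 < √(N : ℝ) := Real.sqrt_pos.2 hNR
  have hsM : √M * √M = M := Real.mul_self_sqrt hM0.le
  have hsM0 : 0 < √M := Real.sqrt_pos.2 hM0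
  set u := unitOnes N
  set e : Fin N → EuclideanSpace ℝ (Fin N) := fun k => √N • EuclideanSpace.single k (1 : ℝ) with he
  have huu : ⟪u, u⟫ = 1 := by rw [real_inner_self_eq_norm_sq, norm_unitOnes hN0, one_pow]
  have hue : ∀ k, ⟪u, e k⟫ = 1 := by
    intro k
    rw [he, inner_smul_right, inner_unitOnes]
    simp [hsN0.ne']
  have heu : ∀ k, ⟪e k, u⟫ = 1 := fun k => by rw [real_inner_comm, hue]
  have hee : ∀ k, ⟪e k, e k⟫ = M + 1 := by
    intro k
    rw [he, inner_smul_right, inner_smul_left, EuclideanSpace.inner_single_left]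
    simpa using hsN
  have hek : ⟪e k, e l⟫ = 0 := by
    rw [he, inner_smul_right, inner_smul_left, EuclideanSpace.inner_single_left]
    simp [hkl]
  have hel : ⟪e l, e k⟫ = 0 := by rw [real_inner_comm, hek]
  obtain ⟨f₁, hf₁⟩ : ∃ f, f = (√M)⁻¹ • (e k - u) := ⟨_, rfl⟩
  obtain ⟨f₂, hf₂⟩ : ∃ f, f = σ⁻¹ • (e l - u + (√M)⁻¹ • f₁) := ⟨_, rfl⟩
  have e1 : e k = u + √M • f₁ := by
    rw [hf₁, smul_smul, mul_inv_cancel₀ hsM0.ne', one_smul, add_sub_cancel]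
  have e2 : e l = u + ((-(√M)⁻¹) • f₁ + σ • f₂) := by
    rw [hf₂, smul_smul, mul_inv_cancel₀ hσ0.ne', one_smul, neg_smul]
    abel
  have huf₁ : ⟪u, f₁⟫ = 0 := by
    rw [hf₁, inner_smul_right, inner_sub_right, hue, huu, sub_self, mul_zero]
  have hf₁f₁ : ⟪f₁, f₁⟫ = 1 := by
    rw [hf₁, inner_smul_right, inner_smul_left, inner_sub_right, inner_sub_left, inner_sub_left,
      hue, huu, hee, heu]
    simp only [conj_trivial]
    rw [← mul_assoc, ← mul_inv, hsM]
    field_simp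
    ring
  have hf₁l : ⟪f₁, e l⟫ = -(√M)⁻¹ := by
    rw [hf₁, inner_smul_left, inner_sub_left, hek, hue]
    simp
  have huf₂ : ⟪u, f₂⟫ = 0 := by
    rw [hf₂, inner_smul_right, inner_add_right, inner_sub_right, hue, huu, inner_smul_right, huf₁]
    simp
  have hf₁f₂ : ⟪f₁, f₂⟫ = 0 := by
    rw [hf₂, inner_smul_right, inner_add_right, inner_sub_right, hf₁l, inner_smul_right, hf₁f₁,
      real_inner_comm, huf₁]
    simp
  have hlf₂ : ⟪e l, f₂⟫ = σ := by
    have h1 : ⟪e l, f₁⟫ = -(√M)⁻¹ := by rw [real_inner_comm, hf₁l]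
    rw [hf₂, inner_smul_right, inner_add_right, inner_sub_right, hee, heu, inner_smul_right, h1,
      mul_neg, ← mul_inv, hsM]
    have : M + 1 - 1 + -M⁻¹ = σ ^ 2 := by rw [hσ]; field_simp; ring
    rw [this]
    field_simp
  have hf₂f₂ : ⟪f₂, f₂⟫ = 1 := by
    have h2 := hlf₂
    rw [e2, inner_add_left, inner_add_left, real_inner_smul_left, real_inner_smul_left, huf₂,
      hf₁f₂, mul_zero, zero_add, zero_add] at h2
    exact (mul_eq_left₀ hσ0.ne').1 h2
  refine ⟨f₁, f₂, orthonormal_vec_three (norm_unitOnes hN0) ?_ ?_ huf₁ huf₂ hf₁f₂, e1, e2⟩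
  · rw [norm_eq_sqrt_real_inner, hf₁f₁, Real.sqrt_one]
  · rw [norm_eq_sqrt_real_inner, hf₂f₂, Real.sqrt_one]

/-- Two distinct standardized samples have, up to normalization, the joint density `pairKernel` with
respect to a product of standard Gaussian measures. -/
lemma exists_lintegral_stdSample_pair {S : Matrix (Fin n) (Fin n) ℝ} (hS : S.PosDef) (d : ℕ)
    (hd : 2 < d) (hN : n + 2 + d = N)
    (hunit : ∀ᵐ x ∂(Measure.pi fun _ : Fin N => multivariateGaussian 0 S),
      IsUnit (sampleCov x)) :
    ∃ c : ENNReal, ∀ k l : Fin N, k ≠ l →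
      ∀ G : EuclideanSpace ℝ (Fin n) × EuclideanSpace ℝ (Fin n) → ENNReal, Measurable G →
      ∫⁻ x, G (stdSample x k, stdSample x l)
          ∂(Measure.pi fun _ : Fin N => multivariateGaussian 0 S) =
        c * ∫⁻ y, ∫⁻ z, ENNReal.ofReal (pairKernel ((N : ℝ) - 1) ((d : ℝ) / 2 - 1) y z) * G (y, z)
          ∂(stdGaussian (EuclideanSpace ℝ (Fin n))) ∂(stdGaussian (EuclideanSpace ℝ (Fin n))) := by
  set M : ℝ := (N : ℝ) - 1 with hMdef
  have hN5 : 5 ≤ N := by omega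
  have hNR : (5 : ℝ) ≤ N := by exact_mod_cast hN5
  have hM1 : 1 < M := by linarith
  have hM : (N : ℝ) = M + 1 := by rw [hMdef]; ring
  have hN0 : 0 < N := by omega
  have hsN0 : 0 < √(N : ℝ) := Real.sqrt_pos.2 (by linarith)
  set σ : ℝ := √((M ^ 2 - 1) / M) with hσdef
  have hpos : 0 < (M ^ 2 - 1) / M := div_pos (by nlinarith) (by linarith)
  have hσ : σ ^ 2 = (M ^ 2 - 1) / M := Real.sq_sqrt hpos.le
  have hσ0 : 0 < σ := Real.sqrt_pos.2 hpos
  obtain ⟨c, hc⟩ := exists_lintegral_pairKernel (F := EuclideanSpace ℝ (Fin n))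
    (H := EuclideanSpace ℝ (Fin N)) d hd (by simpa using hN) hM1 hσ hσ0
  refine ⟨c, fun k l hkl G hG => ?_⟩
  set μ := Measure.pi fun _ : Fin N => multivariateGaussian (0 : EuclideanSpace ℝ (Fin n)) S
  set γ := stdGaussian (EuclideanSpace ℝ (Fin N))
  set u := unitOnes N
  obtain ⟨T, hTdef⟩ : ∃ T : (Fin N → EuclideanSpace ℝ (Fin n)) → EuclideanSpace ℝ (Fin N) →
    EuclideanSpace ℝ (Fin n), ∀ x h, T x h = (√N)⁻¹ • ∑ l, h l • stdSample x l :=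
    ⟨_, fun _ _ => rfl⟩
  obtain ⟨f₁, f₂, hf, hek, hel⟩ := exists_orthonormal_decomposition hM hM1 hσ hσ0 hkl
  -- rotating the samples replaces `f₁`, `f₂` by any other orthonormal pair orthogonal to `u`
  have hrot : ∀ a₁ a₂, Orthonormal ℝ ![u, a₁, a₂] →
      ∫⁻ x, G (stdSample x k, stdSample x l) ∂μ =
      ∫⁻ x, G (T x (√M • a₁), T x (-(√M)⁻¹ • a₁ + σ • a₂)) ∂μ := by
    intro a₁ a₂ ha
    obtain ⟨Q, hQ⟩ := exists_linearIsometryEquiv_of_orthonormal (by omega : 3 ≤ N) hf ha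
    have hQ0 : Q u = u := hQ 0
    have hQ1 : Q f₁ = a₁ := hQ 1
    have hQ2 : Q f₂ = a₂ := hQ 2
    have hmeas : Measurable fun x : Fin N → EuclideanSpace ℝ (Fin n) =>
        G (stdSample x k, stdSample x l) :=
      hG.comp ((measurable_stdSample k).prodMk (measurable_stdSample l))
    have hm : Measurable (rotateSamples (n := n) Q) := by
      unfold rotateSamples; fun_prop
    have h1 := lintegral_map hmeas hm (μ := μ)
    rw [map_rotateSamples_pi hS.posSemidef Q] at h1
    rw [h1]
    refine lintegral_congr_ae (hunit.mono fun x hx => ?_)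
    obtain ⟨v, hv0, hv⟩ := exists_stdSample_isometry hN0 hx
    have hvu : v.toContinuousLinearMap.adjoint u = 0 := by
      refine ext_inner_right ℝ fun y => ?_
      rw [ContinuousLinearMap.adjoint_inner_left, inner_zero_left, real_inner_comm]
      exact hv0 y
    have hsample : ∀ j, stdSample (rotateSamples Q x) j =
        v.toContinuousLinearMap.adjoint (Q (√N • EuclideanSpace.single j (1 : ℝ))) := by
      intro j
      rw [stdSample_rotateSamples hQ0 hN0, map_smul, map_smul, hv, smul_smul,
        mul_inv_cancel₀ hsN0.ne', one_smul]
    have hT : ∀ h, T x h = v.toContinuousLinearMap.adjoint h := fun h => by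
      rw [hTdef, hv]
    have q1 : Q (unitOnes N + √M • f₁) = u + √M • a₁ := by
      rw [map_add, map_smul, hQ1, hQ0]
    have q2 : Q (unitOnes N + (-(√M)⁻¹ • f₁ + σ • f₂)) = u + (-(√M)⁻¹ • a₁ + σ • a₂) := by
      rw [map_add, map_add, map_smul, map_smul, hQ1, hQ2, hQ0]
    beta_reduce
    rw [hsample, hsample, hT, hT, hek, hel, q1, q2, map_add _ u, map_add _ u, hvu, zero_add,
      zero_add]
  obtain ⟨a₁, ha₁⟩ : ∃ a : EuclideanSpace ℝ (Fin N) → EuclideanSpace ℝ (Fin N),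
    ∀ ξ, a ξ = unitVec (orthPart u ξ) := ⟨_, fun _ => rfl⟩
  obtain ⟨a₂, ha₂⟩ : ∃ a : EuclideanSpace ℝ (Fin N) → EuclideanSpace ℝ (Fin N) →
    EuclideanSpace ℝ (Fin N), ∀ ξ₁ ξ₂, a ξ₁ ξ₂ = unitVec (orthPart (a₁ ξ₁) (orthPart u ξ₂)) :=
    ⟨_, fun _ _ => rfl⟩
  have hu : ‖u‖ = 1 := norm_unitOnes hN0
  have ha₁m : Measurable a₁ := by
    rw [funext ha₁]
    exact measurable_unitVec.comp (Measurable.orthPart measurable_const measurable_id)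
  have ha₂m : Measurable fun p : EuclideanSpace ℝ (Fin N) × EuclideanSpace ℝ (Fin N) =>
      a₂ p.1 p.2 := by
    simp only [ha₂]
    refine measurable_unitVec.comp (Measurable.orthPart (ha₁m.comp measurable_fst) ?_)
    exact Measurable.orthPart measurable_const measurable_snd
  have hTm : Measurable fun p : (Fin N → EuclideanSpace ℝ (Fin n)) × EuclideanSpace ℝ (Fin N) =>
      T p.1 p.2 := by
    simp only [hTdef]
    have h1 : ∀ l, Measurable fun p : (Fin N → EuclideanSpace ℝ (Fin n)) ×
        EuclideanSpace ℝ (Fin N) => p.2 l • stdSample p.1 l := fun l =>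
      Measurable.fun_smul (by fun_prop) ((measurable_stdSample l).comp measurable_fst)
    have h2 := Finset.measurable_fun_sum Finset.univ fun l _ => h1 l
    fun_prop
  have hGm : Measurable fun p : (EuclideanSpace ℝ (Fin N) × EuclideanSpace ℝ (Fin N)) ×
      (Fin N → EuclideanSpace ℝ (Fin n)) =>
      G (T p.2 (√M • a₁ p.1.1), T p.2 (-(√M)⁻¹ • a₁ p.1.1 + σ • a₂ p.1.1 p.1.2)) := by
    have m1 : Measurable fun p : (EuclideanSpace ℝ (Fin N) × EuclideanSpace ℝ (Fin N)) ×
      (Fin N → EuclideanSpace ℝ (Fin n)) => a₁ p.1.1 := by fun_prop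
    have m2 : Measurable fun p : (EuclideanSpace ℝ (Fin N) × EuclideanSpace ℝ (Fin N)) ×
      (Fin N → EuclideanSpace ℝ (Fin n)) => a₂ p.1.1 p.1.2 := ha₂m.comp measurable_fst
    have m3 : Measurable fun p : (EuclideanSpace ℝ (Fin N) × EuclideanSpace ℝ (Fin N)) ×
      (Fin N → EuclideanSpace ℝ (Fin n)) => √M • a₁ p.1.1 := by fun_prop
    have m4 : Measurable fun p : (EuclideanSpace ℝ (Fin N) × EuclideanSpace ℝ (Fin N)) ×
      (Fin N → EuclideanSpace ℝ (Fin n)) => -(√M)⁻¹ • a₁ p.1.1 + σ • a₂ p.1.1 p.1.2 := by fun_prop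
    exact hG.comp ((hTm.comp (measurable_snd.prodMk m3)).prodMk
      (hTm.comp (measurable_snd.prodMk m4)))
  have hdim : 2 < finrank ℝ (EuclideanSpace ℝ (Fin N)) := by simp; omega
  have hortho : ∀ᵐ p ∂(γ.prod γ), Orthonormal ℝ ![u, a₁ p.1, a₂ p.1 p.2] := by
    simp only [ha₂, ha₁]
    exact ae_orthonormal_gramSchmidt hu hdim
  -- averaging over a random orthonormal pair that is independent of the samples, and then, for
  -- fixed samples, computing the law of its image under the adjoint of the isometry given by the samples
  calc ∫⁻ x, G (stdSample x k, stdSample x l) ∂μ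
      = ∫⁻ _, ∫⁻ x, G (stdSample x k, stdSample x l) ∂μ ∂(γ.prod γ) := by simp
    _ = ∫⁻ p, ∫⁻ x, G (T x (√M • a₁ p.1), T x (-(√M)⁻¹ • a₁ p.1 + σ • a₂ p.1 p.2)) ∂μ
          ∂(γ.prod γ) := lintegral_congr_ae (hortho.mono fun p hp => hrot _ _ hp)
    _ = ∫⁻ x, ∫⁻ p, G (T x (√M • a₁ p.1), T x (-(√M)⁻¹ • a₁ p.1 + σ • a₂ p.1 p.2)) ∂(γ.prod γ)
          ∂μ := lintegral_lintegral_swap hGm.aemeasurable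
    _ = ∫⁻ x, c * ∫⁻ y, ∫⁻ z, ENNReal.ofReal (pairKernel M ((d : ℝ) / 2 - 1) y z) * G (y, z)
          ∂(stdGaussian (EuclideanSpace ℝ (Fin n))) ∂(stdGaussian (EuclideanSpace ℝ (Fin n)))
          ∂μ := by
        refine lintegral_congr_ae (hunit.mono fun x hx => ?_)
        obtain ⟨v, hv0, hv⟩ := exists_stdSample_isometry hN0 hx
        have hT : ∀ h, T x h = v.toContinuousLinearMap.adjoint h := fun h => by rw [hTdef, hv]
        have h1 := hc u v hu hv0 G hG
        simp only [← hT, ← ha₁, ← ha₂] at h1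
        rw [← h1]
        exact lintegral_prod _ (hGm.comp (measurable_id.prodMk measurable_const)).aemeasurable
    _ = _ := by simp

end PairLaw

/-! ### Pointwise asymptotics of the pair density -/

section Kernel

/-- Bernoulli's inequality, extended past `b = 1` by truncation. -/
lemma one_sub_mul_le_rpow {b p : ℝ} (hp : 1 ≤ p) :
    1 - p * b ≤ (max (1 - b) 0) ^ p := by
  rcases le_total b 1 with hb | hb
  · rw [max_eq_left (by linarith)]
    have := one_add_mul_self_le_rpow_one_add (s := -b) (by linarith) hp
    calc 1 - p * b = 1 + p * -b := by ring
      _ ≤ _ := this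
      _ = _ := by rw [← sub_eq_add_neg]
  · have : 0 ≤ (max (1 - b) 0) ^ p := by positivity
    nlinarith

lemma rpow_le_exp_neg {b p : ℝ} (hp : 0 ≤ p) : (max (1 - b) 0) ^ p ≤ Real.exp (-(p * b)) := by
  have h1 : max (1 - b) 0 ≤ Real.exp (-b) :=
    max_le (by linarith [Real.add_one_le_exp (-b)]) (Real.exp_pos _).le
  calc (max (1 - b) 0) ^ p ≤ (Real.exp (-b)) ^ p := Real.rpow_le_rpow (by positivity) h1 hp
    _ = _ := by rw [← Real.exp_mul]; congr 1; ring

lemma exp_neg_le {v : ℝ} (hv : 0 ≤ v) : Real.exp (-v) ≤ 1 - v + v ^ 2 := by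
  rw [Real.exp_neg]
  have h1 : 1 + v ≤ Real.exp v := by linarith [Real.add_one_le_exp v]
  calc (Real.exp v)⁻¹ ≤ (1 + v)⁻¹ := by gcongr
    _ ≤ _ := by
      rw [inv_le_iff_one_le_mul₀ (by linarith)]
      nlinarith [pow_nonneg hv 3]

/-- Second order expansion of `r ↦ max (t - r) 0 ^ p` at `r = 0`, with an explicit remainder. -/
lemma abs_rpow_sub_le {t r p : ℝ} (ht : 0 ≤ t) (hr : 0 ≤ r) (hp : 2 < p) :
    |(max (t - r) 0) ^ p - t ^ p + p * r * t ^ (p - 1)| ≤ p ^ 2 * r ^ 2 * t ^ (p - 2) := by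
  rcases ht.eq_or_lt with rfl | ht
  · rw [max_eq_right (by linarith), Real.zero_rpow (by linarith), Real.zero_rpow (by linarith),
      Real.zero_rpow (by linarith)]
    simp
  · have hb : max (t - r) 0 = t * max (1 - r / t) 0 := by
      rw [mul_max_of_nonneg _ _ ht.le, mul_zero, mul_sub, mul_one, mul_div_cancel₀ _ ht.ne']
    have h1 : t ^ (p - 1) = t ^ p / t := by rw [Real.rpow_sub_one ht.ne']
    have h2 : t ^ (p - 2) = t ^ p / t ^ 2 := by
      rw [Real.rpow_sub ht, Real.rpow_two]
    have hb0 : 0 ≤ r / t := by positivity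
    rw [hb, Real.mul_rpow ht.le (by positivity), h1, h2]
    have e1 := one_sub_mul_le_rpow (b := r / t) (p := p) (by linarith)
    have e2 := (rpow_le_exp_neg (b := r / t) (p := p) (by linarith)).trans
      (exp_neg_le (by positivity))
    have htp : 0 < t ^ p := by positivity
    have e3 : |(max (1 - r / t) 0) ^ p - 1 + p * (r / t)| ≤ (p * (r / t)) ^ 2 := by
      rw [abs_le]; constructor <;> nlinarith [sq_nonneg (p * (r / t))]
    calc |t ^ p * (max (1 - r / t) 0) ^ p - t ^ p + p * r * (t ^ p / t)|
        = t ^ p * |(max (1 - r / t) 0) ^ p - 1 + p * (r / t)| := by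
          rw [← abs_of_pos htp, ← abs_mul, abs_of_pos htp]; congr 1; ring
      _ ≤ t ^ p * (p * (r / t)) ^ 2 := by gcongr
      _ = _ := by ring

/-- The function `(1 - u / M)₊ ^ q * exp (u / 2)`; for `u = ‖x‖ ^ 2` and `q` close to `M / 2` it is
the unnormalized Gaussian density of one coordinate block of a point on a sphere of radius `√M`. -/
noncomputable def ballWeight (M q u : ℝ) : ℝ := (max (1 - u / M) 0) ^ q * Real.exp (u / 2)

lemma ballWeight_nonneg (M q u : ℝ) : 0 ≤ ballWeight M q u := by unfold ballWeight; positivity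

lemma ballWeight_eq_zero {M q u : ℝ} (hM : 0 < M) (hq : 0 < q) (hu : M ≤ u) :
    ballWeight M q u = 0 := by
  have : 1 - u / M ≤ 0 := by rw [sub_nonpos, one_le_div hM]; exact hu
  rw [ballWeight, max_eq_right this, Real.zero_rpow hq.ne', zero_mul]

lemma ballWeight_le_exp {M m u : ℝ} (hM : 0 < M) (hm : m ≤ M) :
    ballWeight M ((M - m) / 2) u ≤ Real.exp (m * u / (2 * M)) := by
  calc ballWeight M ((M - m) / 2) u
      ≤ Real.exp (-((M - m) / 2 * (u / M))) * Real.exp (u / 2) := by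
        unfold ballWeight
        gcongr
        exact rpow_le_exp_neg (by linarith)
    _ = _ := by rw [← Real.exp_add]; congr 1; field_simp; ring

/-- Uniform bound for `ballWeight`: only `u ≤ M` matters, and there
`(1 - u / M) ^ q ≤ exp (-q u / M)`. -/
lemma ballWeight_le {M m u : ℝ} (hM : 0 < M) (hm0 : 0 ≤ m) (hm : m + 2 ≤ M) :
    ballWeight M ((M - m) / 2) u ≤ Real.exp (m / 2) := by
  rcases le_total M u with hu | hu
  · rw [ballWeight_eq_zero hM (by linarith) hu]; positivity
  · refine (ballWeight_le_exp hM (by linarith)).trans (Real.exp_le_exp.2 ?_)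
    rw [div_le_div_iff₀ (by positivity) (by positivity)]
    nlinarith

/-- The upper bound comes from `(1 - u / M) ^ q ≤ exp (-q u / M)`, the lower bound from
`exp (u / 2) ≥ (1 + u / M) ^ q` and Bernoulli's inequality for `(1 - (u / M)²) ^ q`, where
`q = (M - m) / 2`. -/
lemma abs_ballWeight_sub_one_le {M m u : ℝ} (hM : 0 < M) (hm0 : 0 ≤ m) (hm : m + 2 ≤ M)
    (hu : 0 ≤ u) :
    |ballWeight M ((M - m) / 2) u - 1| ≤ (1 + m * Real.exp (m / 2)) / M * (1 + u) ^ 2 := by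
  have hq : 1 ≤ (M - m) / 2 := by linarith
  have hE : 0 < Real.exp (m / 2) := Real.exp_pos _
  have hC : 0 ≤ m * Real.exp (m / 2) := by positivity
  rw [abs_le]
  constructor
  · have h1 : 1 - (M - m) / 2 * (u / M) ^ 2 ≤ ballWeight M ((M - m) / 2) u := by
      rcases le_total M u with hMu | hMu
      · rw [ballWeight_eq_zero hM (by linarith) hMu]
        have : 1 ≤ u / M := (one_le_div hM).2 hMu
        nlinarith
      · have hb : u / M ≤ 1 := (div_le_one hM).2 hMu
        have hb0 : 0 ≤ u / M := by positivity
        calc 1 - (M - m) / 2 * (u / M) ^ 2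
            ≤ (max (1 - (u / M) ^ 2) 0) ^ ((M - m) / 2) := one_sub_mul_le_rpow hq
          _ = (max (1 - u / M) 0) ^ ((M - m) / 2) * (1 + u / M) ^ ((M - m) / 2) := by
            rw [← Real.mul_rpow (by positivity) (by positivity),
              max_eq_left (by nlinarith), max_eq_left (by linarith)]
            congr 1; ring
          _ ≤ (max (1 - u / M) 0) ^ ((M - m) / 2) * Real.exp (u / 2) := by
            gcongr
            calc (1 + u / M) ^ ((M - m) / 2) ≤ (Real.exp (u / M)) ^ ((M - m) / 2) := by
                  refine Real.rpow_le_rpow (by positivity) ?_ (by linarith)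
                  linarith [Real.add_one_le_exp (u / M)]
              _ = Real.exp (u / M * ((M - m) / 2)) := by rw [← Real.exp_mul]
              _ ≤ Real.exp (u / 2) := by
                refine Real.exp_le_exp.2 ?_
                rw [div_mul_div_comm, div_le_div_iff₀ (by positivity) (by positivity)]
                nlinarith [mul_nonneg hu hm0]
    have h2 : (M - m) / 2 * (u / M) ^ 2 ≤ 1 / M * u ^ 2 := by
      rw [div_pow, div_mul_div_comm, div_mul_eq_mul_div, div_le_div_iff₀ (by positivity) hM]
      nlinarith [mul_nonneg (mul_nonneg hm0 hM.le) (sq_nonneg u),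
        mul_nonneg (mul_nonneg hM.le hM.le) (sq_nonneg u)]
    have h3 : 1 / M * u ^ 2 ≤ (1 + m * Real.exp (m / 2)) / M * (1 + u) ^ 2 := by
      gcongr <;> linarith
    linarith
  · rcases le_total M u with hMu | hMu
    · rw [ballWeight_eq_zero hM (by linarith) hMu]
      have : 0 ≤ (1 + m * Real.exp (m / 2)) / M * (1 + u) ^ 2 := by positivity
      linarith
    · have h1 := ballWeight_le_exp (u := u) hM (by linarith : m ≤ M)
      set v := m * u / (2 * M) with hv
      have hvm : v ≤ m / 2 := by
        rw [hv, div_le_div_iff₀ (by positivity) (by positivity)]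
        nlinarith
      have hv0 : 0 ≤ v := by positivity
      have h2 : Real.exp v - 1 ≤ v * Real.exp v := by
        have := Real.add_one_le_exp (-v)
        have h3 : Real.exp v * Real.exp (-v) = 1 := by rw [← Real.exp_add]; simp
        nlinarith [Real.exp_pos v]
      have h3 : v * Real.exp v ≤ v * Real.exp (m / 2) := by gcongr
      have h4 : v * Real.exp (m / 2) ≤ (1 + m * Real.exp (m / 2)) / M * (1 + u) ^ 2 := by
        calc v * Real.exp (m / 2) = (m * Real.exp (m / 2)) / M * (u / 2) := by
              rw [hv]; field_simp
          _ ≤ _ := by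
            gcongr
            · linarith
            · nlinarith
      linarith

variable {F : Type*} [NormedAddCommGroup F] [InnerProductSpace ℝ F]

omit [InnerProductSpace ℝ F] in
lemma abs_ballWeight_norm_sub_one_le {M m : ℝ} (hM : 0 < M) (hm0 : 0 ≤ m) (hm : m + 2 ≤ M)
    (x : F) :
    |ballWeight M ((M - m) / 2) (‖x‖ ^ 2) - 1| ≤
      (1 + m * Real.exp (m / 2)) / M * (1 + ‖x‖) ^ 4 := by
  refine (abs_ballWeight_sub_one_le hM hm0 hm (by positivity)).trans ?_
  gcongr
  calc (1 + ‖x‖ ^ 2) ^ 2 ≤ ((1 + ‖x‖) ^ 2) ^ 2 := by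
        gcongr
        nlinarith [norm_nonneg x]
    _ = _ := by ring

/-- The expansion of `r ↦ (t - r)₊ ^ p` with `t = (1 - ‖x‖² / M)₊ (1 - ‖y‖² / M)₊` and
`r = (1 + ⟪x, y⟫)² / M²`. Lowering the exponent by one raises `m` by two. -/
lemma pairKernel_expansion {M m : ℝ} (hM : 0 < M) (hm : m + 6 ≤ M) (x y : F) :
    |pairKernel M ((M - m) / 2) x y
      - ballWeight M ((M - m) / 2) (‖x‖ ^ 2) * ballWeight M ((M - m) / 2) (‖y‖ ^ 2)
      + (M - m) / 2 / M ^ 2 * (1 + ⟪x, y⟫) ^ 2 *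
        (ballWeight M ((M - (m + 2)) / 2) (‖x‖ ^ 2) * ballWeight M ((M - (m + 2)) / 2) (‖y‖ ^ 2))| ≤
    ((M - m) / 2 / M ^ 2 * (1 + ⟪x, y⟫) ^ 2) ^ 2 *
      (ballWeight M ((M - (m + 4)) / 2) (‖x‖ ^ 2) *
        ballWeight M ((M - (m + 4)) / 2) (‖y‖ ^ 2)) := by
  set p := (M - m) / 2 with hp
  have hp1 : (M - (m + 2)) / 2 = p - 1 := by rw [hp]; ring
  have hp2 : (M - (m + 4)) / 2 = p - 2 := by rw [hp]; ring
  have hp3 : 2 < p := by rw [hp]; linarith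
  set a := max (1 - ‖x‖ ^ 2 / M) 0 with ha
  set b := max (1 - ‖y‖ ^ 2 / M) 0 with hb
  have ha0 : 0 ≤ a := le_max_right _ _
  have hb0 : 0 ≤ b := le_max_right _ _
  set r := (1 + ⟪x, y⟫) ^ 2 / M ^ 2 with hr
  have hprod : ∀ q, ballWeight M q (‖x‖ ^ 2) * ballWeight M q (‖y‖ ^ 2) =
      (a * b) ^ q * Real.exp ((‖x‖ ^ 2 + ‖y‖ ^ 2) / 2) := by
    intro q
    rw [ballWeight, ballWeight, Real.mul_rpow ha0 hb0, add_div, Real.exp_add]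
    ring
  have hE : 0 < Real.exp ((‖x‖ ^ 2 + ‖y‖ ^ 2) / 2) := Real.exp_pos _
  rw [hp1, hp2, hprod, hprod, hprod, pairKernel, ← ha, ← hb, ← hr]
  set E := Real.exp ((‖x‖ ^ 2 + ‖y‖ ^ 2) / 2)
  have h := abs_rpow_sub_le (mul_nonneg ha0 hb0) (by positivity : 0 ≤ r) hp3
  have hpr : p / M ^ 2 * (1 + ⟪x, y⟫) ^ 2 = p * r := by rw [hr]; ring
  rw [hpr]
  calc _ = |(max (a * b - r) 0) ^ p - (a * b) ^ p + p * r * (a * b) ^ (p - 1)| * E := by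
        rw [← abs_of_pos hE, ← abs_mul, abs_of_pos hE]; congr 1; ring
    _ ≤ (p ^ 2 * r ^ 2 * (a * b) ^ (p - 2)) * E := by gcongr
    _ = _ := by ring

lemma sq_one_add_inner_le (x y : F) :
    (1 + ⟪x, y⟫) ^ 2 ≤ ((1 + ‖x‖) * (1 + ‖y‖)) ^ 2 := by
  have h := abs_real_inner_le_norm x y
  have hx := norm_nonneg x
  have hy := norm_nonneg y
  rw [sq_le_sq, abs_of_nonneg (by positivity : 0 ≤ (1 + ‖x‖) * (1 + ‖y‖))]
  calc |1 + ⟪x, y⟫| ≤ |1| + |⟪x, y⟫| := abs_add_le _ _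
    _ ≤ _ := by rw [abs_one]; nlinarith

lemma abs_mul_sub_one_le {a b A B D : ℝ} (ha : |a - 1| ≤ A) (hb : |b - 1| ≤ B) (hb0 : 0 ≤ b)
    (hbD : b ≤ D) (hA : 0 ≤ A) : |a * b - 1| ≤ A * D + B := by
  calc |a * b - 1| = |(a - 1) * b + (b - 1)| := by congr 1; ring
    _ ≤ |(a - 1) * b| + |b - 1| := abs_add_le _ _
    _ ≤ A * D + B := by
      rw [abs_mul, abs_of_nonneg hb0]
      gcongr

/-- The pair density to second order: the deviation from independence is `-(1 + ⟪x, y⟫)² / (2 M)` up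
to `O(M⁻²)`, besides the factor `ballWeight` in each variable. -/
lemma exists_pairKernel_bound {m : ℝ} (hm0 : 0 ≤ m) :
    ∃ C, 0 ≤ C ∧ ∀ M, m + 6 ≤ M → ∀ x y : F,
      |ballWeight M ((M - m) / 2) (‖x‖ ^ 2) - 1| ≤ C / M * (1 + ‖x‖) ^ 6 ∧
      |pairKernel M ((M - m) / 2) x y
        - ballWeight M ((M - m) / 2) (‖x‖ ^ 2) * ballWeight M ((M - m) / 2) (‖y‖ ^ 2)
        + (1 + ⟪x, y⟫) ^ 2 / (2 * M)| ≤ C / M ^ 2 * ((1 + ‖x‖) ^ 6 * (1 + ‖y‖) ^ 6) ∧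
      |pairKernel M ((M - m) / 2) x y - 1| ≤ C / M * ((1 + ‖x‖) ^ 6 * (1 + ‖y‖) ^ 6) := by
  -- `D` bounds the weights with the exponents `(M - m) / 2 - j`, `j ≤ 2`, and `B / M` their
  -- distance to `1`
  set D := Real.exp ((m + 4) / 2) with hD
  have hD1 : 1 ≤ D := Real.one_le_exp (by linarith)
  set B := 1 + (m + 4) * D with hB
  have hB0 : 0 ≤ B := by positivity
  refine ⟨2 * (D ^ 2 + B * (D + 1) + m * D ^ 2) + 1, by positivity, fun M hM x y => ?_⟩
  have hM0 : 0 < M := by linarith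
  have hM1 : 1 ≤ M := by linarith
  set wx := 1 + ‖x‖ with hwx
  set wy := 1 + ‖y‖ with hwy
  have hx1 : 1 ≤ wx := by linarith [norm_nonneg x]
  have hy1 : 1 ≤ wy := by linarith [norm_nonneg y]
  have hW : 1 ≤ wx * wy := one_le_mul_of_one_le_of_one_le hx1 hy1
  have hxW : wx ≤ wx * wy := le_mul_of_one_le_right (by linarith) hy1
  have hyW : wy ≤ wx * wy := le_mul_of_one_le_left (by linarith) hx1
  rw [← mul_pow wx wy 6]
  set W := wx * wy
  -- bounds for the three weights, uniform in the shift of the exponent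
  have hbound : ∀ m', 0 ≤ m' → m' ≤ m + 4 → ∀ z : F,
      |ballWeight M ((M - m') / 2) (‖z‖ ^ 2) - 1| ≤ B / M * (1 + ‖z‖) ^ 4 ∧
      ballWeight M ((M - m') / 2) (‖z‖ ^ 2) ≤ D := by
    intro m' h0 h4 z
    have hexp : Real.exp (m' / 2) ≤ D := Real.exp_le_exp.2 (by linarith)
    refine ⟨(abs_ballWeight_norm_sub_one_le hM0 h0 (by linarith) z).trans ?_,
      (ballWeight_le hM0 h0 (by linarith)).trans hexp⟩
    gcongr
    rw [hB]
    gcongr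
  have hprod : ∀ m', 0 ≤ m' → m' ≤ m + 4 →
      |ballWeight M ((M - m') / 2) (‖x‖ ^ 2) * ballWeight M ((M - m') / 2) (‖y‖ ^ 2) - 1| ≤
        B * (D + 1) / M * W ^ 4 := by
    intro m' h0 h4
    refine (abs_mul_sub_one_le (hbound m' h0 h4 x).1 (hbound m' h0 h4 y).1 (ballWeight_nonneg _ _ _)
      (hbound m' h0 h4 y).2 (by positivity)).trans ?_
    calc B / M * wx ^ 4 * D + B / M * wy ^ 4 ≤ B / M * W ^ 4 * D + B / M * W ^ 4 := by gcongr
      _ = _ := by ring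
  have hs := sq_one_add_inner_le x y
  set s := (1 + ⟪x, y⟫) ^ 2 with hsdef
  have hs0 : 0 ≤ s := sq_nonneg _
  have hsW : s ≤ W ^ 2 := hs
  have hexp := pairKernel_expansion hM0 hM x y
  have hp0 : 0 ≤ (M - m) / 2 / M ^ 2 := div_nonneg (by linarith) (by positivity)
  have hp1 : (M - m) / 2 / M ^ 2 ≤ 1 / M := by
    calc (M - m) / 2 / M ^ 2 ≤ M / M ^ 2 := by gcongr; linarith
      _ = 1 / M := by field_simp
  have h1 := hprod m hm0 (by linarith)
  have h2 := hprod (m + 2) (by linarith) (by linarith)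
  have b1 := (hbound (m + 2) (by linarith) (by linarith) x).2
  have b2 := (hbound (m + 2) (by linarith) (by linarith) y).2
  have b3 := (hbound (m + 4) (by linarith) le_rfl x).2
  have b4 := (hbound (m + 4) (by linarith) le_rfl y).2
  have n1 := ballWeight_nonneg M ((M - (m + 2)) / 2) (‖x‖ ^ 2)
  have n2 := ballWeight_nonneg M ((M - (m + 2)) / 2) (‖y‖ ^ 2)
  have n3 := ballWeight_nonneg M ((M - (m + 4)) / 2) (‖x‖ ^ 2)
  have n4 := ballWeight_nonneg M ((M - (m + 4)) / 2) (‖y‖ ^ 2)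
  set a₁ := ballWeight M ((M - (m + 2)) / 2) (‖x‖ ^ 2)
  set a₁' := ballWeight M ((M - (m + 2)) / 2) (‖y‖ ^ 2)
  set a₂ := ballWeight M ((M - (m + 4)) / 2) (‖x‖ ^ 2)
  set a₂' := ballWeight M ((M - (m + 4)) / 2) (‖y‖ ^ 2)
  set aa := ballWeight M ((M - m) / 2) (‖x‖ ^ 2) * ballWeight M ((M - m) / 2) (‖y‖ ^ 2)
  set κ := pairKernel M ((M - m) / 2) x y
  have hW46 : W ^ 4 ≤ W ^ 6 := pow_le_pow_right₀ hW (by norm_num)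
  have hW26 : W ^ 2 ≤ W ^ 6 := pow_le_pow_right₀ hW (by norm_num)
  have second : |κ - aa + s / (2 * M)| ≤
      (D ^ 2 + B * (D + 1) + m * D ^ 2) / M ^ 2 * W ^ 6 := by
    have t1 : ((M - m) / 2 / M ^ 2 * s) ^ 2 * (a₂ * a₂') ≤ D ^ 2 / M ^ 2 * W ^ 6 := by
      calc ((M - m) / 2 / M ^ 2 * s) ^ 2 * (a₂ * a₂') ≤ (1 / M * W ^ 2) ^ 2 * (D * D) := by gcongr
        _ = D ^ 2 / M ^ 2 * W ^ 4 := by ring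
        _ ≤ _ := by gcongr
    have t2 : s / (2 * M) * |a₁ * a₁' - 1| ≤ B * (D + 1) / M ^ 2 * W ^ 6 := by
      calc s / (2 * M) * |a₁ * a₁' - 1| ≤ W ^ 2 / (1 * M) * (B * (D + 1) / M * W ^ 4) := by
            gcongr; norm_num
        _ = _ := by field_simp
    have t3 : m / (2 * M ^ 2) * s * (a₁ * a₁') ≤ m * D ^ 2 / M ^ 2 * W ^ 6 := by
      calc m / (2 * M ^ 2) * s * (a₁ * a₁') ≤ m / (1 * M ^ 2) * W ^ 6 * (D * D) := by
            gcongr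
            · norm_num
            · exact hsW.trans hW26
        _ = _ := by ring
    have e : κ - aa + s / (2 * M) = (κ - aa + (M - m) / 2 / M ^ 2 * s * (a₁ * a₁')) +
        (-(s / (2 * M) * (a₁ * a₁' - 1)) + m / (2 * M ^ 2) * s * (a₁ * a₁')) := by
      field_simp
      ring
    rw [e]
    refine (abs_add_le _ _).trans ((add_le_add hexp (abs_add_le _ _)).trans ?_)
    rw [abs_neg, abs_mul (s / (2 * M)), abs_of_nonneg (by positivity : 0 ≤ s / (2 * M)),
      abs_of_nonneg (by positivity : 0 ≤ m / (2 * M ^ 2) * s * (a₁ * a₁'))]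
    calc _ ≤ D ^ 2 / M ^ 2 * W ^ 6 + (B * (D + 1) / M ^ 2 * W ^ 6 + m * D ^ 2 / M ^ 2 * W ^ 6) := by
          gcongr
      _ = _ := by ring
  have hC0 : 0 ≤ D ^ 2 + B * (D + 1) + m * D ^ 2 := by positivity
  have hD2 : 0 ≤ D ^ 2 := sq_nonneg D
  have hmD : 0 ≤ m * D ^ 2 := mul_nonneg hm0 hD2
  have hBB : B * 1 ≤ B * (D + 1) := mul_le_mul_of_nonneg_left (by linarith) hB0
  have hBD : B ≤ D ^ 2 + B * (D + 1) + m * D ^ 2 := by linarith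
  have hBD' : B * (D + 1) ≤ D ^ 2 + B * (D + 1) + m * D ^ 2 := by linarith
  set C₀ := D ^ 2 + B * (D + 1) + m * D ^ 2
  refine ⟨(hbound m hm0 (by linarith) x).1.trans ?_, second.trans ?_, ?_⟩
  · have : wx ^ 4 ≤ wx ^ 6 := pow_le_pow_right₀ hx1 (by norm_num)
    gcongr
    linarith
  · gcongr
    linarith
  · have e : κ - 1 = (κ - aa + s / (2 * M)) + ((aa - 1) - s / (2 * M)) := by ring
    rw [e]
    refine (abs_add_le _ _).trans ((add_le_add second (abs_sub _ _)).trans ?_)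
    rw [abs_of_nonneg (by positivity : 0 ≤ s / (2 * M))]
    have hMM : M ≤ M ^ 2 := le_self_pow₀ hM1 two_ne_zero
    calc _ ≤ C₀ / M * W ^ 6 + (C₀ / M * W ^ 6 + W ^ 6 / (1 * M)) := by
          gcongr
          · exact h1.trans (by gcongr)
          · exact hsW.trans hW26
          · norm_num
      _ = _ := by ring

end Kernel

/-! ### Integrals against the pair density -/

section KernelIntegral

variable {F : Type*} [NormedAddCommGroup F] [InnerProductSpace ℝ F] [FiniteDimensional ℝ F]
  [MeasurableSpace F] [BorelSpace F]

lemma integrable_one_add_norm_pow (k : ℕ) :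
    Integrable (fun x : F => (1 + ‖x‖) ^ k) (stdGaussian F) := by
  have h0 : MemLp (fun x : F => x) (k : ENNReal) (stdGaussian F) :=
    IsGaussian.memLp_id (stdGaussian F) _ (by simp)
  have h1 : MemLp (fun x : F => 1 + ‖x‖) (k : ENNReal) (stdGaussian F) :=
    MemLp.add (memLp_const (1 : ℝ)) h0.norm
  refine h1.integrable_norm_pow'.congr (ae_of_all _ fun x => ?_)
  simp only [Real.norm_eq_abs]
  rw [abs_of_nonneg (by positivity)]

/-- The weight `(1 + ‖x‖) ^ 8` makes `g (1 + ‖x‖) ^ 4` square integrable; multiplied by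
`(1 + ‖x‖) ^ 2` it is integrable by the inequality of arithmetic and geometric means. -/
lemma integrable_mul_pow_of_sq {g : F → ℝ} (hg : Measurable g)
    (hint : Integrable (fun x => (1 + ‖x‖) ^ 8 * g x ^ 2) (stdGaussian F)) :
    Integrable (fun x => g x ^ 2 * (1 + ‖x‖) ^ 6) (stdGaussian F) ∧
      Integrable (fun x => g x * (1 + ‖x‖) ^ 6) (stdGaussian F) := by
  constructor
  · refine hint.mono' (by fun_prop) (ae_of_all _ fun x => ?_)
    rw [Real.norm_eq_abs, abs_of_nonneg (by positivity), mul_comm]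
    gcongr <;> norm_num
  · refine (hint.add (integrable_one_add_norm_pow 4)).mono' (by fun_prop) (ae_of_all _ fun x => ?_)
    rw [norm_mul, norm_pow, Real.norm_eq_abs, Real.norm_eq_abs,
      abs_of_nonneg (by positivity : 0 ≤ 1 + ‖x‖), Pi.add_apply, ← sq_abs (g x)]
    nlinarith [sq_nonneg ((1 + ‖x‖) ^ 4 * |g x| - (1 + ‖x‖) ^ 2),
      mul_nonneg (pow_nonneg (by positivity : 0 ≤ 1 + ‖x‖) 6) (abs_nonneg (g x))]

omit [InnerProductSpace ℝ F] [FiniteDimensional ℝ F] [BorelSpace F] in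
lemma integrable_mul_of_le_one_add_norm_pow {g : F → ℝ} (hg : Measurable g) {k : ℕ} {μ : Measure F}
    (hint : Integrable (fun x => g x * (1 + ‖x‖) ^ k) μ) {q : F → ℝ} (hq : Measurable q) {D : ℝ}
    (hqD : ∀ x, |q x| ≤ D * (1 + ‖x‖) ^ k) : Integrable (fun x => g x * q x) μ := by
  refine (hint.norm.const_mul D).mono' (by fun_prop) (ae_of_all _ fun x => ?_)
  rw [norm_mul, norm_mul, norm_pow, Real.norm_eq_abs, Real.norm_eq_abs, Real.norm_eq_abs,
    abs_of_nonneg (by positivity : 0 ≤ 1 + ‖x‖)]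
  calc |g x| * |q x| ≤ |g x| * (D * (1 + ‖x‖) ^ k) := by gcongr; exact hqD x
    _ = _ := by ring

/-- If `k` is `ε`-close to `1` relative to a weight `W`, integrals against `k` are `ε`-close to
plain integrals. -/
lemma integral_mul_sub_le {α : Type*} [MeasurableSpace α] {μ : Measure α} {k W h : α → ℝ}
    {ε : ℝ} (hk : AEStronglyMeasurable k μ) (hh : Integrable h μ)
    (hhW : Integrable (fun z => h z * W z) μ) (hkW : ∀ z, |k z - 1| ≤ ε * W z) (hW : ∀ z, 0 ≤ W z) :
    Integrable (fun z => h z * k z) μ ∧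
      |∫ z, h z * k z ∂μ - ∫ z, h z ∂μ| ≤ ε * ∫ z, |h z| * W z ∂μ := by
  have h1 : Integrable (fun z => h z * (k z - 1)) μ := by
    refine (hhW.norm.const_mul ε).mono'
      (hh.aestronglyMeasurable.mul (hk.sub aestronglyMeasurable_const)) (ae_of_all _ fun z => ?_)
    rw [norm_mul, norm_mul, Real.norm_eq_abs, Real.norm_eq_abs, Real.norm_eq_abs,
      abs_of_nonneg (hW z)]
    calc |h z| * |k z - 1| ≤ |h z| * (ε * W z) := by gcongr; exact hkW z
      _ = _ := by ring
  have h2 : (fun z => h z * k z) = fun z => h z + h z * (k z - 1) := by ext z; ring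
  refine ⟨h2 ▸ hh.add h1, ?_⟩
  rw [h2, integral_add hh h1, add_sub_cancel_left, ← integral_const_mul, ← Real.norm_eq_abs]
  refine norm_integral_le_of_norm_le ((hhW.abs.const_mul ε).congr (ae_of_all _ fun z => ?_))
    (ae_of_all _ fun z => ?_)
  · simp only [abs_mul, abs_of_nonneg (hW z)]
  · rw [norm_mul, Real.norm_eq_abs, Real.norm_eq_abs]
    calc |h z| * |k z - 1| ≤ |h z| * (ε * W z) := by gcongr; exact hkW z
      _ = _ := by ring

/-- Integrals against the pair density are `O(1 / M)`-close to those for independent standard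
Gaussian variables. -/
lemma exists_integral_pairKernel_sub_le {m : ℝ} (hm : 0 ≤ m) {h : F × F → ℝ}
    (hh : Measurable h) (hhW : Integrable (fun z => h z * ((1 + ‖z.1‖) ^ 6 * (1 + ‖z.2‖) ^ 6))
      ((stdGaussian F).prod (stdGaussian F))) :
    ∃ C, ∀ M, m + 6 ≤ M →
      Integrable (fun z => h z * pairKernel M ((M - m) / 2) z.1 z.2)
        ((stdGaussian F).prod (stdGaussian F)) ∧
      |∫ z, h z * pairKernel M ((M - m) / 2) z.1 z.2 ∂((stdGaussian F).prod (stdGaussian F)) -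
        ∫ z, h z ∂((stdGaussian F).prod (stdGaussian F))| ≤ C / M := by
  obtain ⟨C, hC, hCb⟩ := exists_pairKernel_bound (F := F) hm
  have hh1 : Integrable h ((stdGaussian F).prod (stdGaussian F)) := by
    refine hhW.mono hh.aestronglyMeasurable (ae_of_all _ fun z => ?_)
    rw [norm_mul]
    refine le_mul_of_one_le_right (norm_nonneg _) ?_
    rw [Real.norm_eq_abs, abs_of_nonneg (by positivity)]
    exact one_le_mul_of_one_le_of_one_le (one_le_pow₀ (by linarith [norm_nonneg z.1]))
      (one_le_pow₀ (by linarith [norm_nonneg z.2]))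
  refine ⟨C * ∫ z, |h z| * ((1 + ‖z.1‖) ^ 6 * (1 + ‖z.2‖) ^ 6)
    ∂((stdGaussian F).prod (stdGaussian F)), fun M hM => ?_⟩
  have := integral_mul_sub_le (ε := C / M)
    (measurable_pairKernel M ((M - m) / 2)).aestronglyMeasurable hh1 hhW
    (fun z => (hCb M hM z.1 z.2).2.2) (fun z => by positivity)
  refine ⟨this.1, this.2.trans_eq (by ring)⟩

/-- Against the pair density, a function orthogonal to all quadratic polynomials has correlation
`O(M⁻²)` between the two coordinates. -/
lemma exists_integral_mul_pairKernel_le {m : ℝ} (hm : 0 ≤ m) {g : F → ℝ} (hg : Measurable g)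
    (hint : Integrable (fun x => (1 + ‖x‖) ^ 8 * g x ^ 2) (stdGaussian F))
    (hg0 : ∫ x, g x ∂(stdGaussian F) = 0)
    (hg2 : ∀ y, ∫ x, g x * (1 + ⟪y, x⟫) ^ 2 ∂(stdGaussian F) = 0) :
    ∃ C, ∀ M, m + 6 ≤ M →
      |∫ z, g z.1 * g z.2 * pairKernel M ((M - m) / 2) z.1 z.2
        ∂((stdGaussian F).prod (stdGaussian F))| ≤ C / M ^ 2 := by
  obtain ⟨C, hC, hCb⟩ := exists_pairKernel_bound (F := F) hm
  have hg6 := (integrable_mul_pow_of_sq hg hint).2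
  have hgi : Integrable g (stdGaussian F) := by
    simpa using integrable_mul_of_le_one_add_norm_pow hg hg6 (q := fun _ => 1) (by fun_prop) (D := 1)
      (fun x => by rw [abs_one, one_mul]; exact one_le_pow₀ (by linarith [norm_nonneg x]))
  set γ := stdGaussian F
  set J := ∫ x, |g x| * (1 + ‖x‖) ^ 6 ∂γ with hJ
  refine ⟨(C * J) ^ 2 + C * (J * J), fun M hM => ?_⟩
  have hM0 : 0 < M := by linarith
  set p := (M - m) / 2
  set a : F → ℝ := fun x => ballWeight M p (‖x‖ ^ 2) with ha
  have ham : Measurable a := by rw [ha]; unfold ballWeight; fun_prop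
  obtain ⟨ha1, ha2⟩ := integral_mul_sub_le (ε := C / M) ham.aestronglyMeasurable hgi hg6
    (fun x => (hCb M hM x x).1) (fun x => by positivity)
  rw [hg0, sub_zero] at ha2
  have hprod : ∫ z, (g z.1 * a z.1) * (g z.2 * a z.2) ∂(γ.prod γ) = (∫ x, g x * a x ∂γ) ^ 2 := by
    rw [integral_prod_mul (fun x => g x * a x) (fun x => g x * a x), sq]
  have hpi := ha1.mul_prod ha1
  -- the term of order `1 / M` integrates to zero, being quadratic in the second variable
  have hsi : Integrable (fun z : F × F => g z.1 * (g z.2 * (1 + ⟪z.1, z.2⟫) ^ 2)) (γ.prod γ) := by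
    refine (hg6.mul_prod hg6).mono (by fun_prop) (ae_of_all _ fun z => ?_)
    simp only [norm_mul, norm_pow, Real.norm_eq_abs]
    rw [← abs_pow (1 + ⟪z.1, z.2⟫), abs_of_nonneg (sq_nonneg (1 + ⟪z.1, z.2⟫)),
      abs_of_nonneg (by positivity : 0 ≤ 1 + ‖z.1‖), abs_of_nonneg (by positivity : 0 ≤ 1 + ‖z.2‖)]
    have h1 := sq_one_add_inner_le z.1 z.2
    have h2 : ((1 + ‖z.1‖) * (1 + ‖z.2‖)) ^ 2 ≤ ((1 + ‖z.1‖) * (1 + ‖z.2‖)) ^ 6 :=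
      pow_le_pow_right₀ (one_le_mul_of_one_le_of_one_le (by linarith [norm_nonneg z.1])
        (by linarith [norm_nonneg z.2])) (by norm_num)
    calc |g z.1| * (|g z.2| * (1 + ⟪z.1, z.2⟫) ^ 2)
        ≤ |g z.1| * (|g z.2| * ((1 + ‖z.1‖) * (1 + ‖z.2‖)) ^ 6) := by gcongr; exact h1.trans h2
      _ = _ := by ring
  have hs0 : ∫ z, g z.1 * (g z.2 * (1 + ⟪z.1, z.2⟫) ^ 2) ∂(γ.prod γ) = 0 := by
    rw [integral_prod _ hsi]
    simp only [integral_const_mul, hg2, mul_zero, integral_zero]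
  have hmain : ∫ z, g z.1 * g z.2 * pairKernel M p z.1 z.2 ∂(γ.prod γ) =
      (∫ x, g x * a x ∂γ) ^ 2 + ∫ z, g z.1 * g z.2 * (pairKernel M p z.1 z.2 - a z.1 * a z.2 +
        (1 + ⟪z.1, z.2⟫) ^ 2 / (2 * M)) ∂(γ.prod γ) := by
    have hRi : Integrable (fun z : F × F => g z.1 * g z.2 * (pairKernel M p z.1 z.2 -
        a z.1 * a z.2 + (1 + ⟪z.1, z.2⟫) ^ 2 / (2 * M))) (γ.prod γ) := by
      have hκ := measurable_pairKernel (F := F) M p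
      refine ((hg6.mul_prod hg6).norm.const_mul (C / M ^ 2)).mono'
        (Measurable.aestronglyMeasurable (by fun_prop)) (ae_of_all _ fun z => ?_)
      have h3 := (hCb M hM z.1 z.2).2.1
      simp only [norm_mul, norm_pow, Real.norm_eq_abs]
      rw [abs_of_nonneg (by positivity : 0 ≤ 1 + ‖z.1‖), abs_of_nonneg (by positivity : 0 ≤ 1 + ‖z.2‖)]
      calc _ ≤ |g z.1| * |g z.2| * (C / M ^ 2 * ((1 + ‖z.1‖) ^ 6 * (1 + ‖z.2‖) ^ 6)) := by
            gcongr
        _ = _ := by ring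
    rw [← hprod]
    have h4 : ∀ z : F × F, g z.1 * g z.2 * pairKernel M p z.1 z.2 =
        (g z.1 * a z.1) * (g z.2 * a z.2) +
        (g z.1 * g z.2 * (pairKernel M p z.1 z.2 - a z.1 * a z.2 +
        (1 + ⟪z.1, z.2⟫) ^ 2 / (2 * M)) -
          (2 * M)⁻¹ * (g z.1 * (g z.2 * (1 + ⟪z.1, z.2⟫) ^ 2))) := fun z => by ring
    have hsi' := hsi.const_mul (2 * M)⁻¹
    have hsub : Integrable (fun z : F × F => g z.1 * g z.2 * (pairKernel M p z.1 z.2 -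
        a z.1 * a z.2 + (1 + ⟪z.1, z.2⟫) ^ 2 / (2 * M)) -
          (2 * M)⁻¹ * (g z.1 * (g z.2 * (1 + ⟪z.1, z.2⟫) ^ 2))) (γ.prod γ) := hRi.sub hsi'
    simp_rw [h4]
    rw [integral_add hpi hsub, integral_sub hRi hsi', integral_const_mul, hs0, mul_zero, sub_zero]
  rw [hmain]
  refine (abs_add_le _ _).trans ?_
  have e1 : |(∫ x, g x * a x ∂γ) ^ 2| ≤ (C * J) ^ 2 / M ^ 2 := by
    rw [abs_pow]
    calc |∫ x, g x * a x ∂γ| ^ 2 ≤ (C / M * J) ^ 2 := by gcongr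
      _ = _ := by ring
  have e2 : |∫ z, g z.1 * g z.2 * (pairKernel M p z.1 z.2 - a z.1 * a z.2 +
        (1 + ⟪z.1, z.2⟫) ^ 2 / (2 * M)) ∂(γ.prod γ)| ≤ C * (J * J) / M ^ 2 := by
    have h5 : ∫ z, (|g z.1| * (1 + ‖z.1‖) ^ 6) * (|g z.2| * (1 + ‖z.2‖) ^ 6) ∂(γ.prod γ) = J * J :=
      integral_prod_mul (fun x => |g x| * (1 + ‖x‖) ^ 6) (fun x => |g x| * (1 + ‖x‖) ^ 6)
    have habs : Integrable (fun x => |g x| * (1 + ‖x‖) ^ 6) γ :=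
      hg6.abs.congr (ae_of_all _ fun x => by
        simp only [abs_mul, abs_of_nonneg (by positivity : 0 ≤ (1 + ‖x‖) ^ 6)])
    rw [← Real.norm_eq_abs, ← h5, mul_div_right_comm, ← integral_const_mul]
    refine norm_integral_le_of_norm_le ((habs.mul_prod habs).const_mul _) (ae_of_all _ fun z => ?_)
    have h3 := (hCb M hM z.1 z.2).2.1
    rw [norm_mul, norm_mul, Real.norm_eq_abs, Real.norm_eq_abs, Real.norm_eq_abs]
    calc _ ≤ |g z.1| * |g z.2| * (C / M ^ 2 * ((1 + ‖z.1‖) ^ 6 * (1 + ‖z.2‖) ^ 6)) := by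
          gcongr
      _ = _ := by ring
  calc _ ≤ (C * J) ^ 2 / M ^ 2 + C * (J * J) / M ^ 2 := add_le_add e1 e2
    _ = _ := by ring

end KernelIntegral

/-! ### The variance of averages over standardized samples -/

section Variance

variable {n N : ℕ}

lemma ae_isUnit_sampleCov {ν : Measure (EuclideanSpace ℝ (Fin n))} [IsProbabilityMeasure ν]
    (hν : ν ≪ volume) (hN : n + 1 ≤ N) :
    ∀ᵐ x ∂(Measure.pi fun _ : Fin N => ν), IsUnit (sampleCov x) := by
  have hind : iIndepFun (fun (i : Fin N) (x : Fin N → EuclideanSpace ℝ (Fin n)) => x i)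
      (Measure.pi fun _ : Fin N => ν) :=
    iIndepFun_pi (X := fun _ x => x) fun _ => aemeasurable_id
  have hsub := hind.precomp (Fin.castLE_injective hN)
  rw [iIndepFun_iff_map_fun_eq_pi_map fun i => (measurable_pi_apply _).aemeasurable] at hsub
  have hmap : ∀ i : Fin N, (Measure.pi fun _ : Fin N => ν).map (fun x => x i) = ν := fun i =>
    (measurePreserving_eval (fun _ : Fin N => ν) i).map_eq
  simp only [hmap] at hsub
  have h1 := ae_linearIndependent_sub hν
  rw [← hsub] at h1
  have hm : Measurable fun (x : Fin N → EuclideanSpace ℝ (Fin n)) (i : Fin (n + 1)) =>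
    x (Fin.castLE hN i) := by fun_prop
  filter_upwards [ae_of_ae_map hm.aemeasurable h1] with x hx
  have h2 := isUnit_sampleCov (fun i => if h : i < N then x ⟨i, h⟩ else 0) (N := N) ?_ hN
  · simpa using h2
  · convert hx using 2 with i
    have h3 : (i : ℕ) + 1 < N := by omega
    have h4 : 0 < N := by omega
    simp only [h3, h4, dif_pos]
    rfl

/-- Expectations of functions of two distinct standardized samples. The constant in the pair density
is the reciprocal of its integral, as both sides are probability laws. -/
lemma integral_stdSample_pair {S : Matrix (Fin n) (Fin n) ℝ} (hS : S.PosDef) (d : ℕ)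
    (hd : 2 < d) (hN : n + 2 + d = N)
    (hκ : Integrable (fun z : EuclideanSpace ℝ (Fin n) × EuclideanSpace ℝ (Fin n) =>
        pairKernel ((N : ℝ) - 1) ((d : ℝ) / 2 - 1) z.1 z.2)
      ((stdGaussian (EuclideanSpace ℝ (Fin n))).prod (stdGaussian (EuclideanSpace ℝ (Fin n)))))
    {k l : Fin N} (hkl : k ≠ l)
    {h : EuclideanSpace ℝ (Fin n) × EuclideanSpace ℝ (Fin n) → ℝ} (hh : Measurable h)
    (hhκ : Integrable (fun z => h z * pairKernel ((N : ℝ) - 1) ((d : ℝ) / 2 - 1) z.1 z.2)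
      ((stdGaussian (EuclideanSpace ℝ (Fin n))).prod (stdGaussian (EuclideanSpace ℝ (Fin n))))) :
    Integrable (fun x => h (stdSample x k, stdSample x l))
        (Measure.pi fun _ : Fin N => multivariateGaussian 0 S) ∧
      ∫ x, h (stdSample x k, stdSample x l)
          ∂(Measure.pi fun _ : Fin N => multivariateGaussian 0 S) =
        (∫ z, h z * pairKernel ((N : ℝ) - 1) ((d : ℝ) / 2 - 1) z.1 z.2
            ∂((stdGaussian (EuclideanSpace ℝ (Fin n))).prod
              (stdGaussian (EuclideanSpace ℝ (Fin n))))) /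
          ∫ z, pairKernel ((N : ℝ) - 1) ((d : ℝ) / 2 - 1) z.1 z.2
            ∂((stdGaussian (EuclideanSpace ℝ (Fin n))).prod
              (stdGaussian (EuclideanSpace ℝ (Fin n)))) := by
  obtain ⟨c, hc⟩ := exists_lintegral_stdSample_pair hS d hd hN
    (ae_isUnit_sampleCov (multivariateGaussian_absolutelyContinuous hS) (by omega))
  set μ := Measure.pi fun _ : Fin N => multivariateGaussian (0 : EuclideanSpace ℝ (Fin n)) S
  set γ := stdGaussian (EuclideanSpace ℝ (Fin n))
  obtain ⟨κ, hκdef⟩ : ∃ κ : EuclideanSpace ℝ (Fin n) × EuclideanSpace ℝ (Fin n) → ℝ,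
    ∀ z, κ z = pairKernel ((N : ℝ) - 1) ((d : ℝ) / 2 - 1) z.1 z.2 := ⟨_, fun _ => rfl⟩
  have hκm : Measurable κ := by
    rw [funext hκdef]; exact measurable_pairKernel _ _
  have hκ0 : ∀ z, 0 ≤ κ z := fun z => by rw [hκdef]; exact pairKernel_nonneg _ _ _ _
  simp only [← hκdef] at hκ hhκ ⊢
  have hc' : ∀ G : EuclideanSpace ℝ (Fin n) × EuclideanSpace ℝ (Fin n) → ENNReal, Measurable G →
      ∫⁻ x, G (stdSample x k, stdSample x l) ∂μ =
        c * ∫⁻ z, ENNReal.ofReal (κ z) * G z ∂(γ.prod γ) := fun G hG => by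
    rw [hc k l hkl G hG, lintegral_prod _ (by fun_prop)]
    simp only [hκdef]
  have hpm : Measurable fun x : Fin N → EuclideanSpace ℝ (Fin n) =>
      (stdSample x k, stdSample x l) := (measurable_stdSample k).prodMk (measurable_stdSample l)
  have hmap : μ.map (fun x => (stdSample x k, stdSample x l)) =
      c • (γ.prod γ).withDensity (fun z => ENNReal.ofReal (κ z)) := by
    refine Measure.ext_of_lintegral _ fun G hG => ?_
    rw [lintegral_map hG hpm, hc' G hG, lintegral_smul_measure,
      lintegral_withDensity_eq_lintegral_mul _ (by fun_prop) hG]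
    rfl
  set Z := ∫ z, κ z ∂(γ.prod γ) with hZ
  have h1 : 1 = c * ENNReal.ofReal Z := by
    have := hc' (fun _ => 1) measurable_const
    simp only [lintegral_const, measure_univ, mul_one] at this
    rw [this, hZ, ofReal_integral_eq_lintegral_ofReal hκ (ae_of_all _ hκ0)]
  have hZ0 : 0 < Z := by
    by_contra h0
    rw [ENNReal.ofReal_of_nonpos (not_lt.1 h0), mul_zero] at h1
    exact one_ne_zero h1
  have hcZ : c = (ENNReal.ofReal Z)⁻¹ := ENNReal.eq_inv_of_mul_eq_one_left h1.symm
  have hcR : c.toReal = Z⁻¹ := by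
    rw [hcZ, ENNReal.toReal_inv, ENNReal.toReal_ofReal hZ0.le]
  have hctop : c ≠ ⊤ := by
    rw [hcZ, ENNReal.inv_ne_top]
    exact (ENNReal.ofReal_pos.2 hZ0).ne'
  have hint : Integrable h (μ.map (fun x => (stdSample x k, stdSample x l))) := by
    rw [hmap]
    refine Integrable.smul_measure ?_ hctop
    rw [integrable_withDensity_iff (by fun_prop) (ae_of_all _ fun _ => ENNReal.ofReal_lt_top)]
    simpa only [ENNReal.toReal_ofReal (hκ0 _)] using hhκ
  refine ⟨hint.comp_measurable hpm, ?_⟩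
  rw [← integral_map hpm.aemeasurable hh.aestronglyMeasurable, hmap, integral_smul_measure, hcR,
    integral_withDensity_eq_integral_toReal_smul (by fun_prop)
      (ae_of_all _ fun _ => ENNReal.ofReal_lt_top)]
  simp only [ENNReal.toReal_ofReal (hκ0 _), smul_eq_mul]
  rw [div_eq_inv_mul]
  congr 2
  ext z
  ring

/-- The variance of an average of random variables with equal first and second moments. -/
lemma variance_average {Ω : Type*} [MeasurableSpace Ω] {μ : Measure Ω} [IsProbabilityMeasure μ]
    (hN : 0 < N) {W : Fin N → Ω → ℝ} {B Q e : ℝ} (hW : ∀ k, MemLp (W k) 2 μ)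
    (hB : ∀ k, ∫ ω, W k ω ^ 2 ∂μ = B) (he : ∀ k, ∫ ω, W k ω ∂μ = e)
    (hQ : ∀ k l, k ≠ l → ∫ ω, W k ω * W l ω ∂μ = Q) :
    MemLp (fun ω => (N : ℝ)⁻¹ * ∑ k, W k ω) 2 μ ∧
      variance (fun ω => (N : ℝ)⁻¹ * ∑ k, W k ω) μ = (B + (N - 1) * Q - N * e ^ 2) / N := by
  have hN0 : (N : ℝ) ≠ 0 := by positivity
  have hsum : MemLp (fun ω => ∑ k, W k ω) 2 μ := memLp_finsetSum _ fun k _ => hW k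
  have hprod : ∀ k l, Integrable (fun ω => W k ω * W l ω) μ := fun k l =>
    (hW k).integrable_mul (hW l)
  refine ⟨hsum.const_mul _, ?_⟩
  have h1 : ∫ ω, ∑ k, W k ω ∂μ = N * e := by
    rw [integral_finsetSum _ fun k _ => (hW k).integrable one_le_two]
    simp [he]
  have h2 : ∫ ω, (∑ k, W k ω) ^ 2 ∂μ = N * (B + (N - 1) * Q) := by
    simp only [sq, Finset.sum_mul_sum]
    rw [integral_finsetSum _ fun k _ => integrable_finsetSum _ fun l _ => hprod k l]
    have h3 : ∀ k, ∫ ω, ∑ l, W k ω * W l ω ∂μ = B + (N - 1) * Q := by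
      intro k
      rw [integral_finsetSum _ fun l _ => hprod k l, ← Finset.add_sum_erase _ _ (Finset.mem_univ k)]
      have h4 : ∀ l ∈ Finset.univ.erase k, ∫ ω, W k ω * W l ω ∂μ = Q := fun l hl =>
        hQ k l (Finset.ne_of_mem_erase hl).symm
      rw [Finset.sum_congr rfl h4, Finset.sum_const, Finset.card_erase_of_mem (Finset.mem_univ k),
        Finset.card_univ, Fintype.card_fin, nsmul_eq_mul, Nat.cast_pred hN, ← hB k]
      simp only [sq]
    simp only [h3, Finset.sum_const, Finset.card_univ, Fintype.card_fin, nsmul_eq_mul]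
  rw [variance_const_mul, variance_eq_sub hsum]
  have h5 : ∫ ω, ((fun ω => ∑ k, W k ω) ^ 2) ω ∂μ = N * (B + (N - 1) * Q) := h2
  rw [h5, h1]
  field_simp

end Variance

section VarianceAsymptotics

variable {n : ℕ}

/-- The error analysis for the variance. Here `Z` is the integral of the unnormalized pair density,
and `B`, `e` and `Q` are the integrals of `g(x)²`, `g(x)` and `g(x) g(y)` against it, so that
`B / Z + M Q / Z - (M + 1) (e / Z)²` is `N` times the variance of the average of `N = M + 1` terms.
-/
lemma abs_variance_ratio_sub_le {M Z B e Q v C₁ C₂ C₃ C₄ : ℝ} (hM : 1 ≤ M) (hMC : 2 * C₁ ≤ M)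
    (hZ : |Z - 1| ≤ C₁ / M) (hB : |B - v| ≤ C₂ / M) (he : |e| ≤ C₃ / M) (hQ : |Q| ≤ C₄ / M ^ 2) :
    |B / Z + M * (Q / Z) - (M + 1) * (e / Z) ^ 2 - v| ≤
      (2 * (C₂ + |v| * C₁) + 2 * C₄ + 8 * C₃ ^ 2) / M := by
  have hM0 : 0 < M := by linarith
  have h1 : C₁ / M ≤ 1 / 2 := by rw [div_le_div_iff₀ hM0 two_pos]; linarith
  have hZ2 : 1 / 2 ≤ Z := by have := (abs_le.1 hZ).1; linarith
  have hZ0 : 0 < Z := by linarith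
  have hZi : Z⁻¹ ≤ 2 := by rw [inv_le_comm₀ hZ0 two_pos]; linarith
  have hZi0 : 0 ≤ Z⁻¹ := by positivity
  have hC₃ : 0 ≤ C₃ / M := (abs_nonneg _).trans he
  have e1 : |(B - v) - v * (Z - 1)| ≤ C₂ / M + |v| * (C₁ / M) := by
    refine (abs_sub _ _).trans (add_le_add hB ?_)
    rw [abs_mul]
    gcongr
  have e2 : |M * Q| ≤ C₄ / M := by
    rw [abs_mul, abs_of_pos hM0]
    calc M * |Q| ≤ M * (C₄ / M ^ 2) := by gcongr
      _ = _ := by field_simp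
  have e3 : |(M + 1) * e ^ 2 * Z⁻¹| ≤ 4 * (C₃ ^ 2 / M) := by
    have hM2 : |M + 1| ≤ 2 * M := by rw [abs_of_pos (by linarith)]; linarith
    rw [abs_mul, abs_mul, abs_pow, abs_of_nonneg hZi0]
    calc |M + 1| * |e| ^ 2 * Z⁻¹ ≤ 2 * M * (C₃ / M) ^ 2 * 2 := by gcongr
      _ = _ := by field_simp; ring
  have key : B / Z + M * (Q / Z) - (M + 1) * (e / Z) ^ 2 - v =
      (((B - v) - v * (Z - 1)) + M * Q - (M + 1) * e ^ 2 * Z⁻¹) * Z⁻¹ := by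
    field_simp
    ring
  rw [key, abs_mul, abs_of_nonneg hZi0]
  have e4 : |((B - v) - v * (Z - 1)) + M * Q - (M + 1) * e ^ 2 * Z⁻¹| ≤
      C₂ / M + |v| * (C₁ / M) + C₄ / M + 4 * (C₃ ^ 2 / M) :=
    (abs_sub _ _).trans (add_le_add ((abs_add_le _ _).trans (add_le_add e1 e2)) e3)
  calc _ ≤ (C₂ / M + |v| * (C₁ / M) + C₄ / M + 4 * (C₃ ^ 2 / M)) * 2 :=
        mul_le_mul e4 hZi hZi0 ((abs_nonneg _).trans e4)
    _ = _ := by ring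

/-- The variance of the average of `g` over the standardized samples is `N⁻¹ ∫ g² + O(N⁻²)` if `g`
is orthogonal to the quadratic polynomials. -/
theorem exists_variance_average_stdSample {S : Matrix (Fin n) (Fin n) ℝ} (hS : S.PosDef)
    {g : EuclideanSpace ℝ (Fin n) → ℝ} (hg : Measurable g)
    (hint : Integrable (fun x => (1 + ‖x‖) ^ 8 * g x ^ 2) (stdGaussian (EuclideanSpace ℝ (Fin n))))
    (hg0 : ∫ x, g x ∂(stdGaussian (EuclideanSpace ℝ (Fin n))) = 0)
    (hg2 : ∀ y, ∫ x, g x * (1 + ⟪y, x⟫) ^ 2 ∂(stdGaussian (EuclideanSpace ℝ (Fin n))) = 0) :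
    ∃ C, ∀ᶠ N : ℕ in atTop,
      MemLp (fun x : Fin N → EuclideanSpace ℝ (Fin n) => (N : ℝ)⁻¹ * ∑ k, g (stdSample x k)) 2
        (Measure.pi fun _ => multivariateGaussian 0 S) ∧
      |N * variance (fun x : Fin N → EuclideanSpace ℝ (Fin n) =>
          (N : ℝ)⁻¹ * ∑ k, g (stdSample x k)) (Measure.pi fun _ => multivariateGaussian 0 S) -
        ∫ x, g x ^ 2 ∂(stdGaussian (EuclideanSpace ℝ (Fin n)))| ≤ C / N ∧
      (∫ x, g x ^ 2 ∂(stdGaussian (EuclideanSpace ℝ (Fin n))) = 0 →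
        variance (fun x : Fin N → EuclideanSpace ℝ (Fin n) =>
          (N : ℝ)⁻¹ * ∑ k, g (stdSample x k)) (Measure.pi fun _ => multivariateGaussian 0 S) = 0) := by
  obtain ⟨hs6, hg6⟩ := integrable_mul_pow_of_sq hg hint
  have h16 : Integrable (fun x : EuclideanSpace ℝ (Fin n) => (1 + ‖x‖) ^ 6)
      (stdGaussian (EuclideanSpace ℝ (Fin n))) :=
    integrable_one_add_norm_pow 6
  have hm : (0 : ℝ) ≤ n + 3 := by positivity
  obtain ⟨C₁, h₁⟩ := exists_integral_pairKernel_sub_le (F := EuclideanSpace ℝ (Fin n)) hm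
    (h := fun _ => 1) measurable_const ((h16.mul_prod h16).congr (ae_of_all _ fun z => by simp))
  obtain ⟨C₂, h₂⟩ := exists_integral_pairKernel_sub_le (F := EuclideanSpace ℝ (Fin n)) hm
    (h := fun z => g z.1 ^ 2) (by fun_prop)
    ((hs6.mul_prod h16).congr (ae_of_all _ fun z => by simp only; ring))
  obtain ⟨C₃, h₃⟩ := exists_integral_pairKernel_sub_le (F := EuclideanSpace ℝ (Fin n)) hm
    (h := fun z => g z.1) (by fun_prop)
    ((hg6.mul_prod h16).congr (ae_of_all _ fun z => by simp only; ring))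
  obtain ⟨C₅, h₅⟩ := exists_integral_pairKernel_sub_le (F := EuclideanSpace ℝ (Fin n)) hm
    (h := fun z => g z.1 * g z.2) (by fun_prop)
    ((hg6.mul_prod hg6).congr (ae_of_all _ fun z => by simp only; ring))
  obtain ⟨C₄, h₄⟩ := exists_integral_mul_pairKernel_le hm hg hint hg0 hg2
  set γ := stdGaussian (EuclideanSpace ℝ (Fin n))
  set v := ∫ x, g x ^ 2 ∂γ with hv
  have hv1 : ∫ z, g z.1 ^ 2 ∂(γ.prod γ) = v := by
    rw [integral_fun_fst (fun x => g x ^ 2)]; simp [hv]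
  have hg1 : ∫ z, g z.1 ∂(γ.prod γ) = 0 := by
    rw [integral_fun_fst g, hg0, smul_zero]
  simp only [hv1] at h₂
  simp only [hg1, sub_zero] at h₃
  simp only [one_mul, integral_const, probReal_univ, smul_eq_mul, mul_one] at h₁
  set K := 2 * (C₂ + |v| * C₁) + 2 * C₄ + 8 * C₃ ^ 2 with hK
  refine ⟨2 * K, ?_⟩
  filter_upwards [eventually_ge_atTop (n + 10 + ⌈2 * C₁⌉₊)] with N hN
  obtain ⟨d, hd⟩ : ∃ d, n + 2 + d = N := ⟨N - (n + 2), by omega⟩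
  have hdR : (n : ℝ) + 2 + d = N := by exact_mod_cast hd
  have hNR : (n : ℝ) + 10 + 2 * C₁ ≤ N := by
    calc (n : ℝ) + 10 + 2 * C₁ ≤ n + 10 + ⌈2 * C₁⌉₊ := by gcongr; exact Nat.le_ceil _
      _ ≤ N := by exact_mod_cast hN
  have hN10 : (n : ℝ) + 10 ≤ N := by
    have : n + 10 ≤ N := by omega
    exact_mod_cast this
  have hn0 : (0 : ℝ) ≤ n := by positivity
  obtain ⟨M, hM⟩ : ∃ M : ℝ, M = (N : ℝ) - 1 := ⟨_, rfl⟩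
  have hp : (d : ℝ) / 2 - 1 = (M - (n + 3)) / 2 := by rw [hM]; linarith
  have hMm : (n : ℝ) + 3 + 6 ≤ M := by linarith
  obtain ⟨i₁, b₁⟩ := h₁ M hMm
  obtain ⟨i₂, b₂⟩ := h₂ M hMm
  obtain ⟨i₃, b₃⟩ := h₃ M hMm
  obtain ⟨i₅, -⟩ := h₅ M hMm
  have b₄ := h₄ M hMm
  have hpair := fun {k l : Fin N} (hkl : k ≠ l)
      {h : EuclideanSpace ℝ (Fin n) × EuclideanSpace ℝ (Fin n) → ℝ} (hh : Measurable h) =>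
    integral_stdSample_pair hS d (by omega) hd (by rw [hp, ← hM]; exact i₁) hkl hh
  rw [hp, ← hM] at hpair
  set κ := fun z : EuclideanSpace ℝ (Fin n) × EuclideanSpace ℝ (Fin n) =>
    pairKernel M ((M - (n + 3)) / 2) z.1 z.2
  set Z := ∫ z, κ z ∂(γ.prod γ)
  set B := ∫ z, g z.1 ^ 2 * κ z ∂(γ.prod γ)
  set e := ∫ z, g z.1 * κ z ∂(γ.prod γ)
  set Q := ∫ z, g z.1 * g z.2 * κ z ∂(γ.prod γ)
  have hN0 : 0 < N := by omega
  have hex : ∀ k : Fin N, ∃ l, k ≠ l := fun k => by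
    have : Nontrivial (Fin N) := Fin.nontrivial_iff_two_le.2 (by omega)
    obtain ⟨l, hl⟩ := exists_ne k
    exact ⟨l, hl.symm⟩
  have hW2 : ∀ k : Fin N, Integrable (fun x => g (stdSample x k) ^ 2)
      (Measure.pi fun _ : Fin N => multivariateGaussian 0 S) ∧
      ∫ x, g (stdSample x k) ^ 2 ∂(Measure.pi fun _ : Fin N => multivariateGaussian 0 S) = B / Z := by
    intro k
    obtain ⟨l, hl⟩ := hex k
    exact hpair hl (h := fun z => g z.1 ^ 2) (by fun_prop) i₂
  have hW1 : ∀ k : Fin N,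
      ∫ x, g (stdSample x k) ∂(Measure.pi fun _ : Fin N => multivariateGaussian 0 S) = e / Z := by
    intro k
    obtain ⟨l, hl⟩ := hex k
    exact (hpair hl (h := fun z => g z.1) (by fun_prop) i₃).2
  have hWQ : ∀ k l : Fin N, k ≠ l → ∫ x, g (stdSample x k) * g (stdSample x l)
      ∂(Measure.pi fun _ : Fin N => multivariateGaussian 0 S) = Q / Z := fun k l hl =>
    (hpair hl (h := fun z => g z.1 * g z.2) (by fun_prop) i₅).2
  obtain ⟨r₁, r₂⟩ := variance_average hN0 (W := fun k x => g (stdSample x k))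
    (fun k => (memLp_two_iff_integrable_sq
      (hg.comp (measurable_stdSample k)).aestronglyMeasurable).2 (hW2 k).1)
    (fun k => (hW2 k).2) hW1 hWQ
  have hNpos : (0 : ℝ) < N := by exact_mod_cast hN0
  have hM1 : 1 ≤ M := by linarith
  refine ⟨r₁, ?_, fun h0 => ?_⟩
  · rw [r₂, mul_div_cancel₀ _ hNpos.ne', ← hM, show (N : ℝ) = M + 1 by rw [hM]; ring]
    have hb := abs_variance_ratio_sub_le hM1 (by linarith) b₁ b₂ b₃ b₄
    have hK0 : 0 ≤ K := by
      by_contra hK0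
      exact absurd ((abs_nonneg _).trans hb) (not_le.2 (div_neg_of_neg_of_pos (not_le.1 hK0)
        (by linarith)))
    refine hb.trans ?_
    rw [div_le_div_iff₀ (by linarith) (by linarith)]
    nlinarith
  · -- a vanishing second moment makes `g` vanish almost everywhere
    have hgi : Integrable (fun x => g x ^ 2) γ := by
      simpa using integrable_mul_of_le_one_add_norm_pow (g := fun x => g x ^ 2) (by fun_prop) hs6
        (q := fun _ => 1) (by fun_prop) (D := 1)
        (fun x => by rw [abs_one, one_mul]; exact one_le_pow₀ (by linarith [norm_nonneg x]))
    have hgz : ∀ᵐ x ∂γ, g x = 0 :=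
      ((integral_eq_zero_iff_of_nonneg (fun x => sq_nonneg _) hgi).1 h0).mono fun x hx => by
        simpa using hx
    have hgz' : ∀ᵐ z ∂(γ.prod γ), g z.1 = 0 := Measure.quasiMeasurePreserving_fst.ae hgz
    have hB0 : B = 0 := integral_eq_zero_of_ae (hgz'.mono fun z hz => by simp [hz])
    have he0 : e = 0 := integral_eq_zero_of_ae (hgz'.mono fun z hz => by simp [hz])
    have hQ0 : Q = 0 := integral_eq_zero_of_ae (hgz'.mono fun z hz => by simp [hz])
    rw [r₂, hB0, he0, hQ0]
    simp

end VarianceAsymptotics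

/-! ### Gaussian moments up to order four -/

section GaussianMoments

/-- One step in differentiating the moment generating function of a Gaussian. -/
lemma deriv_mul_exp_sq {v : ℝ} {P P' : ℝ → ℝ} (hP : ∀ t, HasDerivAt P (P' t) t) :
    deriv (fun t => P t * Real.exp (v * t ^ 2 / 2)) =
      fun t => (P' t + v * t * P t) * Real.exp (v * t ^ 2 / 2) := by
  ext t
  have h1 : HasDerivAt (fun t : ℝ => v * t ^ 2 / 2) (v * t) t := by
    have := ((hasDerivAt_pow 2 t).const_mul v).div_const 2
    refine this.congr_deriv ?_
    simp only [Nat.cast_ofNat]; ring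
  refine ((hP t).fun_mul h1.exp).deriv.trans ?_
  ring

/-- Second and fourth moments, as derivatives at `0` of the moment generating function. -/
lemma integral_pow_gaussianReal (v : NNReal) :
    ∫ x, x ^ 2 ∂(gaussianReal 0 v) = v ∧ ∫ x, x ^ 4 ∂(gaussianReal 0 v) = 3 * (v : ℝ) ^ 2 := by
  have hmgf : mgf id (gaussianReal 0 v) = fun t => 1 * Real.exp (v * t ^ 2 / 2) := by
    rw [mgf_id_gaussianReal]; ext t; simp
  have hset : (0 : ℝ) ∈ interior (integrableExpSet id (gaussianReal 0 v)) := by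
    simp
  have d1 : deriv (mgf id (gaussianReal 0 v)) = fun t => (v * t) * Real.exp (v * t ^ 2 / 2) := by
    rw [hmgf, deriv_mul_exp_sq (P := fun _ => 1) (P' := fun _ => 0) (fun t => hasDerivAt_const t 1)]
    simp
  have d2 : deriv (deriv (mgf id (gaussianReal 0 v))) =
      fun t => (v + v ^ 2 * t ^ 2) * Real.exp (v * t ^ 2 / 2) := by
    rw [d1, deriv_mul_exp_sq (P' := fun _ => v) (fun t => by
      simpa using (hasDerivAt_id t).const_mul (v : ℝ))]
    ext t; ring
  have d3 : deriv (deriv (deriv (mgf id (gaussianReal 0 v)))) =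
      fun t => (3 * v ^ 2 * t + v ^ 3 * t ^ 3) * Real.exp (v * t ^ 2 / 2) := by
    rw [d2, deriv_mul_exp_sq (P' := fun t => v ^ 2 * (2 * t)) (fun t => by
      simpa using ((hasDerivAt_pow 2 t).const_mul ((v : ℝ) ^ 2)).const_add (v : ℝ))]
    ext t; ring
  have d4 : deriv (deriv (deriv (deriv (mgf id (gaussianReal 0 v))))) =
      fun t => (3 * v ^ 2 + 6 * v ^ 3 * t ^ 2 + v ^ 4 * t ^ 4) * Real.exp (v * t ^ 2 / 2) := by
    rw [d3, deriv_mul_exp_sq (P' := fun t => 3 * v ^ 2 + v ^ 3 * (3 * t ^ 2)) (fun t => by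
      simpa using ((hasDerivAt_id' t).const_mul (3 * (v : ℝ) ^ 2)).fun_add
        ((hasDerivAt_pow 3 t).const_mul ((v : ℝ) ^ 3)))]
    ext t; ring
  have m2 := iteratedDeriv_mgf_zero hset 2
  have m4 := iteratedDeriv_mgf_zero hset 4
  simp only [iteratedDeriv_succ, iteratedDeriv_zero] at m2 m4
  rw [d2] at m2
  rw [d4] at m4
  constructor
  · simpa using m2.symm
  · simpa using m4.symm

variable {E : Type*} [NormedAddCommGroup E] [InnerProductSpace ℝ E] [FiniteDimensional ℝ E]
  [MeasurableSpace E] [BorelSpace E]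

lemma map_inner_stdGaussian (u : E) :
    (stdGaussian E).map (fun x => ⟪u, x⟫) = gaussianReal 0 (‖u‖₊ ^ 2) := by
  have h1 := IsGaussian.map_eq_gaussianReal (μ := stdGaussian E) (innerSL ℝ u)
  rw [integral_strongDual_stdGaussian, variance_dual_stdGaussian] at h1
  have h2 : (⇑(innerSL ℝ u) : E → ℝ) = fun x => ⟪u, x⟫ := by ext; simp
  rw [h2] at h1
  rw [h1, innerSL_apply_norm]
  congr 1
  ext
  simp

lemma integral_inner_pow_stdGaussian (u : E) :
    ∫ x, ⟪u, x⟫ ^ 2 ∂(stdGaussian E) = ‖u‖ ^ 2 ∧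
      ∫ x, ⟪u, x⟫ ^ 4 ∂(stdGaussian E) = 3 * (‖u‖ ^ 2) ^ 2 := by
  obtain ⟨h2, h4⟩ := integral_pow_gaussianReal (‖u‖₊ ^ 2)
  rw [← map_inner_stdGaussian, integral_map (by fun_prop) (by fun_prop)] at h2 h4
  simpa using And.intro h2 h4

lemma integral_eq_zero_of_odd {F : E → ℝ} (hF : ∀ x, F (-x) = -F x) :
    ∫ x, F x ∂(stdGaussian E) = 0 := by
  have h1 : (stdGaussian E).map (LinearIsometryEquiv.neg ℝ (E := E)) = stdGaussian E :=
    stdGaussian_map _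
  have h2 : ∫ x, F x ∂(stdGaussian E) = ∫ x, F (-x) ∂(stdGaussian E) := by
    conv_lhs => rw [← h1]
    exact (LinearIsometryEquiv.neg ℝ (E := E)).toHomeomorph.measurableEmbedding.integral_map _
  simp only [hF, integral_neg] at h2
  linarith

lemma integrable_of_abs_le_one_add_norm_pow {q : E → ℝ} (hq : Measurable q) {D : ℝ} {k : ℕ}
    (h : ∀ x, |q x| ≤ D * (1 + ‖x‖) ^ k) : Integrable q (stdGaussian E) :=
  ((integrable_one_add_norm_pow k).const_mul D).mono' hq.aestronglyMeasurable (ae_of_all _ h)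

omit [FiniteDimensional ℝ E] [MeasurableSpace E] [BorelSpace E] in
lemma abs_inner_le_one_add_norm (u x : E) : |⟪u, x⟫| ≤ ‖u‖ * (1 + ‖x‖) :=
  (abs_real_inner_le_norm u x).trans (by gcongr; linarith)

lemma integrable_inner_pow (u : E) (k : ℕ) :
    Integrable (fun x => ⟪u, x⟫ ^ k) (stdGaussian E) := by
  refine integrable_of_abs_le_one_add_norm_pow (by fun_prop) (D := ‖u‖ ^ k) (k := k) fun x => ?_
  rw [abs_pow, ← mul_pow]
  gcongr
  exact abs_inner_le_one_add_norm u x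

/-- Polarization of the second moment of a linear functional. -/
lemma integral_inner_mul_inner (u v : E) :
    ∫ x, ⟪u, x⟫ * ⟪v, x⟫ ∂(stdGaussian E) = ⟪u, v⟫ := by
  have h : ∀ x : E, ⟪u, x⟫ * ⟪v, x⟫ = 4⁻¹ * (⟪u + v, x⟫ ^ 2 - ⟪u - v, x⟫ ^ 2) := fun x => by
    rw [inner_add_left, inner_sub_left]; ring
  simp only [h]
  rw [integral_const_mul, integral_sub (integrable_inner_pow _ _) (integrable_inner_pow _ _),
    (integral_inner_pow_stdGaussian _).1, (integral_inner_pow_stdGaussian _).1, norm_add_sq_real,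
    norm_sub_sq_real]
  ring

/-- The fourth order case of Isserlis' formula, by polarization of the fourth moment of a linear
functional. -/
lemma integral_inner_mul_four (a b c d : E) :
    ∫ x, ⟪a, x⟫ * ⟪b, x⟫ * (⟪c, x⟫ * ⟪d, x⟫) ∂(stdGaussian E) =
      ⟪a, b⟫ * ⟪c, d⟫ + ⟪a, c⟫ * ⟪b, d⟫ + ⟪a, d⟫ * ⟪b, c⟫ := by
  have h : ∀ x : E, ⟪a, x⟫ * ⟪b, x⟫ * (⟪c, x⟫ * ⟪d, x⟫) = 192⁻¹ *
      (((⟪a + b + c + d, x⟫ ^ 4 - ⟪a + b + c - d, x⟫ ^ 4) -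
        (⟪a + b - c + d, x⟫ ^ 4 - ⟪a + b - c - d, x⟫ ^ 4)) -
      ((⟪a - b + c + d, x⟫ ^ 4 - ⟪a - b + c - d, x⟫ ^ 4) -
        (⟪a - b - c + d, x⟫ ^ 4 - ⟪a - b - c - d, x⟫ ^ 4))) := fun x => by
    simp only [inner_add_left, inner_sub_left]; ring
  have i4 : ∀ u : E, Integrable (fun x => ⟪u, x⟫ ^ 4) (stdGaussian E) :=
    fun u => integrable_inner_pow u 4
  have i2 : ∀ u v : E, Integrable (fun x => ⟪u, x⟫ ^ 4 - ⟪v, x⟫ ^ 4) (stdGaussian E) :=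
    fun u v => (i4 u).sub (i4 v)
  have i3 : ∀ u v w z : E, Integrable (fun x => (⟪u, x⟫ ^ 4 - ⟪v, x⟫ ^ 4) -
      (⟪w, x⟫ ^ 4 - ⟪z, x⟫ ^ 4)) (stdGaussian E) := fun u v w z => (i2 u v).sub (i2 w z)
  simp only [h]
  rw [integral_const_mul, integral_sub (i3 _ _ _ _) (i3 _ _ _ _), integral_sub (i2 _ _) (i2 _ _),
    integral_sub (i2 _ _) (i2 _ _), integral_sub (i4 _) (i4 _), integral_sub (i4 _) (i4 _),
    integral_sub (i4 _) (i4 _), integral_sub (i4 _) (i4 _)]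
  have h4 : ∀ u : E, ∫ x, ⟪u, x⟫ ^ 4 ∂(stdGaussian E) = 3 * (‖u‖ ^ 2) ^ 2 := fun u =>
    (integral_inner_pow_stdGaussian u).2
  simp only [h4]
  simp only [norm_add_sq_real, norm_sub_sq_real, inner_add_left, inner_sub_left]
  ring

end GaussianMoments

section EuclideanMoments

variable {n : ℕ}

lemma coord_eq_inner (x : EuclideanSpace ℝ (Fin n)) (i : Fin n) :
    x i = ⟪EuclideanSpace.single i (1 : ℝ), x⟫ := by
  simp [EuclideanSpace.inner_single_left]

lemma inner_single_single (i j : Fin n) :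
    ⟪EuclideanSpace.single i (1 : ℝ), EuclideanSpace.single j (1 : ℝ)⟫ = if i = j then 1 else 0 := by
  rw [EuclideanSpace.inner_single_left]
  simp

lemma integral_coord (i : Fin n) : ∫ x, x i ∂(stdGaussian (EuclideanSpace ℝ (Fin n))) = 0 :=
  integral_eq_zero_of_odd fun x => by simp

lemma integral_coord_mul_coord (i j : Fin n) :
    ∫ x, x i * x j ∂(stdGaussian (EuclideanSpace ℝ (Fin n))) = if i = j then 1 else 0 := by
  simp only [coord_eq_inner, integral_inner_mul_inner, inner_single_single]

lemma integral_coord_mul_three (i j k : Fin n) :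
    ∫ x, x i * x j * x k ∂(stdGaussian (EuclideanSpace ℝ (Fin n))) = 0 :=
  integral_eq_zero_of_odd fun x => by simp

lemma integral_coord_mul_four (i j k l : Fin n) :
    ∫ x, x i * x j * (x k * x l) ∂(stdGaussian (EuclideanSpace ℝ (Fin n))) =
      (if i = j then 1 else 0) * (if k = l then 1 else 0) +
      (if i = k then 1 else 0) * (if j = l then 1 else 0) +
      (if i = l then 1 else 0) * (if j = k then 1 else 0) := by
  simp only [coord_eq_inner, integral_inner_mul_four, inner_single_single]

end EuclideanMoments

/-! ### Orthogonal projection onto the quadratic polynomials -/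

section QuadraticProjection

variable {n : ℕ}

/-- The quadratic polynomial `c₀ + c ⬝ x + (xᵀ m x - tr m) / 2`. -/
noncomputable def quadraticPoly (c₀ : ℝ) (c : Fin n → ℝ) (m : Matrix (Fin n) (Fin n) ℝ)
    (x : EuclideanSpace ℝ (Fin n)) : ℝ :=
  c₀ + ∑ i, c i * x i + 1 / 2 * ∑ i, ∑ j, m i j * (x i * x j - if i = j then 1 else 0)

@[fun_prop]
lemma measurable_quadraticPoly (c₀ : ℝ) (c : Fin n → ℝ) (m : Matrix (Fin n) (Fin n) ℝ) :
    Measurable (quadraticPoly c₀ c m) := by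
  unfold quadraticPoly; fun_prop

lemma abs_coord_le (x : EuclideanSpace ℝ (Fin n)) (i : Fin n) : |x i| ≤ 1 + ‖x‖ := by
  have := PiLp.norm_apply_le x i
  rw [Real.norm_eq_abs] at this
  linarith

lemma abs_coord_mul_coord_le (x : EuclideanSpace ℝ (Fin n)) (i j : Fin n) :
    |x i * x j| ≤ (1 + ‖x‖) ^ 2 := by
  rw [abs_mul, sq]
  gcongr <;> exact abs_coord_le _ _

lemma exists_abs_quadraticPoly_le (c₀ : ℝ) (c : Fin n → ℝ) (m : Matrix (Fin n) (Fin n) ℝ) :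
    ∃ D, 0 ≤ D ∧ ∀ x, |quadraticPoly c₀ c m x| ≤ D * (1 + ‖x‖) ^ 2 := by
  refine ⟨|c₀| + ∑ i, |c i| + 1 / 2 * ∑ i, ∑ j, |m i j| * 2, by positivity, fun x => ?_⟩
  have hw1 : 1 ≤ 1 + ‖x‖ := by linarith [norm_nonneg x]
  have hw2 : 1 ≤ (1 + ‖x‖) ^ 2 := one_le_pow₀ hw1
  have hw12 : 1 + ‖x‖ ≤ (1 + ‖x‖) ^ 2 := le_self_pow₀ hw1 two_ne_zero
  rw [add_mul, add_mul, Finset.sum_mul, mul_assoc, Finset.sum_mul]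
  simp only [Finset.sum_mul]
  refine (abs_add_le _ _).trans (add_le_add ((abs_add_le _ _).trans (add_le_add ?_ ?_)) ?_)
  · exact le_mul_of_one_le_right (abs_nonneg _) hw2
  · refine (Finset.abs_sum_le_sum_abs _ _).trans (Finset.sum_le_sum fun i _ => ?_)
    rw [abs_mul]
    gcongr
    exact (abs_coord_le x i).trans hw12
  · rw [abs_mul, abs_of_pos (by norm_num : (0 : ℝ) < 1 / 2)]
    gcongr
    refine (Finset.abs_sum_le_sum_abs _ _).trans (Finset.sum_le_sum fun i _ => ?_)
    refine (Finset.abs_sum_le_sum_abs _ _).trans (Finset.sum_le_sum fun j _ => ?_)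
    rw [abs_mul, mul_assoc]
    gcongr
    refine (abs_sub _ _).trans ?_
    have h1 := abs_coord_mul_coord_le x i j
    have h2 : |(if i = j then (1 : ℝ) else 0)| ≤ 1 := by split_ifs <;> simp
    linarith

/-- Integrals of `ψ` against a quadratic polynomial in terms of the moments of `ψ`. -/
lemma integral_mul_quadraticPoly {ψ : EuclideanSpace ℝ (Fin n) → ℝ} (hψ : Measurable ψ)
    (hint : Integrable (fun x => ψ x * (1 + ‖x‖) ^ 2) (stdGaussian (EuclideanSpace ℝ (Fin n))))
    (c₀ : ℝ) (c : Fin n → ℝ) (m : Matrix (Fin n) (Fin n) ℝ) :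
    ∫ x, ψ x * quadraticPoly c₀ c m x ∂(stdGaussian (EuclideanSpace ℝ (Fin n))) =
      c₀ * ∫ x, ψ x ∂(stdGaussian (EuclideanSpace ℝ (Fin n))) +
      ∑ i, c i * ∫ x, ψ x * x i ∂(stdGaussian (EuclideanSpace ℝ (Fin n))) +
      1 / 2 * ∑ i, ∑ j, m i j * (∫ x, ψ x * (x i * x j) ∂(stdGaussian (EuclideanSpace ℝ (Fin n))) -
        (if i = j then 1 else 0) * ∫ x, ψ x ∂(stdGaussian (EuclideanSpace ℝ (Fin n)))) := by
  set γ := stdGaussian (EuclideanSpace ℝ (Fin n))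
  have h1 : ∀ x : EuclideanSpace ℝ (Fin n), 1 ≤ 1 + ‖x‖ := fun x => by linarith [norm_nonneg x]
  have i0 : Integrable ψ γ := by
    simpa using integrable_mul_of_le_one_add_norm_pow hψ hint (q := fun _ => 1) (by fun_prop)
      (D := 1) (fun x => by rw [abs_one, one_mul]; exact one_le_pow₀ (h1 x))
  have i1 : ∀ i, Integrable (fun x => ψ x * x i) γ := fun i =>
    integrable_mul_of_le_one_add_norm_pow hψ hint (q := fun x => x i) (by fun_prop) (D := 1)
      (fun x => by
        rw [one_mul]; exact (abs_coord_le x i).trans (le_self_pow₀ (h1 x) two_ne_zero))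
  have i2 : ∀ i j, Integrable (fun x => ψ x * (x i * x j)) γ := fun i j =>
    integrable_mul_of_le_one_add_norm_pow hψ hint (q := fun x => x i * x j) (by fun_prop) (D := 1)
      (fun x => by rw [one_mul]; exact abs_coord_mul_coord_le x i j)
  have i3 : ∀ i j, Integrable (fun x => ψ x * (x i * x j) - (if i = j then 1 else 0) * ψ x) γ :=
    fun i j => (i2 i j).sub (i0.const_mul _)
  have e : ∀ x, ψ x * quadraticPoly c₀ c m x = (c₀ * ψ x + ∑ i, c i * (ψ x * x i)) +
      1 / 2 * ∑ i, ∑ j, m i j * (ψ x * (x i * x j) - (if i = j then 1 else 0) * ψ x) := fun x => by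
    rw [quadraticPoly, mul_add, mul_add, Finset.mul_sum, mul_left_comm, Finset.mul_sum]
    simp only [Finset.mul_sum]
    congr 1
    · congr 1
      · ring
      · exact Finset.sum_congr rfl fun i _ => by ring
    · exact Finset.sum_congr rfl fun i _ => Finset.sum_congr rfl fun j _ => by ring
  have s1 : Integrable (fun x => ∑ i, c i * (ψ x * x i)) γ :=
    integrable_finsetSum _ fun i _ => (i1 i).const_mul _
  have s2 : ∀ i, Integrable (fun x => ∑ j, m i j *
      (ψ x * (x i * x j) - (if i = j then 1 else 0) * ψ x)) γ := fun i =>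
    integrable_finsetSum _ fun j _ => (i3 i j).const_mul _
  have s3 : Integrable (fun x => 1 / 2 * ∑ i, ∑ j, m i j *
      (ψ x * (x i * x j) - (if i = j then 1 else 0) * ψ x)) γ :=
    (integrable_finsetSum _ fun i _ => s2 i).const_mul _
  have s4 : Integrable (fun x => c₀ * ψ x + ∑ i, c i * (ψ x * x i)) γ :=
    (i0.const_mul _).add s1
  simp only [e]
  rw [integral_add s4 s3, integral_add (i0.const_mul _) s1, integral_const_mul, integral_const_mul,
    integral_finsetSum _ fun i _ => (i1 i).const_mul _, integral_finsetSum _ fun i _ => s2 i]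
  congr 1
  · congr 1
    exact Finset.sum_congr rfl fun i _ => integral_const_mul _ _
  · congr 1
    refine Finset.sum_congr rfl fun i _ => ?_
    rw [integral_finsetSum _ fun j _ => (i3 i j).const_mul _]
    refine Finset.sum_congr rfl fun j _ => ?_
    rw [integral_const_mul, integral_sub (i2 i j) (i0.const_mul _), integral_const_mul]

lemma integral_quadraticPoly (c₀ : ℝ) (c : Fin n → ℝ) (m : Matrix (Fin n) (Fin n) ℝ) :
    ∫ x, quadraticPoly c₀ c m x ∂(stdGaussian (EuclideanSpace ℝ (Fin n))) = c₀ := by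
  have h := integral_mul_quadraticPoly (ψ := fun _ : EuclideanSpace ℝ (Fin n) => (1 : ℝ))
    measurable_const (by simpa using integrable_one_add_norm_pow 2) c₀ c m
  simpa [integral_coord, integral_coord_mul_coord] using h

lemma integral_coord_mul_quadraticPoly (c₀ : ℝ) (c : Fin n → ℝ) (m : Matrix (Fin n) (Fin n) ℝ)
    (k : Fin n) :
    ∫ x, x k * quadraticPoly c₀ c m x ∂(stdGaussian (EuclideanSpace ℝ (Fin n))) = c k := by
  have h := integral_mul_quadraticPoly (ψ := fun x : EuclideanSpace ℝ (Fin n) => x k)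
    (by fun_prop) (integrable_of_abs_le_one_add_norm_pow (by fun_prop) (D := 1) (k := 3) fun x => by
      rw [abs_mul, abs_pow, abs_of_nonneg (by positivity : 0 ≤ 1 + ‖x‖), one_mul, pow_succ' _ 2]
      gcongr
      exact abs_coord_le x k) c₀ c m
  simp only [← mul_assoc, integral_coord, integral_coord_mul_coord, integral_coord_mul_three] at h
  simpa using h

lemma integral_coord_mul_coord_mul_quadraticPoly (c₀ : ℝ) (c : Fin n → ℝ)
    {m : Matrix (Fin n) (Fin n) ℝ} (hm : ∀ i j, m i j = m j i) (k l : Fin n) :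
    ∫ x, x k * x l * quadraticPoly c₀ c m x ∂(stdGaussian (EuclideanSpace ℝ (Fin n))) =
      m k l + (if k = l then 1 else 0) * c₀ := by
  have h := integral_mul_quadraticPoly (ψ := fun x : EuclideanSpace ℝ (Fin n) => x k * x l)
    (by fun_prop) (integrable_of_abs_le_one_add_norm_pow (by fun_prop) (D := 1) (k := 4) fun x => by
      rw [abs_mul, abs_pow, abs_of_nonneg (by positivity : 0 ≤ 1 + ‖x‖), one_mul,
        show (1 + ‖x‖) ^ 4 = (1 + ‖x‖) ^ 2 * (1 + ‖x‖) ^ 2 by ring]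
      gcongr
      exact abs_coord_mul_coord_le x k l) c₀ c m
  rw [h]
  simp only [integral_coord_mul_coord, integral_coord_mul_three, integral_coord_mul_four]
  have h1 : ∀ i j, m i j * ((if k = l then 1 else 0) * (if i = j then 1 else 0) +
      (if k = i then 1 else 0) * (if l = j then 1 else 0) +
      (if k = j then 1 else 0) * (if l = i then 1 else 0) -
      (if i = j then 1 else 0) * (if k = l then 1 else 0)) =
      (if k = i then (if l = j then m i j else 0) else 0) +
      (if l = i then (if k = j then m i j else 0) else 0) := by
    intro i j
    split_ifs <;> ring
  simp only [h1, Finset.sum_add_distrib]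
  simp [hm l k]
  ring

end QuadraticProjection

section Residual

variable {n : ℕ}

/-- The leading correction in the pair density is a quadratic polynomial in each variable. -/
lemma sq_one_add_inner_eq_quadraticPoly (y x : EuclideanSpace ℝ (Fin n)) :
    (1 + ⟪y, x⟫) ^ 2 = quadraticPoly (1 + ∑ i, y i ^ 2) (fun i => 2 * y i)
      (Matrix.of fun i j => 2 * (y i * y j)) x := by
  have h1 : ⟪y, x⟫ = ∑ i, y i * x i := by
    rw [PiLp.inner_apply]
    exact Finset.sum_congr rfl fun i _ => by simp [mul_comm]
  have h2 : ∀ i j, (Matrix.of fun i j => 2 * (y i * y j) : Matrix (Fin n) (Fin n) ℝ) i j *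
      (x i * x j - if i = j then 1 else 0) =
      2 * ((y i * x i) * (y j * x j)) - 2 * (if i = j then y i * y j else 0) := by
    intro i j
    rw [Matrix.of_apply]
    split_ifs <;> ring
  have h4 : ∑ i, 2 * y i * x i = 2 * ∑ i, y i * x i := by
    rw [Finset.mul_sum]
    exact Finset.sum_congr rfl fun i _ => mul_assoc _ _ _
  rw [quadraticPoly, h1, h4]
  simp only [h2, Finset.sum_sub_distrib, ← Finset.mul_sum, ← Finset.sum_mul,
    Finset.sum_ite_eq, Finset.mem_univ, if_true, ← sq]
  ring

/-- The polynomial with the moments of `φ` up to order two as coefficients is the orthogonal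
projection of `φ` onto the quadratic polynomials in `L²` of the standard Gaussian measure. -/
lemma exists_residual {φ : EuclideanSpace ℝ (Fin n) → ℝ} (hφ : Measurable φ)
    (hint : Integrable (fun x => (1 + ‖x‖) ^ 8 * φ x ^ 2) (stdGaussian (EuclideanSpace ℝ (Fin n))))
    {c₀ : ℝ} {c : Fin n → ℝ} {m : Matrix (Fin n) (Fin n) ℝ}
    (hc₀ : c₀ = ∫ x, φ x ∂(stdGaussian (EuclideanSpace ℝ (Fin n))))
    (hc : ∀ i, c i = ∫ x, φ x * x i ∂(stdGaussian (EuclideanSpace ℝ (Fin n))))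
    (hm : ∀ i j, m i j = ∫ x, φ x * (x i * x j) ∂(stdGaussian (EuclideanSpace ℝ (Fin n))) -
      (if i = j then 1 else 0) * c₀) :
    Integrable (fun x => (1 + ‖x‖) ^ 8 * (φ x - quadraticPoly c₀ c m x) ^ 2)
        (stdGaussian (EuclideanSpace ℝ (Fin n))) ∧
      ∫ x, (φ x - quadraticPoly c₀ c m x) ∂(stdGaussian (EuclideanSpace ℝ (Fin n))) = 0 ∧
      (∀ y, ∫ x, (φ x - quadraticPoly c₀ c m x) * (1 + ⟪y, x⟫) ^ 2
        ∂(stdGaussian (EuclideanSpace ℝ (Fin n))) = 0) ∧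
      ∫ x, (φ x - quadraticPoly c₀ c m x) ^ 2 ∂(stdGaussian (EuclideanSpace ℝ (Fin n))) =
        ∫ x, φ x ^ 2 ∂(stdGaussian (EuclideanSpace ℝ (Fin n))) - c₀ ^ 2 - ∑ i, c i ^ 2 -
          1 / 2 * ∑ i, ∑ j, m i j ^ 2 := by
  set γ := stdGaussian (EuclideanSpace ℝ (Fin n))
  set q := quadraticPoly c₀ c m
  have hq : Measurable q := measurable_quadraticPoly _ _ _
  set g := fun x => φ x - q x
  have hg : Measurable g := hφ.sub hq
  obtain ⟨D, hD0, hD⟩ := exists_abs_quadraticPoly_le c₀ c m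
  have hint' : Integrable (fun x => (1 + ‖x‖) ^ 8 * g x ^ 2) γ := by
    refine ((hint.const_mul 2).add ((integrable_one_add_norm_pow 12).const_mul (2 * D ^ 2))).mono'
      (by fun_prop) (ae_of_all _ fun x => ?_)
    rw [Real.norm_eq_abs, abs_of_nonneg (by positivity), Pi.add_apply]
    have h1 : q x ^ 2 ≤ (D * (1 + ‖x‖) ^ 2) ^ 2 := sq_le_sq' (abs_le.1 (hD x)).1 (abs_le.1 (hD x)).2
    have h2 : g x ^ 2 ≤ 2 * φ x ^ 2 + 2 * q x ^ 2 := by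
      have : g x = φ x - q x := rfl
      rw [this]
      nlinarith [sq_nonneg (φ x + q x)]
    calc (1 + ‖x‖) ^ 8 * g x ^ 2
        ≤ (1 + ‖x‖) ^ 8 * (2 * φ x ^ 2 + 2 * (D * (1 + ‖x‖) ^ 2) ^ 2) := by
          gcongr
          linarith
      _ = _ := by ring
  have weight : ∀ {ψ : EuclideanSpace ℝ (Fin n) → ℝ}, Measurable ψ →
      Integrable (fun x => (1 + ‖x‖) ^ 8 * ψ x ^ 2) γ →
      Integrable (fun x => ψ x * (1 + ‖x‖) ^ 2) γ := fun {ψ} hψ hi =>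
    integrable_mul_of_le_one_add_norm_pow hψ (integrable_mul_pow_of_sq hψ hi).2
      (q := fun x => (1 + ‖x‖) ^ 2) (by fun_prop) (D := 1) fun x => by
        rw [abs_of_nonneg (by positivity), one_mul]
        exact pow_le_pow_right₀ (by linarith [norm_nonneg x]) (by norm_num)
  have hφ2 := weight hφ hint
  have hg2 := weight hg hint'
  have hq2 : Integrable (fun x => q x * (1 + ‖x‖) ^ 2) γ :=
    (hφ2.sub hg2).congr (ae_of_all _ fun x => by simp only [g, Pi.sub_apply]; ring)
  have h1 : ∀ x : EuclideanSpace ℝ (Fin n), 1 ≤ 1 + ‖x‖ := fun x => by linarith [norm_nonneg x]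
  -- the moments of `φ` and of its projection agree up to order two
  have sub : ∀ {r : EuclideanSpace ℝ (Fin n) → ℝ}, Measurable r → (∀ x, |r x| ≤ (1 + ‖x‖) ^ 2) →
      ∫ x, g x * r x ∂γ = ∫ x, φ x * r x ∂γ - ∫ x, r x * q x ∂γ := fun {r} hr hr' => by
    have i1 := integrable_mul_of_le_one_add_norm_pow hφ hφ2 hr (D := 1) (by simpa using hr')
    have i2 := integrable_mul_of_le_one_add_norm_pow hq hq2 hr (D := 1) (by simpa using hr')
    simp only [mul_comm (r _)]
    rw [← integral_sub i1 i2]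
    exact integral_congr_ae (ae_of_all _ fun x => by simp only [g]; ring)
  have hsymm : ∀ i j, m i j = m j i := fun i j => by
    rw [hm, hm]
    simp only [mul_comm, eq_comm]
  have m0 : ∫ x, g x ∂γ = 0 := by
    have := sub (r := fun _ => 1) measurable_const (fun x => by
      rw [abs_one]; exact one_le_pow₀ (h1 x))
    simp only [mul_one, one_mul] at this
    rw [this, integral_quadraticPoly, hc₀, sub_self]
  have m1 : ∀ i, ∫ x, g x * x i ∂γ = 0 := fun i => by
    rw [sub (r := fun x => x i) (by fun_prop) fun x =>
      (abs_coord_le x i).trans (le_self_pow₀ (h1 x) two_ne_zero),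
      integral_coord_mul_quadraticPoly, hc, sub_self]
  have m2 : ∀ i j, ∫ x, g x * (x i * x j) ∂γ = 0 := fun i j => by
    rw [sub (r := fun x => x i * x j) (by fun_prop) fun x => abs_coord_mul_coord_le x i j,
      integral_coord_mul_coord_mul_quadraticPoly _ _ hsymm, hm]
    ring
  have horth : ∀ c₀' c' m', ∫ x, g x * quadraticPoly c₀' c' m' x ∂γ = 0 := fun c₀' c' m' => by
    rw [integral_mul_quadraticPoly hg hg2]
    change c₀' * ∫ x, g x ∂γ + ∑ i, c' i * ∫ x, g x * x i ∂γ + 1 / 2 * ∑ i, ∑ j, m' i j *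
      (∫ x, g x * (x i * x j) ∂γ - (if i = j then 1 else 0) * ∫ x, g x ∂γ) = 0
    simp [m0, m1, m2]
  refine ⟨hint', m0, fun y => ?_, ?_⟩
  · simp only [sq_one_add_inner_eq_quadraticPoly]
    exact horth _ _ _
  · have i1 : Integrable (fun x => φ x ^ 2) γ := by
      refine hint.mono' (by fun_prop) (ae_of_all _ fun x => ?_)
      rw [Real.norm_eq_abs, abs_of_nonneg (sq_nonneg _)]
      exact le_mul_of_one_le_left (sq_nonneg _) (one_le_pow₀ (h1 x))
    have i2 : Integrable (fun x => φ x * q x) γ :=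
      integrable_mul_of_le_one_add_norm_pow hφ hφ2 hq hD
    have i3 : Integrable (fun x => g x * q x) γ :=
      integrable_mul_of_le_one_add_norm_pow hg hg2 hq hD
    have e : ∀ x, (φ x - q x) ^ 2 = φ x ^ 2 - φ x * q x - g x * q x := fun x => by
      simp only [g]; ring
    have h3 : ∫ x, g x * q x ∂γ = 0 := horth _ _ _
    have i4 : Integrable (fun x => φ x ^ 2 - φ x * q x) γ := i1.sub i2
    simp only [e]
    rw [integral_sub i4 i3, integral_sub i1 i2, h3, integral_mul_quadraticPoly hφ hφ2]
    change _ - (c₀ * ∫ x, φ x ∂γ + ∑ i, c i * ∫ x, φ x * x i ∂γ + 1 / 2 * ∑ i, ∑ j, m i j *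
      (∫ x, φ x * (x i * x j) ∂γ - (if i = j then 1 else 0) * ∫ x, φ x ∂γ)) - 0 = _
    rw [← hc₀]
    simp only [← hc, ← hm, ← sq]
    ring

end Residual

/-! ### Reduction to standardized samples -/

section Reduction

variable {n N : ℕ}

/-- The law of a single standardized sample is absolutely continuous with respect to the standard
Gaussian measure. -/
lemma ae_stdSample {S : Matrix (Fin n) (Fin n) ℝ} (hS : S.PosDef) (hN : n + 5 ≤ N)
    {p : EuclideanSpace ℝ (Fin n) → Prop}
    (hp : ∀ᵐ y ∂(stdGaussian (EuclideanSpace ℝ (Fin n))), p y) :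
    ∀ᵐ x ∂(Measure.pi fun _ : Fin N => multivariateGaussian 0 S), ∀ k, p (stdSample x k) := by
  obtain ⟨c, hc⟩ := exists_lintegral_stdSample_pair hS (N - (n + 2)) (by omega) (by omega : _ = N)
    (ae_isUnit_sampleCov (multivariateGaussian_absolutelyContinuous hS) (by omega))
  obtain ⟨s, hs, hsm, hs0⟩ := exists_measurable_superset_of_null (ae_iff.1 hp)
  rw [ae_all_iff]
  intro k
  have : Nontrivial (Fin N) := Fin.nontrivial_iff_two_le.2 (by omega)
  obtain ⟨l, hl⟩ := exists_ne k
  have h1 := hc k l hl.symm (fun z => s.indicator 1 z.1)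
    ((measurable_one.indicator hsm).comp measurable_fst)
  have h2 : ∀ᵐ y ∂(stdGaussian (EuclideanSpace ℝ (Fin n))), y ∉ s := measure_eq_zero_iff_ae_notMem.1 hs0
  have h3 : ∀ f : EuclideanSpace ℝ (Fin n) → EuclideanSpace ℝ (Fin n) → ENNReal,
      ∫⁻ y, ∫⁻ z, f y z * s.indicator 1 y ∂(stdGaussian (EuclideanSpace ℝ (Fin n)))
        ∂(stdGaussian (EuclideanSpace ℝ (Fin n))) = 0 := fun f => by
    rw [← lintegral_zero (μ := stdGaussian (EuclideanSpace ℝ (Fin n)))]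
    exact lintegral_congr_ae (h2.mono fun y hy => by simp [hy])
  have h4 : Measurable fun x : Fin N → EuclideanSpace ℝ (Fin n) =>
      s.indicator (1 : EuclideanSpace ℝ (Fin n) → ENNReal) (stdSample x k) :=
    (measurable_one.indicator hsm).comp (measurable_stdSample k)
  rw [h3, mul_zero] at h1
  filter_upwards [(lintegral_eq_zero_iff h4).1 h1] with x hx
  by_contra hpx
  have : stdSample x k ∈ s := hs hpx
  simp [this] at hx

/-- Quadratic polynomials are averaged exactly by the standardized samples. -/
lemma average_quadraticPoly (hN : 0 < N) {x : Fin N → EuclideanSpace ℝ (Fin n)}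
    (hx : IsUnit (sampleCov x)) (c₀ : ℝ) (c : Fin n → ℝ) (m : Matrix (Fin n) (Fin n) ℝ) :
    (N : ℝ)⁻¹ * ∑ k, quadraticPoly c₀ c m (stdSample x k) = c₀ := by
  have hN0 : (N : ℝ) ≠ 0 := by positivity
  have h1 : ∀ i, ∑ k, stdSample x k i = 0 := fun i => by
    have := congrArg (fun z : EuclideanSpace ℝ (Fin n) => z i) (sum_stdSample hN x)
    simpa using this
  have h2 : ∀ i j, ∑ k, stdSample x k i * stdSample x k j = N * if i = j then 1 else 0 := by
    intro i j
    have := sum_inner_stdSample hN hx (EuclideanSpace.single i 1) (EuclideanSpace.single j 1)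
    rw [inner_single_single, inv_mul_eq_iff_eq_mul₀ hN0] at this
    rw [← this]
    simp only [coord_eq_inner, real_inner_comm]
  simp only [quadraticPoly, Finset.sum_add_distrib, ← Finset.mul_sum, Finset.sum_const,
    Finset.card_univ, Fintype.card_fin, nsmul_eq_mul]
  rw [Finset.sum_comm, Finset.sum_comm (f := fun k i => ∑ j, m i j *
    (stdSample x k i * stdSample x k j - if i = j then 1 else 0))]
  have h3 : ∀ i, ∑ k, ∑ j, m i j * (stdSample x k i * stdSample x k j - if i = j then 1 else 0) =
      0 := by
    intro i
    rw [Finset.sum_comm]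
    refine Finset.sum_eq_zero fun j _ => ?_
    rw [← Finset.mul_sum, Finset.sum_sub_distrib, h2]
    simp
  simp only [h3, ← Finset.mul_sum, h1, mul_zero, Finset.sum_const_zero, add_zero]
  field_simp

variable {S : Matrix (Fin n) (Fin n) ℝ}

lemma transpose_sqrt : (CFC.sqrt S).transpose = CFC.sqrt S := by
  have : (CFC.sqrt S).IsHermitian := (CFC.sqrt_nonneg S).isSelfAdjoint
  rw [← Matrix.conjTranspose_eq_transpose_of_trivial]
  exact this

lemma sqrt_mul_sqrt (hS : S.PosDef) : CFC.sqrt S * CFC.sqrt S = S :=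
  CFC.sqrt_mul_sqrt_self S hS.posSemidef.nonneg

lemma isUnit_det_sqrt (hS : S.PosDef) : IsUnit (CFC.sqrt S).det :=
  (Matrix.isUnit_iff_isUnit_det _).1 (isUnit_sqrt hS)

lemma inv_eq_inv_sqrt_mul (hS : S.PosDef) : S⁻¹ = (CFC.sqrt S)⁻¹ * (CFC.sqrt S)⁻¹ := by
  rw [← Matrix.mul_inv_rev, sqrt_mul_sqrt hS]

lemma dotProduct_inv_mulVec_sqrt (hS : S.PosDef) (c : Fin n → ℝ) :
    (CFC.sqrt S).mulVec c ⬝ᵥ S⁻¹.mulVec ((CFC.sqrt S).mulVec c) = ∑ i, c i ^ 2 := by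
  rw [inv_eq_inv_sqrt_mul hS, Matrix.mulVec_mulVec, mul_assoc,
    Matrix.nonsing_inv_mul _ (isUnit_det_sqrt hS), mul_one, ← Matrix.vecMul_transpose,
    transpose_sqrt, ← Matrix.dotProduct_mulVec, Matrix.mulVec_mulVec,
    Matrix.mul_nonsing_inv _ (isUnit_det_sqrt hS), Matrix.one_mulVec]
  exact Finset.sum_congr rfl fun i _ => (sq _).symm

/-- With `x = S^{1/2} y`, the matrix `S⁻¹ x xᵀ - 1` is a conjugate of `y yᵀ - 1`. -/
lemma inv_mul_vecMulVec_sub_one (hS : S.PosDef) (y : Fin n → ℝ) :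
    S⁻¹ * Matrix.vecMulVec ((CFC.sqrt S).mulVec y) ((CFC.sqrt S).mulVec y) - 1 =
      (CFC.sqrt S)⁻¹ * (Matrix.vecMulVec y y - 1) * CFC.sqrt S := by
  have h1 : Matrix.vecMulVec ((CFC.sqrt S).mulVec y) ((CFC.sqrt S).mulVec y) =
      CFC.sqrt S * Matrix.vecMulVec y y * CFC.sqrt S := by
    rw [Matrix.mul_vecMulVec, Matrix.vecMulVec_mul, ← Matrix.vecMul_transpose, transpose_sqrt]
  have h2 := Matrix.nonsing_inv_mul _ (isUnit_det_sqrt hS)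
  rw [h1, inv_eq_inv_sqrt_mul hS, mul_sub, sub_mul, mul_one, h2]
  congr 1
  calc (CFC.sqrt S)⁻¹ * (CFC.sqrt S)⁻¹ * (CFC.sqrt S * Matrix.vecMulVec y y * CFC.sqrt S)
      = (CFC.sqrt S)⁻¹ * ((CFC.sqrt S)⁻¹ * CFC.sqrt S) * Matrix.vecMulVec y y * CFC.sqrt S := by
        simp only [mul_assoc]
    _ = _ := by rw [h2, mul_one]

lemma trace_conj_sq (hS : S.PosDef) {m : Matrix (Fin n) (Fin n) ℝ} (hm : ∀ i j, m i j = m j i) :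
    (((CFC.sqrt S)⁻¹ * m * CFC.sqrt S) ^ 2).trace = ∑ i, ∑ j, m i j ^ 2 := by
  have h2 := Matrix.mul_nonsing_inv _ (isUnit_det_sqrt hS)
  have h1 : ((CFC.sqrt S)⁻¹ * m * CFC.sqrt S) ^ 2 = (CFC.sqrt S)⁻¹ * (m * m) * CFC.sqrt S := by
    calc ((CFC.sqrt S)⁻¹ * m * CFC.sqrt S) ^ 2
        = (CFC.sqrt S)⁻¹ * (m * (CFC.sqrt S * (CFC.sqrt S)⁻¹) * m) * CFC.sqrt S := by
          rw [sq]; simp only [mul_assoc]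
      _ = _ := by rw [h2, mul_one]
  rw [h1, Matrix.trace_mul_cycle, h2, one_mul, Matrix.trace]
  refine Finset.sum_congr rfl fun i _ => ?_
  rw [Matrix.diag_apply, Matrix.mul_apply]
  exact Finset.sum_congr rfl fun j _ => by rw [hm j i, sq]

end Reduction

section Moments

variable {n : ℕ} {S : Matrix (Fin n) (Fin n) ℝ}

lemma meanXf_congr {ν : Measure (EuclideanSpace ℝ (Fin n))} {f f' : EuclideanSpace ℝ (Fin n) → ℝ}
    (h : f =ᵐ[ν] f') : meanXf ν f = meanXf ν f' := by
  ext i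
  exact integral_congr_ae (h.mono fun x hx => by simp only [hx])

lemma meanHessf_congr {ν : Measure (EuclideanSpace ℝ (Fin n))}
    {f f' : EuclideanSpace ℝ (Fin n) → ℝ} (h : f =ᵐ[ν] f') :
    meanHessf ν S f = meanHessf ν S f' := by
  ext i j
  exact integral_congr_ae (h.mono fun x hx => by simp only [hx])

lemma integral_multivariateGaussian {F : EuclideanSpace ℝ (Fin n) → ℝ} (hF : Measurable F) :
    ∫ x, F x ∂(multivariateGaussian 0 S) =
      ∫ y, F (Matrix.toEuclideanCLM (𝕜 := ℝ) (CFC.sqrt S) y)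
        ∂(stdGaussian (EuclideanSpace ℝ (Fin n))) := by
  rw [multivariateGaussian_eq_map]
  exact integral_map (by fun_prop) hF.aestronglyMeasurable

/-- `E[X f(X)]` in terms of the standardized variable `S^{-1/2} X`. -/
lemma meanXf_multivariateGaussian {f : EuclideanSpace ℝ (Fin n) → ℝ} (hf : Measurable f)
    (hint : ∀ i, Integrable (fun y : EuclideanSpace ℝ (Fin n) =>
      f (Matrix.toEuclideanCLM (𝕜 := ℝ) (CFC.sqrt S) y) * y i)
      (stdGaussian (EuclideanSpace ℝ (Fin n)))) :
    meanXf (multivariateGaussian 0 S) f = (CFC.sqrt S).mulVec fun i =>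
      ∫ y, f (Matrix.toEuclideanCLM (𝕜 := ℝ) (CFC.sqrt S) y) * y i
        ∂(stdGaussian (EuclideanSpace ℝ (Fin n))) := by
  ext i
  rw [meanXf, integral_multivariateGaussian (by fun_prop), Matrix.mulVec, dotProduct]
  simp only [← integral_const_mul]
  rw [← integral_finsetSum _ fun j _ => (hint j).const_mul _]
  refine integral_congr_ae (ae_of_all _ fun y => ?_)
  simp only [Matrix.ofLp_toEuclideanCLM, Matrix.mulVec, dotProduct, Finset.sum_mul]
  exact Finset.sum_congr rfl fun j _ => by ring

/-- `E[(S⁻¹ X Xᵀ - I) f(X)]` in terms of the standardized variable `S^{-1/2} X`. -/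
lemma meanHessf_multivariateGaussian (hS : S.PosDef) {f : EuclideanSpace ℝ (Fin n) → ℝ}
    (hf : Measurable f)
    (hint : Integrable (fun y : EuclideanSpace ℝ (Fin n) =>
      f (Matrix.toEuclideanCLM (𝕜 := ℝ) (CFC.sqrt S) y)) (stdGaussian (EuclideanSpace ℝ (Fin n))))
    (hint2 : ∀ i j, Integrable (fun y : EuclideanSpace ℝ (Fin n) =>
      f (Matrix.toEuclideanCLM (𝕜 := ℝ) (CFC.sqrt S) y) * (y i * y j))
      (stdGaussian (EuclideanSpace ℝ (Fin n)))) :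
    meanHessf (multivariateGaussian 0 S) S f = (CFC.sqrt S)⁻¹ * (Matrix.of fun i j =>
      ∫ y, f (Matrix.toEuclideanCLM (𝕜 := ℝ) (CFC.sqrt S) y) * (y i * y j)
        ∂(stdGaussian (EuclideanSpace ℝ (Fin n))) - (if i = j then 1 else 0) *
      ∫ y, f (Matrix.toEuclideanCLM (𝕜 := ℝ) (CFC.sqrt S) y)
        ∂(stdGaussian (EuclideanSpace ℝ (Fin n)))) * CFC.sqrt S := by
  ext i j
  have hm : Measurable fun x : EuclideanSpace ℝ (Fin n) =>
      (S⁻¹ * Matrix.vecMulVec x.ofLp x.ofLp - 1) i j * f x := by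
    simp only [Matrix.sub_apply, Matrix.mul_apply, Matrix.vecMulVec_apply]
    fun_prop
  rw [meanHessf, Matrix.of_apply, integral_multivariateGaussian hm, Matrix.mul_apply]
  simp only [Matrix.ofLp_toEuclideanCLM, inv_mul_vecMulVec_sub_one hS]
  simp only [Matrix.mul_apply, Matrix.of_apply, Matrix.sub_apply, Matrix.vecMulVec_apply,
    Matrix.one_apply]
  have h1 : ∀ k l, Integrable (fun y : EuclideanSpace ℝ (Fin n) =>
      f (Matrix.toEuclideanCLM (𝕜 := ℝ) (CFC.sqrt S) y) * (y k * y l) - (if k = l then 1 else 0) *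
      f (Matrix.toEuclideanCLM (𝕜 := ℝ) (CFC.sqrt S) y))
      (stdGaussian (EuclideanSpace ℝ (Fin n))) := fun k l => (hint2 k l).sub (hint.const_mul _)
  have h2 : ∀ k l, (∫ y, f (Matrix.toEuclideanCLM (𝕜 := ℝ) (CFC.sqrt S) y) * (y k * y l)
        ∂(stdGaussian (EuclideanSpace ℝ (Fin n))) - (if k = l then 1 else 0) *
      ∫ y, f (Matrix.toEuclideanCLM (𝕜 := ℝ) (CFC.sqrt S) y)
        ∂(stdGaussian (EuclideanSpace ℝ (Fin n)))) =
      ∫ y, (f (Matrix.toEuclideanCLM (𝕜 := ℝ) (CFC.sqrt S) y) * (y k * y l) -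
        (if k = l then 1 else 0) * f (Matrix.toEuclideanCLM (𝕜 := ℝ) (CFC.sqrt S) y))
        ∂(stdGaussian (EuclideanSpace ℝ (Fin n))) := fun k l => by
    rw [integral_sub (hint2 k l) (hint.const_mul _), integral_const_mul]
  simp only [h2]
  simp only [← integral_const_mul]
  have h3 : ∀ l, Integrable (fun y : EuclideanSpace ℝ (Fin n) => ∑ k, (CFC.sqrt S)⁻¹ i k *
      (f (Matrix.toEuclideanCLM (𝕜 := ℝ) (CFC.sqrt S) y) * (y k * y l) - (if k = l then 1 else 0) *
      f (Matrix.toEuclideanCLM (𝕜 := ℝ) (CFC.sqrt S) y)))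
      (stdGaussian (EuclideanSpace ℝ (Fin n))) := fun l =>
    integrable_finsetSum _ fun k _ => (h1 k l).const_mul _
  have h4 : ∀ l, ∑ k, ∫ y, (CFC.sqrt S)⁻¹ i k *
      (f (Matrix.toEuclideanCLM (𝕜 := ℝ) (CFC.sqrt S) y) * (y k * y l) - (if k = l then 1 else 0) *
      f (Matrix.toEuclideanCLM (𝕜 := ℝ) (CFC.sqrt S) y)) ∂(stdGaussian (EuclideanSpace ℝ (Fin n))) =
      ∫ y, ∑ k, (CFC.sqrt S)⁻¹ i k *
      (f (Matrix.toEuclideanCLM (𝕜 := ℝ) (CFC.sqrt S) y) * (y k * y l) - (if k = l then 1 else 0) *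
      f (Matrix.toEuclideanCLM (𝕜 := ℝ) (CFC.sqrt S) y))
      ∂(stdGaussian (EuclideanSpace ℝ (Fin n))) := fun l =>
    (integral_finsetSum _ fun k _ => (h1 k l).const_mul _).symm
  simp only [h4, ← integral_mul_const]
  rw [← integral_finsetSum _ fun l _ => (h3 l).mul_const _]
  refine integral_congr_ae (ae_of_all _ fun y => ?_)
  simp only [Finset.sum_mul]
  exact Finset.sum_congr rfl fun l _ => Finset.sum_congr rfl fun k _ => by ring

lemma integrable_comp_sqrt (hS : S.PosDef) {f : EuclideanSpace ℝ (Fin n) → ℝ} (hf : Measurable f)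
    (hint : Integrable (fun x => (1 + ‖x‖) ^ 8 * f x ^ 2) (multivariateGaussian 0 S)) :
    Integrable (fun y => (1 + ‖y‖) ^ 8 *
      f (Matrix.toEuclideanCLM (𝕜 := ℝ) (CFC.sqrt S) y) ^ 2)
      (stdGaussian (EuclideanSpace ℝ (Fin n))) := by
  set R := Matrix.toEuclideanCLM (𝕜 := ℝ) (CFC.sqrt S) with hR
  set R' := Matrix.toEuclideanCLM (𝕜 := ℝ) (CFC.sqrt S)⁻¹ with hR'
  rw [multivariateGaussian_eq_map, integrable_map_measure
    (Measurable.aestronglyMeasurable (by fun_prop)) (by fun_prop)] at hint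
  have h1 : ∀ y, R' (R y) = y := fun y => by
    have : R' * R = 1 := by
      rw [hR, hR', ← map_mul, Matrix.nonsing_inv_mul _ (isUnit_det_sqrt hS), map_one]
    exact congrArg (fun T : EuclideanSpace ℝ (Fin n) →L[ℝ] EuclideanSpace ℝ (Fin n) => T y) this
  refine (hint.const_mul ((1 + ‖R'‖) ^ 8)).mono'
    (Measurable.aestronglyMeasurable (by fun_prop)) (ae_of_all _ fun y => ?_)
  rw [Real.norm_eq_abs, abs_of_nonneg (by positivity), Function.comp_apply, ← mul_assoc, ← mul_pow]
  gcongr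
  have h2 : ‖y‖ ≤ ‖R'‖ * ‖R y‖ := by
    conv_lhs => rw [← h1 y]
    exact R'.le_opNorm _
  nlinarith [norm_nonneg (R y), norm_nonneg R']

end Moments

section Estimator

variable {n N : ℕ} {S : Matrix (Fin n) (Fin n) ℝ}

lemma map_samples {Ω : Type*} [MeasurableSpace Ω] {P : Measure Ω} [IsProbabilityMeasure P]
    {X : ℕ → Ω → EuclideanSpace ℝ (Fin n)}
    (hlaw : ∀ k, HasLaw (X k) (multivariateGaussian 0 S) P) (hindep : iIndepFun X P) :
    P.map (fun ω (k : Fin N) => X k ω) = Measure.pi fun _ => multivariateGaussian 0 S := by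
  have h1 := hindep.precomp (Fin.val_injective (n := N))
  rw [iIndepFun_iff_map_fun_eq_pi_map (f := fun (i : Fin N) => X i)
    fun i => (hlaw i).aemeasurable] at h1
  simpa only [(hlaw _).map_eq] using h1

/-- Almost surely, the estimator is a constant plus the average over the standardized samples of the
component of the integrand that is orthogonal to the quadratic polynomials. -/
lemma ae_matchedEstimator_eq (hS : S.PosDef) (hN : n + 5 ≤ N)
    {f f' : EuclideanSpace ℝ (Fin n) → ℝ} (hff' : f =ᵐ[multivariateGaussian 0 S] f')
    (c₀ : ℝ) (c : Fin n → ℝ) (m : Matrix (Fin n) (Fin n) ℝ) :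
    ∀ᵐ x ∂(Measure.pi fun _ : Fin N => multivariateGaussian 0 S),
      matchedEstimator f 0 S x = (N : ℝ)⁻¹ * ∑ k,
        (f' (Matrix.toEuclideanCLM (𝕜 := ℝ) (CFC.sqrt S) (stdSample x k)) -
          quadraticPoly c₀ c m (stdSample x k)) + c₀ := by
  rw [multivariateGaussian_eq_map] at hff'
  have h1 := ae_stdSample (N := N) hS hN (ae_of_ae_map (by fun_prop) hff')
  filter_upwards [h1, ae_isUnit_sampleCov (multivariateGaussian_absolutelyContinuous hS)
    (by omega : n + 1 ≤ N)] with x hx hunit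
  have h2 := average_quadraticPoly (by omega : 0 < N) hunit c₀ c m
  rw [Finset.sum_sub_distrib, mul_sub, h2, sub_add_cancel, matchedEstimator]
  simp only [matchedSample_zero, hx]

lemma inv_isBigO_rpow : (fun N : ℕ => (N : ℝ)⁻¹) =O[atTop] fun N : ℕ => (N : ℝ) ^ (-(1 / 2) : ℝ) := by
  refine IsBigO.of_bound 1 ?_
  filter_upwards [eventually_ge_atTop 1] with N hN
  have h1 : (1 : ℝ) ≤ N := by exact_mod_cast hN
  rw [one_mul, Real.norm_eq_abs, Real.norm_eq_abs, abs_of_nonneg (by positivity),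
    abs_of_nonneg (by positivity), ← Real.rpow_neg_one]
  exact Real.rpow_le_rpow_of_exponent_le h1 (by norm_num)

/-- The variance constant of the estimator is the squared `L²` distance of the integrand from the
quadratic polynomials. -/
lemma integral_residual_sq_eq (hS : S.PosDef) {f : EuclideanSpace ℝ (Fin n) → ℝ} (hf : Measurable f)
    {φ : EuclideanSpace ℝ (Fin n) → ℝ}
    (hφdef : φ = fun y => f (Matrix.toEuclideanCLM (𝕜 := ℝ) (CFC.sqrt S) y)) (hφ : Measurable φ)
    (hint : Integrable (fun y => (1 + ‖y‖) ^ 8 * φ y ^ 2) (stdGaussian (EuclideanSpace ℝ (Fin n)))) :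
    ∃ c₀ c m,
      Integrable (fun x => (1 + ‖x‖) ^ 8 * (φ x - quadraticPoly c₀ c m x) ^ 2)
        (stdGaussian (EuclideanSpace ℝ (Fin n))) ∧
      ∫ x, (φ x - quadraticPoly c₀ c m x) ∂(stdGaussian (EuclideanSpace ℝ (Fin n))) = 0 ∧
      (∀ y, ∫ x, (φ x - quadraticPoly c₀ c m x) * (1 + ⟪y, x⟫) ^ 2
        ∂(stdGaussian (EuclideanSpace ℝ (Fin n))) = 0) ∧
      ∫ x, (φ x - quadraticPoly c₀ c m x) ^ 2 ∂(stdGaussian (EuclideanSpace ℝ (Fin n))) =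
        variance f (multivariateGaussian 0 S)
          - dotProduct (meanXf (multivariateGaussian 0 S) f)
              (S⁻¹.mulVec (meanXf (multivariateGaussian 0 S) f))
          - 1 / 2 * Matrix.trace (meanHessf (multivariateGaussian 0 S) S f ^ 2) := by
  set γ := stdGaussian (EuclideanSpace ℝ (Fin n))
  have h1 : ∀ x : EuclideanSpace ℝ (Fin n), 1 ≤ 1 + ‖x‖ := fun x => by linarith [norm_nonneg x]
  have hφ6 := (integrable_mul_pow_of_sq hφ hint).2
  have i0 : Integrable φ γ := by
    simpa using integrable_mul_of_le_one_add_norm_pow hφ hφ6 (q := fun _ => 1) (by fun_prop)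
      (D := 1) (fun x => by rw [abs_one, one_mul]; exact one_le_pow₀ (h1 x))
  have i1 : ∀ i, Integrable (fun x => φ x * x i) γ := fun i =>
    integrable_mul_of_le_one_add_norm_pow hφ hφ6 (q := fun x => x i) (by fun_prop) (D := 1)
      (fun x => by
        rw [one_mul]; exact (abs_coord_le x i).trans (le_self_pow₀ (h1 x) (by norm_num)))
  have i2 : ∀ i j, Integrable (fun x => φ x * (x i * x j)) γ := fun i j =>
    integrable_mul_of_le_one_add_norm_pow hφ hφ6 (q := fun x => x i * x j) (by fun_prop) (D := 1)
      (fun x => by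
        rw [one_mul]
        exact (abs_coord_mul_coord_le x i j).trans (pow_le_pow_right₀ (h1 x) (by norm_num)))
  have i3 : MemLp φ 2 γ := by
    refine (memLp_two_iff_integrable_sq hφ.aestronglyMeasurable).2 (hint.mono' (by fun_prop)
      (ae_of_all _ fun x => ?_))
    rw [Real.norm_eq_abs, abs_of_nonneg (sq_nonneg _)]
    exact le_mul_of_one_le_left (sq_nonneg _) (one_le_pow₀ (h1 x))
  set c₀ := ∫ x, φ x ∂γ with hc₀
  set c : Fin n → ℝ := fun i => ∫ x, φ x * x i ∂γ with hc
  set m : Matrix (Fin n) (Fin n) ℝ := Matrix.of fun i j =>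
    ∫ x, φ x * (x i * x j) ∂γ - (if i = j then 1 else 0) * c₀ with hm
  have hsymm : ∀ i j, m i j = m j i := fun i j => by
    simp only [hm, Matrix.of_apply, mul_comm, eq_comm]
  obtain ⟨r1, r2, r3, r4⟩ := exists_residual hφ hint (c₀ := c₀) (c := c) (m := m) rfl
    (fun _ => rfl) (fun _ _ => rfl)
  refine ⟨c₀, c, m, r1, r2, r3, r4.trans ?_⟩
  have e1 : variance f (multivariateGaussian 0 S) = ∫ x, φ x ^ 2 ∂γ - c₀ ^ 2 := by
    rw [multivariateGaussian_eq_map, variance_map hf.aemeasurable (by fun_prop)]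
    have : f ∘ (Matrix.toEuclideanCLM (𝕜 := ℝ) (CFC.sqrt S)) = φ := hφdef.symm
    rw [this, variance_eq_sub i3]
    rfl
  have e2 : meanXf (multivariateGaussian 0 S) f = (CFC.sqrt S).mulVec c := by
    subst hφdef
    exact meanXf_multivariateGaussian hf i1
  have e3 : meanHessf (multivariateGaussian 0 S) S f = (CFC.sqrt S)⁻¹ * m * CFC.sqrt S := by
    subst hφdef
    exact meanHessf_multivariateGaussian hS hf i0 i2
  rw [e1, e2, e3, dotProduct_inv_mulVec_sqrt hS, trace_conj_sq hS hsymm]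

end Estimator

end MomentMatching

theorem proposition2 {n : ℕ} (S : Matrix (Fin n) (Fin n) ℝ) (hS : S.PosDef)
    (f : EuclideanSpace ℝ (Fin n) → ℝ) (hf : NullMeasurable f volume)
    (hint : Integrable (fun x => (1 + ‖x‖) ^ 8 * f x ^ 2) (multivariateGaussian 0 S))
    {Ω : Type*} [MeasurableSpace Ω] (P : Measure Ω) [IsProbabilityMeasure P]
    (X : ℕ → Ω → EuclideanSpace ℝ (Fin n))
    (hlaw : ∀ k, HasLaw (X k) (multivariateGaussian 0 S) P)
    (hindep : iIndepFun X P) :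
    ∃ A : ℕ → ℝ,
      (fun N : ℕ => A N - 1) =O[atTop] (fun N : ℕ => (N : ℝ) ^ (-(1 / 2) : ℝ)) ∧
      ∀ᶠ N : ℕ in atTop,
        MemLp (fun ω => MomentMatching.matchedEstimator f 0 S (fun k : Fin N => X k ω)) 2 P ∧
        variance (fun ω => MomentMatching.matchedEstimator f 0 S (fun k : Fin N => X k ω)) P =
          A N / N *
            (variance f (multivariateGaussian 0 S)
              - dotProduct (MomentMatching.meanXf (multivariateGaussian 0 S) f)
                  (S⁻¹.mulVec (MomentMatching.meanXf (multivariateGaussian 0 S) f))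
              - 1 / 2 * Matrix.trace
                  (MomentMatching.meanHessf (multivariateGaussian 0 S) S f ^ 2)) := by
  -- the Lebesgue measurable `f` has a Borel version; the estimator is almost surely not affected,
  -- since the law of a matched sample is absolutely continuous
  obtain ⟨f', hf', hff'⟩ : ∃ f', Measurable f' ∧ f =ᵐ[multivariateGaussian 0 S] f' :=
    ⟨_, hf.aemeasurable.measurable_mk,
      (MomentMatching.multivariateGaussian_absolutelyContinuous hS).ae_eq hf.aemeasurable.ae_eq_mk⟩
  have hint' : Integrable (fun x => (1 + ‖x‖) ^ 8 * f' x ^ 2) (multivariateGaussian 0 S) :=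
    hint.congr (hff'.mono fun x hx => by simp only [hx])
  rw [variance_congr hff', MomentMatching.meanXf_congr hff', MomentMatching.meanHessf_congr hff']
  obtain ⟨φ, hφ⟩ : ∃ φ, φ = fun y => f' (Matrix.toEuclideanCLM (𝕜 := ℝ) (CFC.sqrt S) y) := ⟨_, rfl⟩
  have hφm : Measurable φ := by rw [hφ]; fun_prop
  obtain ⟨c₀, c, m, r1, r2, r3, r4⟩ := MomentMatching.integral_residual_sq_eq hS hf' hφ hφm
    (by rw [hφ]; exact MomentMatching.integrable_comp_sqrt hS hf' hint')
  rw [← r4]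
  have hgm : Measurable fun y => φ y - MomentMatching.quadraticPoly c₀ c m y := by fun_prop
  obtain ⟨C, hC⟩ := MomentMatching.exists_variance_average_stdSample hS hgm r1 r2 r3
  set v := ∫ x, (φ x - MomentMatching.quadraticPoly c₀ c m x) ^ 2
    ∂(stdGaussian (EuclideanSpace ℝ (Fin n)))
  obtain ⟨V, hV⟩ : ∃ V : (N : ℕ) → (Fin N → EuclideanSpace ℝ (Fin n)) → ℝ, ∀ N, V N = fun x =>
    (N : ℝ)⁻¹ * ∑ k, (φ (MomentMatching.stdSample x k) -
      MomentMatching.quadraticPoly c₀ c m (MomentMatching.stdSample x k)) :=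
    ⟨_, fun _ => rfl⟩
  simp only [← hV] at hC
  -- for `v ≠ 0` the constant `A_N` is determined by the formula; for `v = 0` the variance vanishes
  -- and any value will do
  refine ⟨fun N => if v = 0 then 1 else
    N * variance (V N) (Measure.pi fun _ => multivariateGaussian 0 S) / v, ?_, ?_⟩
  · by_cases hv : v = 0
    · simp only [hv, if_true, sub_self]
      exact isBigO_zero _ _
    · simp only [hv, if_false]
      refine IsBigO.trans (IsBigO.of_bound (C / |v|) ?_) MomentMatching.inv_isBigO_rpow
      filter_upwards [hC] with N hN
      have h1 := hN.2.1
      rw [div_sub_one hv, norm_div, Real.norm_eq_abs, Real.norm_eq_abs, Real.norm_eq_abs,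
        abs_of_nonneg (by positivity : (0 : ℝ) ≤ (N : ℝ)⁻¹), div_mul_eq_mul_div]
      gcongr
      exact h1
  · filter_upwards [hC, eventually_ge_atTop (n + 5)] with N hN hn
    have hmap := MomentMatching.map_samples (N := N) hlaw hindep
    have hXm : AEMeasurable (fun ω (k : Fin N) => X k ω) P :=
      aemeasurable_pi_iff.2 fun k => (hlaw k).aemeasurable
    have hVm : Measurable (V N) := by
      rw [hV]
      exact (Finset.measurable_fun_sum _ fun k _ =>
        hgm.comp (MomentMatching.measurable_stdSample k)).const_mul _
    have hae : (fun ω => MomentMatching.matchedEstimator f 0 S (fun k : Fin N => X k ω)) =ᵐ[P]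
        fun ω => V N (fun k : Fin N => X k ω) + c₀ := by
      have h1 := MomentMatching.ae_matchedEstimator_eq (N := N) hS hn hff' c₀ c m
      rw [← hmap] at h1
      refine (ae_of_ae_map hXm h1).mono fun ω hω => ?_
      beta_reduce
      rw [hω, hV, hφ]
    have hLp : MemLp (fun ω => V N (fun k : Fin N => X k ω)) 2 P := by
      have h1 := hN.1
      rw [← hmap, memLp_map_measure_iff hVm.aestronglyMeasurable hXm] at h1
      exact h1
    refine ⟨(memLp_congr_ae hae).2 (hLp.add (memLp_const c₀)), ?_⟩
    have hvar : variance (fun ω => MomentMatching.matchedEstimator f 0 S (fun k : Fin N => X k ω)) P =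
        variance (V N) (Measure.pi fun _ => multivariateGaussian 0 S) := by
      rw [variance_congr hae, variance_add_const hLp.aestronglyMeasurable, ← hmap,
        variance_map hVm.aemeasurable hXm]
      rfl
    rw [hvar]
    have hN0 : (N : ℝ) ≠ 0 := by
      have : 0 < N := by omega
      positivity
    split_ifs with hv
    · rw [hN.2.2 hv, hv, mul_zero]
    · field_simp
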